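/- Throughout, directed graphs are finite, and $n$ and $m$ denote the numbers of vertices and arcs of $G$. Let $G$ be a directed graph and $A,B\subseteq V(G)$ disjoint. A set $X\subseteq V(G)$ (which may meet $A\cup B$) is an *$A$-$B$ separator* (or $A$-$B$ vertex cut) if $G\setminus X$ contains no directed path from a vertex of $A$ to a vertex of $B$; let $R_A^G(X)$ be the set of vertices reachable from $A$ in $G\setminus X$. An $A$-$B$ separator $X$ is *important* if it is inclusion-wise minimal and there is no $A$-$B$ separator $Y\subseteq V(G)$ with $|Y|\le|X|$ and $R_A^G(X)\subsetneq R_A^G(Y)$. For $T\subseteq V(G)$ and an integer $c$, a directed graph $G'$ with $T\subseteq V(G')$ is a *$(c,T)$ vertex cut sparsifier* for $G$ if for every partition $T=A\cup B$, $A\cap B=\emptyset$ (parts may be empty), such that the minimum size of an $A$-$B$ vertex cut in $G$ is at most $c$, the minimum sizes of an $A$-$B$ vertex cut in $G$ and in $G'$ are equal. Write $\binom{x}{\le a}=\sum_{i=1}^{a}\binom{x}{i}$. **Theorem.** There is a function $\psi(t,c)=\binom{t}{\le 3c}\cdot 2^{O(c)}$ and a deterministic algorithm (on a random access machine) which, given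 a directed graph $G$, a set of terminals $T\subseteq V(G)$ and an integer $c\ge 1$, runs in time $O(\psi(|T|,c)\cdot(m+n))$ (in time $O(1)$ if $T=\emptyset$) and computes a $(c,T)$ vertex cut sparsifier $G'$ for $G$ with at most $\psi(|T|,c)$ vertices and with $T\subseteq V(G')\subseteq V(G)$. Moreover, for every partition $T=A\cup B$, $A\cap B=\emptyset$, and every $X\subseteq V(G)$ with $|X|\le c$: $X$ is an important $A$-$B$ separator in $G$ if and only if $X\subseteq V(G')$ and $X$ is an important $A$-$B$ separator in $G'$. -/

import Mathlib

/-! ### Finite directed graphs -/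

/-- A finite directed graph: a finite vertex set and a finite set of arcs between its vertices.
An element `(u, v)` of `arcs` is the arc from `u` to `v`. -/
structure FinDigraph (α : Type*) where
  verts : Finset α
  arcs : Finset (α × α)
  fst_mem : ∀ e ∈ arcs, e.1 ∈ verts
  snd_mem : ∀ e ∈ arcs, e.2 ∈ verts

namespace FinDigraph

variable {α : Type*} [DecidableEq α]

/-- `G \ X`: delete the vertices in `X` together with all incident arcs. -/
def deleteVerts (G : FinDigraph α) (X : Finset α) : FinDigraph α where
  verts := G.verts \ X
  arcs := G.arcs.filter fun e => e.1 ∉ X ∧ e.2 ∉ X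
  fst_mem := fun e he => by
    rw [Finset.mem_filter] at he
    exact Finset.mem_sdiff.2 ⟨G.fst_mem e he.1, he.2.1⟩
  snd_mem := fun e he => by
    rw [Finset.mem_filter] at he
    exact Finset.mem_sdiff.2 ⟨G.snd_mem e he.1, he.2.2⟩

/-- There is a (possibly trivial) directed path from the vertex `u` to `v` in `G`. -/
def Reachable (G : FinDigraph α) (u v : α) : Prop :=
  u ∈ G.verts ∧ Relation.ReflTransGen (fun x y => (x, y) ∈ G.arcs) u v

/-- The set `R_S(X)` of the vertices reachable from some vertex of `S` in `G \ X`. -/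
def reachSet (G : FinDigraph α) (S X : Finset α) : Set α :=
  {v | ∃ s ∈ S, (G.deleteVerts X).Reachable s v}

/-- `X ⊆ V(G)` is an `A`-`B` separator (or vertex cut); it may contain vertices of `A` and `B`. -/
def IsSeparator (G : FinDigraph α) (A B X : Finset α) : Prop :=
  X ⊆ G.verts ∧ ∀ a ∈ A, ∀ b ∈ B, ¬ (G.deleteVerts X).Reachable a b

/-- Inclusion-wise minimal `A`-`B` separators. -/
def IsMinimalSeparator (G : FinDigraph α) (A B X : Finset α) : Prop :=
  G.IsSeparator A B X ∧ ∀ v ∈ X, ¬ G.IsSeparator A B (X.erase v)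

/-- Important `A`-`B` separators. -/
def IsImportantSeparator (G : FinDigraph α) (A B X : Finset α) : Prop :=
  G.IsMinimalSeparator A B X ∧
    ∀ Y : Finset α, G.IsSeparator A B Y → Y.card ≤ X.card →
      ¬ G.reachSet A X ⊂ G.reachSet A Y

/-- `V(G)` is always an `A`-`B` separator, so that the infimum in `minCutSize` is a minimum. -/
theorem isSeparator_verts (G : FinDigraph α) (A B : Finset α) : G.IsSeparator A B G.verts :=
  ⟨Finset.Subset.refl _, fun a _ b _ h => by simpa [deleteVerts] using h.1⟩

/-- The size of a minimum `A`-`B` vertex cut. -/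
noncomputable def minCutSize (G : FinDigraph α) (A B : Finset α) : ℕ :=
  sInf {k | ∃ X : Finset α, G.IsSeparator A B X ∧ X.card = k}

/-- `H` is a `(c, T)` vertex cut sparsifier for `G`. -/
def IsVertexCutSparsifier (G : FinDigraph α) (T : Finset α) (c : ℕ) (H : FinDigraph α) : Prop :=
  T ⊆ H.verts ∧
    ∀ A B : Finset α, A ∪ B = T → Disjoint A B →
      G.minCutSize A B ≤ c → H.minCutSize A B = G.minCutSize A B

end FinDigraph

/-- `∑_{i=1}^{a} (n choose i)`. -/
def chooseLE (n a : ℕ) : ℕ := ∑ i ∈ Finset.Icc 1 a, n.choose i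

/-! ### The machine model

A random access machine with registers `0, 1, 2, …` and arrays `0, 1, 2, …`, all holding natural
numbers; a program is a finite structured program, so it mentions only finitely many registers and
arrays. Every instruction and every evaluation of a test takes one step. The arithmetic
instructions are successor and truncated subtraction only, so within `t` steps no number can
exceed the largest number in the input or the program by more than `t`: unit cost gives this
machine nothing that a word RAM does not have. -/

namespace RAM

/-- The memory: `reg x` is the content of register `x`, `arr a i` that of cell `i` of array `a`. -/
structure State where
  reg : ℕ → ℕ
  arr : ℕ → ℕ → ℕ

namespace State

/-- Write `k` into register `x`. -/
def setReg (s : State) (x k : ℕ) : State :=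
  { s with reg := Function.update s.reg x k }

/-- Write `k` into cell `i` of array `a`. -/
def setArr (s : State) (a i k : ℕ) : State :=
  { s with arr := Function.update s.arr a (Function.update (s.arr a) i k) }

end State

/-- Tests compare the contents of two registers. -/
inductive Test where
  | eq (x y : ℕ)
  | ne (x y : ℕ)
  | lt (x y : ℕ)
  | le (x y : ℕ)

/-- The test holds in the state `s`. -/
def Test.Holds : Test → State → Prop
  | eq x y, s => s.reg x = s.reg y
  | ne x y, s => s.reg x ≠ s.reg y
  | lt x y, s => s.reg x < s.reg y
  | le x y, s => s.reg x ≤ s.reg y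

/-- Programs. -/
inductive Prog where
  /-- do nothing -/
  | skip
  /-- `reg x := k` for a constant `k` -/
  | const (x k : ℕ)
  /-- `reg x := reg y` -/
  | copy (x y : ℕ)
  /-- `reg x := reg y + 1` -/
  | succ (x y : ℕ)
  /-- `reg x := reg y - reg z` (truncated at `0`) -/
  | sub (x y z : ℕ)
  /-- `reg x := arr a (reg i)` -/
  | load (x a i : ℕ)
  /-- `arr a (reg i) := reg x` -/
  | store (a i x : ℕ)
  /-- `p; q` -/
  | seq (p q : Prog)
  /-- `if b then p else q` -/
  | cond (b : Test) (p q : Prog)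
  /-- `while b do p` -/
  | loop (b : Test) (p : Prog)

/-- `Run p s t s'`: started in state `s`, the program `p` halts after exactly `t` steps, in state
`s'`. -/
inductive Run : Prog → State → ℕ → State → Prop
  | skip (s : State) : Run .skip s 1 s
  | const (x k : ℕ) (s : State) : Run (.const x k) s 1 (s.setReg x k)
  | copy (x y : ℕ) (s : State) : Run (.copy x y) s 1 (s.setReg x (s.reg y))
  | succ (x y : ℕ) (s : State) : Run (.succ x y) s 1 (s.setReg x (s.reg y + 1))
  | sub (x y z : ℕ) (s : State) : Run (.sub x y z) s 1 (s.setReg x (s.reg y - s.reg z))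
  | load (x a i : ℕ) (s : State) : Run (.load x a i) s 1 (s.setReg x (s.arr a (s.reg i)))
  | store (a i x : ℕ) (s : State) : Run (.store a i x) s 1 (s.setArr a (s.reg i) (s.reg x))
  | seq {p q : Prog} {s s₁ s₂ : State} {t₁ t₂ : ℕ} :
      Run p s t₁ s₁ → Run q s₁ t₂ s₂ → Run (.seq p q) s (t₁ + t₂) s₂
  | cond_true {b : Test} {p q : Prog} {s s₁ : State} {t : ℕ} :
      b.Holds s → Run p s t s₁ → Run (.cond b p q) s (t + 1) s₁
  | cond_false {b : Test} {p q : Prog} {s s₁ : State} {t : ℕ} :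
      ¬ b.Holds s → Run q s t s₁ → Run (.cond b p q) s (t + 1) s₁
  | loop_true {b : Test} {p : Prog} {s s₁ s₂ : State} {t₁ t₂ : ℕ} :
      b.Holds s → Run p s t₁ s₁ → Run (.loop b p) s₁ t₂ s₂ →
        Run (.loop b p) s (t₁ + t₂ + 1) s₂
  | loop_false {b : Test} {p : Prog} {s : State} :
      ¬ b.Holds s → Run (.loop b p) s 1 s

/-- The machine is deterministic: the program and the initial state determine the number of steps
and the final state. -/
theorem Run.deterministic {p : Prog} {s s₁ s₂ : State} {t₁ t₂ : ℕ}
    (h₁ : Run p s t₁ s₁) (h₂ : Run p s t₂ s₂) : t₁ = t₂ ∧ s₁ = s₂ := by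
  induction h₁ generalizing t₂ s₂ with
  | seq _ _ ih₁ ih₂ =>
    cases h₂ with
    | seq k₁ k₂ =>
      obtain ⟨rfl, rfl⟩ := ih₁ k₁
      obtain ⟨rfl, rfl⟩ := ih₂ k₂
      exact ⟨rfl, rfl⟩
  | cond_true hb _ ih =>
    cases h₂ with
    | cond_true _ k =>
      obtain ⟨rfl, rfl⟩ := ih k
      exact ⟨rfl, rfl⟩
    | cond_false hn _ => exact absurd hb hn
  | cond_false hb _ ih =>
    cases h₂ with
    | cond_true hn _ => exact absurd hn hb
    | cond_false _ k =>
      obtain ⟨rfl, rfl⟩ := ih k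
      exact ⟨rfl, rfl⟩
  | loop_true hb _ _ ih₁ ih₂ =>
    cases h₂ with
    | loop_true _ k₁ k₂ =>
      obtain ⟨rfl, rfl⟩ := ih₁ k₁
      obtain ⟨rfl, rfl⟩ := ih₂ k₂
      exact ⟨rfl, rfl⟩
    | loop_false hn => exact absurd hb hn
  | loop_false hb =>
    cases h₂ with
    | loop_true hn _ _ => exact absurd hn hb
    | loop_false _ => exact ⟨rfl, rfl⟩
  | _ => cases h₂; exact ⟨rfl, rfl⟩

/-- The initial state on the input consisting of `n` vertices `0, …, n - 1`, the list `es` of the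
arcs, the list `ts` of the terminals and the number `c`. Registers `0, 1, 2, 3` hold `n`, the
number of arcs, the number of terminals and `c`; arrays `0, 1` hold the tails and the heads of the
arcs, array `2` the terminals. Everything else is `0`. -/
def inputState (n : ℕ) (es : List (ℕ × ℕ)) (ts : List ℕ) (c : ℕ) : State where
  reg
    | 0 => n
    | 1 => es.length
    | 2 => ts.length
    | 3 => c
    | _ => 0
  arr
    | 0, i => (es.map Prod.fst).getD i 0
    | 1, i => (es.map Prod.snd).getD i 0
    | 2, i => ts.getD i 0
    | _, _ => 0

/-- The state `s` holds the graph `H` as output: registers `4, 5` hold the numbers of vertices and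
of arcs of `H`, array `3` lists the vertices and arrays `4, 5` list the tails and the heads of the
arcs, each vertex and each arc exactly once. -/
def Outputs (s : State) (H : FinDigraph ℕ) : Prop :=
  ((List.range (s.reg 4)).map (s.arr 3)).Nodup ∧
  ((List.range (s.reg 4)).map (s.arr 3)).toFinset = H.verts ∧
  ((List.range (s.reg 5)).map fun i => (s.arr 4 i, s.arr 5 i)).Nodup ∧
  ((List.range (s.reg 5)).map fun i => (s.arr 4 i, s.arr 5 i)).toFinset = H.arcs

end RAM

/-! The output is a torso of `G` on a vertex set `K` that contains `T` and every important separator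
of size at most `c` of every partition of `T`. A torso does not change reachability between vertices
of `K` when a subset of `K` is deleted (`IsTorso.mem_reachSet_iff`), so it has the same separators
inside `K`. Every separator can be pushed to an important one that is no larger and reaches no less
(`exists_isImportantSeparator`). Hence minimum cut sizes up to `c` and important separators up to
size `c` agree in both graphs. What remains is to find a small `K` quickly.

Few terminals determine an important separator. Let `Z` be an important `A`-`B` separator with `|Z|
≤ c` and let `R₀` be its reach set. By importance, `Z` is the only separator of size at most `|Z|`
between `R₀ ∪ Z` and `B` that keeps `R₀` on the source side (`IsImportantSeparator.isTight`). At
most `|Z|` vertices of `A` suffice to reach all of `Z` (`IsMinimalSeparator.exists_small_source`),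
and at most `2 * |Z|` vertices of `B` certify the uniqueness (`IsTight.exists_small_sink`): the ends
of `|Z|` disjoint paths, and for each `z ∈ Z` the end of one residual walk. So it is enough to try
all ways of labelling at most `3 * c` terminals as sources or sinks, which accounts for the binomial
sum and for a factor `2 ^ (3 * c)`.

For fixed sources and sinks a search tree is explored. A node forces a set `D` into the separator
and a set `R` onto the source side. Its minimum separator `X ∪ D` furthest from the sources is
computed and `X` is added to `K`. If `D ⊆ Z` and `R ⊆ R₀`, uncrossing with `Z`
(`IsSeparation.uncross`) shows `X ⊆ Z ∪ R₀`, so for any `x ∈ X` one of the branches "put `x` into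
`D`" and "put `x` into `R`" is consistent with `Z`. The second branch raises the minimum because the
cut was the furthest one. Therefore `|R| ≤ |Z| ≤ c` along the consistent path, `|D| ≤ |Z| ≤ c` as
well, and after at most `2 * c` levels `D = Z`; all of `D` was collected in `K` on the way
(`FinDigraph.subset_of_branching`).

The cut of a node comes from at most `c` augmentations of a flow by breadth-first search. The search
runs backwards from the sinks, so that the cut it leaves behind is the one furthest from the sources
(`isFurthestCut_of_flow`). The size of the tree is controlled by weights assigned to its nodes
(`exec_grow`), and one backward search per kept vertex then lists the arcs of the torso
(`exec_torso`). -/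

/-! ### Vertex-disjoint paths as matchings

A family of vertex-disjoint paths from `Src` to `Snk` is encoded by a map `M`, where `M w` is the
vertex whose outgoing half is matched to the incoming half of `w`: the predecessor of `w` on its
path, or `w` itself if no path uses `w`, or `none` if a path starts at `w`. -/

section Flow

variable {α : Type*}

/-- `M` restricted to `W` is a matching whose unmatched incoming halves lie in `Src` and whose
unmatched outgoing halves lie in `Snk`. -/
structure IsFlow (E : α → α → Prop) (V W Src Snk : Finset α) (M : α → Option α) : Prop where
  src : ∀ w ∈ W, M w = none → w ∈ Src
  mem : ∀ w ∈ W, ∀ u, M w = some u → u ∈ V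
  edge : ∀ w ∈ W, ∀ u, M w = some u → u = w ∨ E u w
  inj : ∀ w ∈ W, ∀ w' ∈ W, ∀ u, M w = some u → M w' = some u → w = w'
  snk : ∀ u ∈ V, (∀ w ∈ W, M w ≠ some u) → u ∈ Snk

/-- The number of paths. -/
def flowValue (W : Finset α) (M : α → Option α) : ℕ := (W.filter fun w => M w = none).card

variable {E : α → α → Prop} {V W Src Snk : Finset α} {M : α → Option α}

theorem IsFlow.of_id : IsFlow E V V Src Snk (fun v => some v) where
  src := by simp
  mem := by rintro w hw u ⟨⟩; exact hw
  edge := by rintro w hw u ⟨⟩; exact Or.inl rfl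
  inj := by rintro w _ w' _ u ⟨⟩ ⟨⟩; rfl
  snk := fun u hu h => absurd rfl (h u hu)

theorem flowValue_id : flowValue V (fun v => some v) = 0 := by simp [flowValue]

theorem IsFlow.congr {M' : α → Option α} (h : IsFlow E V W Src Snk M) (e : ∀ w ∈ W, M' w = M w) :
    IsFlow E V W Src Snk M' where
  src w hw := e w hw ▸ h.src w hw
  mem w hw := e w hw ▸ h.mem w hw
  edge w hw := e w hw ▸ h.edge w hw
  inj w hw w' hw' := by rw [e w hw, e w' hw']; exact h.inj w hw w' hw'
  snk u hu h' := h.snk u hu fun w hw => e w hw ▸ h' w hw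

theorem flowValue_congr {M' : α → Option α} (e : ∀ w ∈ W, M' w = M w) :
    flowValue W M' = flowValue W M := by
  unfold flowValue
  congr 1
  exact Finset.filter_congr fun w hw => by rw [e w hw]

/-! ### Alternating walks, cuts and duality -/

/-- One step of an alternating walk. -/
def AltStep (E : α → α → Prop) (M : α → Option α) (p w : α) : Prop :=
  ∃ u, M p = some u ∧ (u = w ∨ E u w)

/-- `w` is the end of an alternating walk of length `k`. -/
def AltReach (E : α → α → Prop) (V Src : Finset α) (M : α → Option α) : ℕ → α → Prop
  | 0, w => w ∈ Src
  | k + 1, w => w ∈ V ∧ ∃ p, AltReach E V Src M k p ∧ AltStep E M p w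

theorem AltReach.mem (hS : Src ⊆ V) {k : ℕ} {w : α} (h : AltReach E V Src M k w) : w ∈ V := by
  cases k with
  | zero => exact hS h
  | succ k => exact h.1

variable [DecidableEq α]

/-- `Y` separates `Src` from `Snk`, and `P` is the source side. -/
structure IsCut (E : α → α → Prop) (V Src Snk P Y : Finset α) : Prop where
  left_subset : P ⊆ V
  right_subset : Y ⊆ V
  disj : Disjoint P Y
  src : Src ⊆ P ∪ Y
  snk : Disjoint P Snk
  closed : ∀ u ∈ P, ∀ w ∈ V, E u w → w ∈ P ∪ Y

/-- A vertex of `P` is no sink, so its outgoing half is matched, and by closedness its partner lies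
in `P ∪ Y`. Unmatched incoming halves are sources and also lie in `P ∪ Y`. Counting the incoming
halves in `P ∪ Y` gives `|P| + flowValue ≤ |P| + |Y|`. The second part is complementary slackness:
in a tight cut nothing in `P ∪ Y` is matched outside `P`, so residual walks cannot leave `P ∪ Y`. -/
theorem IsFlow.weak_duality (hM : IsFlow E V V Src Snk M) {P Y : Finset α}
    (hc : IsCut E V Src Snk P Y) :
    flowValue V M ≤ Y.card ∧
      (Y.card ≤ flowValue V M → ∀ w ∈ P ∪ Y, ∀ u, M w = some u → u ∈ P) := by
  set U := (P ∪ Y).filter fun w => M w ≠ none with hU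
  set I := U.image fun w => (M w).getD w with hI
  have hPI : P ⊆ I := by
    intro u hu
    have huS : u ∉ Snk := Finset.disjoint_left.1 hc.snk hu
    have : ∃ w ∈ V, M w = some u := by
      by_contra hcon
      push Not at hcon
      exact huS (hM.snk u (hc.left_subset hu) hcon)
    obtain ⟨w, hw, hwu⟩ := this
    have hwPY : w ∈ P ∪ Y := by
      rcases hM.edge w hw u hwu with rfl | h
      · exact Finset.mem_union_left _ hu
      · exact hc.closed u hu w hw h
    exact Finset.mem_image.2 ⟨w, Finset.mem_filter.2 ⟨hwPY, by simp [hwu]⟩, by simp [hwu]⟩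
  have hPV : P ∪ Y ⊆ V := Finset.union_subset hc.left_subset hc.right_subset
  have hk : flowValue V M = ((P ∪ Y).filter fun w => M w = none).card := by
    unfold flowValue
    congr 1
    ext w
    simp only [Finset.mem_filter]
    exact ⟨fun h => ⟨hc.src (hM.src w h.1 h.2), h.2⟩, fun h => ⟨hPV h.1, h.2⟩⟩
  have hsplit : ((P ∪ Y).filter fun w => M w = none).card + U.card = P.card + Y.card := by
    rw [hU, Finset.card_filter_add_card_filter_not, Finset.card_union_of_disjoint hc.disj]
  have h1 := Finset.card_le_card hPI
  have h2 : I.card ≤ U.card := Finset.card_image_le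
  refine ⟨by omega, fun hle w hw u hwu => ?_⟩
  have : P = I := Finset.eq_of_subset_of_card_le hPI (by omega)
  rw [this]
  exact Finset.mem_image.2 ⟨w, Finset.mem_filter.2 ⟨hw, by simp [hwu]⟩, by simp [hwu]⟩

/-- The set of vertices matched to `Q`. -/
def matched (Q : Finset α) (M : α → Option α) : Finset α :=
  (Q.filter fun w => M w ≠ none).image fun w => (M w).getD w

theorem mem_matched {Q : Finset α} {u : α} : u ∈ matched Q M ↔ ∃ w ∈ Q, M w = some u := by
  unfold matched
  simp only [Finset.mem_image, Finset.mem_filter]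
  constructor
  · rintro ⟨w, ⟨hw, hn⟩, rfl⟩
    obtain ⟨v, hv⟩ := Option.ne_none_iff_exists'.1 hn
    exact ⟨w, hw, by simp [hv]⟩
  · rintro ⟨w, hw, h⟩
    exact ⟨w, ⟨hw, by simp [h]⟩, by simp [h]⟩

theorem card_matched {Q : Finset α} (hM : IsFlow E V V Src Snk M) (hQ : Q ⊆ V) :
    (matched Q M).card + (Q.filter fun w => M w = none).card = Q.card := by
  have : (matched Q M).card = (Q.filter fun w => M w ≠ none).card := by
    apply Finset.card_image_of_injOn
    intro w hw w' hw' he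
    simp only [Finset.coe_filter, Set.mem_ofPred_eq] at hw hw'
    obtain ⟨v, hv⟩ := Option.ne_none_iff_exists'.1 hw.2
    obtain ⟨v', hv'⟩ := Option.ne_none_iff_exists'.1 hw'.2
    simp only [hv, hv', Option.getD_some] at he
    subst he
    exact hM.inj w (hQ hw.1) w' (hQ hw'.1) v hv hv'
  rw [this, add_comm, Finset.card_filter_add_card_filter_not]

/-- A set that is closed under alternating walks and contains no augmenting walk. -/
structure IsClosedSet (E : α → α → Prop) (V Src Snk : Finset α) (M : α → Option α)
    (Q : Finset α) : Prop where
  subset : Q ⊆ V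
  src : Src ⊆ Q
  self_mem : ∀ w ∈ Q, ∀ u, M w = some u → u ∈ Q
  edge_mem : ∀ w ∈ Q, ∀ u, M w = some u → ∀ v ∈ V, E u v → v ∈ Q
  snk : ∀ w ∈ Q, ∀ u, M w = some u → u ∉ Snk

/-- `Q` consists of reached incoming halves, and their partners are the reached outgoing halves. A
vertex is cut when its incoming half is reached but its outgoing half is not. Since the matching is
injective, the number of cut vertices is the number of unmatched incoming halves of `Q`, and all
unmatched ones lie in `Src ⊆ Q`. -/
theorem IsClosedSet.isCut {Q : Finset α} (hM : IsFlow E V V Src Snk M)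
    (hQ : IsClosedSet E V Src Snk M Q) :
    IsCut E V Src Snk (matched Q M) (Q \ matched Q M) ∧
      (Q \ matched Q M).card = flowValue V M := by
  have hsub : matched Q M ⊆ Q := by
    intro u hu
    obtain ⟨w, hw, h⟩ := mem_matched.1 hu
    exact hQ.self_mem w hw u h
  refine ⟨⟨hsub.trans hQ.subset, Finset.sdiff_subset.trans hQ.subset, Finset.disjoint_sdiff, ?_,
    ?_, ?_⟩, ?_⟩
  · rw [Finset.union_sdiff_of_subset hsub]; exact hQ.src
  · rw [Finset.disjoint_left]
    intro u hu
    obtain ⟨w, hw, h⟩ := mem_matched.1 hu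
    exact hQ.snk w hw u h
  · intro u hu v hv huv
    rw [Finset.union_sdiff_of_subset hsub]
    obtain ⟨w, hw, h⟩ := mem_matched.1 hu
    exact hQ.edge_mem w hw u h v hv huv
  · rw [Finset.card_sdiff_of_subset hsub]
    have h1 := card_matched hM hQ.subset
    have : flowValue V M = (Q.filter fun w => M w = none).card := by
      unfold flowValue
      congr 1
      ext w
      simp only [Finset.mem_filter]
      exact ⟨fun h => ⟨hQ.src (hM.src w h.1 h.2), h.2⟩, fun h => ⟨hQ.subset h.1, h.2⟩⟩
    omega

/-! Augmentation: the flow with a hole at `h` is a flow on `V.erase h`. -/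

/-- An augmenting walk is undone from its sink end. Releasing the sink `u` is allowed, and the
incoming half `h` that loses its partner is the hole, which then travels back to a source. -/
theorem IsFlow.open_hole (hM : IsFlow E V V Src Snk M) {h u : α} (hh : h ∈ V) (hu : M h = some u)
    (hs : u ∈ Snk) :
    IsFlow E V (V.erase h) Src Snk M ∧ flowValue (V.erase h) M = flowValue V M := by
  refine ⟨⟨fun w hw => hM.src w (Finset.mem_of_mem_erase hw),
    fun w hw => hM.mem w (Finset.mem_of_mem_erase hw),
    fun w hw => hM.edge w (Finset.mem_of_mem_erase hw),
    fun w hw w' hw' => hM.inj w (Finset.mem_of_mem_erase hw) w' (Finset.mem_of_mem_erase hw'),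
    fun v hv hn => ?_⟩, ?_⟩
  · by_cases hvu : v = u
    · exact hvu ▸ hs
    · refine hM.snk v hv fun w hw hwv => ?_
      by_cases hwh : w = h
      · subst hwh
        rw [hu] at hwv
        exact hvu (Option.some.inj hwv).symm
      · exact hn w (Finset.mem_erase.2 ⟨hwh, hw⟩) hwv
  · unfold flowValue
    congr 1
    ext w
    simp only [Finset.mem_filter, Finset.mem_erase]
    refine ⟨fun hw => ⟨hw.1.2, hw.2⟩, fun hw => ⟨⟨?_, hw.1⟩, hw.2⟩⟩
    rintro rfl
    rw [hu] at hw
    simp at hw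

/-- The partner `u` of the preceding vertex `p` of the walk is handed over to `h`, and the hole
moves one step towards the start. -/
theorem IsFlow.move_hole {h p u : α} (hM : IsFlow E V (V.erase h) Src Snk M) (hh : h ∈ V)
    (hp : p ∈ V) (hph : p ≠ h) (hu : M p = some u) (he : u = h ∨ E u h) :
    IsFlow E V (V.erase p) Src Snk (Function.update M h (some u)) ∧
      flowValue (V.erase p) (Function.update M h (some u)) = flowValue (V.erase h) M := by
  have hpe : p ∈ V.erase h := Finset.mem_erase.2 ⟨hph, hp⟩
  have key : ∀ w ∈ V.erase p, w ≠ h → w ∈ V.erase h := fun w hw hwh =>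
    Finset.mem_erase.2 ⟨hwh, Finset.mem_of_mem_erase hw⟩
  refine ⟨⟨?_, ?_, ?_, ?_, ?_⟩, ?_⟩
  · intro w hw hn
    by_cases hwh : w = h
    · subst hwh; simp at hn
    · rw [Function.update_of_ne hwh] at hn
      exact hM.src w (key w hw hwh) hn
  · intro w hw v hv
    by_cases hwh : w = h
    · subst hwh
      simp only [Function.update_self, Option.some.injEq] at hv
      exact hv ▸ hM.mem p hpe u hu
    · rw [Function.update_of_ne hwh] at hv
      exact hM.mem w (key w hw hwh) v hv
  · intro w hw v hv
    by_cases hwh : w = h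
    · subst hwh
      simp only [Function.update_self, Option.some.injEq] at hv
      exact hv ▸ he
    · rw [Function.update_of_ne hwh] at hv
      exact hM.edge w (key w hw hwh) v hv
  · intro w hw w' hw' v hv hv'
    by_cases hwh : w = h <;> by_cases hwh' : w' = h
    · rw [hwh, hwh']
    · subst hwh
      rw [Function.update_of_ne hwh'] at hv'
      simp only [Function.update_self, Option.some.injEq] at hv
      subst hv
      exact absurd (hM.inj w' (key w' hw' hwh') p hpe u hv' hu) (Finset.ne_of_mem_erase hw')
    · subst hwh'
      rw [Function.update_of_ne hwh] at hv
      simp only [Function.update_self, Option.some.injEq] at hv'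
      subst hv'
      exact absurd (hM.inj w (key w hw hwh) p hpe u hv hu) (Finset.ne_of_mem_erase hw)
    · rw [Function.update_of_ne hwh] at hv
      rw [Function.update_of_ne hwh'] at hv'
      exact hM.inj w (key w hw hwh) w' (key w' hw' hwh') v hv hv'
  · intro v hv hn
    have hhp : h ∈ V.erase p := Finset.mem_erase.2 ⟨hph.symm, hh⟩
    have hvu : v ≠ u := fun e => hn h hhp (by simp [e])
    refine hM.snk v hv fun w hw hwv => ?_
    have hwp : w ≠ p := by
      rintro rfl
      rw [hu] at hwv
      exact hvu (Option.some.inj hwv).symm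
    have hwh := Finset.ne_of_mem_erase hw
    exact hn w (Finset.mem_erase.2 ⟨hwp, Finset.mem_of_mem_erase hw⟩)
      (by rw [Function.update_of_ne hwh]; exact hwv)
  · unfold flowValue
    congr 1
    ext w
    simp only [Finset.mem_filter, Finset.mem_erase]
    by_cases hwh : w = h
    · subst hwh; simp
    · rw [Function.update_of_ne hwh]
      refine ⟨fun hw => ⟨⟨hwh, hw.1.2⟩, hw.2⟩, fun hw => ⟨⟨?_, hw.1.2⟩, hw.2⟩⟩
      rintro rfl
      rw [hu] at hw
      simp at hw

theorem IsFlow.close_hole {h : α} (hM : IsFlow E V (V.erase h) Src Snk M) (hh : h ∈ V)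
    (hs : h ∈ Src) :
    IsFlow E V V Src Snk (Function.update M h none) ∧
      flowValue V (Function.update M h none) = flowValue (V.erase h) M + 1 := by
  have key : ∀ w ∈ V, w ≠ h → w ∈ V.erase h := fun w hw hwh => Finset.mem_erase.2 ⟨hwh, hw⟩
  have ne_of : ∀ w v, Function.update M h none w = some v → w ≠ h := by
    rintro w v hv rfl; simp at hv
  refine ⟨⟨?_, ?_, ?_, ?_, ?_⟩, ?_⟩
  · intro w hw hn
    by_cases hwh : w = h
    · exact hwh ▸ hs
    · rw [Function.update_of_ne hwh] at hn
      exact hM.src w (key w hw hwh) hn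
  · intro w hw v hv
    have hwh := ne_of w v hv
    rw [Function.update_of_ne hwh] at hv
    exact hM.mem w (key w hw hwh) v hv
  · intro w hw v hv
    have hwh := ne_of w v hv
    rw [Function.update_of_ne hwh] at hv
    exact hM.edge w (key w hw hwh) v hv
  · intro w hw w' hw' v hv hv'
    have hwh := ne_of w v hv
    have hwh' := ne_of w' v hv'
    rw [Function.update_of_ne hwh] at hv
    rw [Function.update_of_ne hwh'] at hv'
    exact hM.inj w (key w hw hwh) w' (key w' hw' hwh') v hv hv'
  · intro v hv hn
    refine hM.snk v hv fun w hw hwv => ?_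
    have hwh := Finset.ne_of_mem_erase hw
    exact hn w (Finset.mem_of_mem_erase hw) (by rw [Function.update_of_ne hwh]; exact hwv)
  · unfold flowValue
    rw [← Finset.card_insert_of_notMem (a := h) (by simp)]
    congr 1
    ext w
    simp only [Finset.mem_filter, Finset.mem_insert, Finset.mem_erase]
    by_cases hwh : w = h
    · subst hwh; simp [hh]
    · simp [hwh]

/-- The hole follows a walk of minimal length. Every vertex rematched so far has no shorter walk
than the hole had when it was there, so on all vertices at smaller distance `M'` still agrees with
`M`, and the next step of the walk is still available. -/
theorem IsFlow.augment_hole (hS : Src ⊆ V) (k : ℕ) : ∀ (w : α) (M' : α → Option α),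
    AltReach E V Src M k w → (∀ j < k, ¬ AltReach E V Src M j w) →
    IsFlow E V (V.erase w) Src Snk M' →
    (∀ v j, j < k → AltReach E V Src M j v → M' v = M v) →
    ∃ M'', IsFlow E V V Src Snk M'' ∧ flowValue V M'' = flowValue (V.erase w) M' + 1 := by
  induction k with
  | zero =>
    intro w M' hw _ hM' _
    exact ⟨_, hM'.close_hole (hS hw) hw⟩
  | succ k ih =>
    rintro w M' ⟨hwV, p, hp, u, hpu, he⟩ hmin hM' hag
    have hpw : p ≠ w := by rintro rfl; exact hmin k (Nat.lt_succ_self k) hp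
    have hu : M' p = some u := by rw [hag p k (Nat.lt_succ_self k) hp, hpu]
    obtain ⟨h1, h2⟩ := hM'.move_hole hwV (hp.mem hS) hpw hu he
    rw [← h2]
    refine ih p _ hp (fun j hj hjp => ?_) h1 fun v j hj hv => ?_
    · exact hmin (j + 1) (by omega) ⟨hwV, p, hjp, u, hpu, he⟩
    · have : v ≠ w := by rintro rfl; exact hmin j (by omega) hv
      rw [Function.update_of_ne this]
      exact hag v j (by omega) hv

/-- An augmenting walk yields a larger flow. -/
theorem IsFlow.augment (hS : Src ⊆ V) (hM : IsFlow E V V Src Snk M) {k : ℕ} {w u : α}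
    (hw : AltReach E V Src M k w) (hu : M w = some u) (hs : u ∈ Snk) :
    ∃ M', IsFlow E V V Src Snk M' ∧ flowValue V M' = flowValue V M + 1 := by
  classical
  have hex : ∃ k, AltReach E V Src M k w := ⟨k, hw⟩
  obtain ⟨h1, h2⟩ := hM.open_hole (hw.mem hS) hu hs
  obtain ⟨M', h3, h4⟩ := IsFlow.augment_hole hS (Nat.find hex) w M (Nat.find_spec hex)
    (fun j hj => Nat.find_min hex hj) h1 (fun _ _ _ _ => rfl)
  exact ⟨M', h3, by omega⟩

/-- Max-flow min-cut. -/
theorem exists_flow_isClosedSet (E : α → α → Prop) (V Src Snk : Finset α) (hS : Src ⊆ V) :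
    ∃ M Q, IsFlow E V V Src Snk M ∧ IsClosedSet E V Src Snk M Q := by
  classical
  have hb : ∃ k, (∃ M, IsFlow E V V Src Snk M ∧ flowValue V M = k) ∧
      ∀ M, IsFlow E V V Src Snk M → flowValue V M ≤ k := by
    have hne : ∃ k, ∃ M, IsFlow E V V Src Snk M ∧ flowValue V M = k := ⟨_, _, IsFlow.of_id, rfl⟩
    have hbd : ∀ k, (∃ M, IsFlow E V V Src Snk M ∧ flowValue V M = k) → k ≤ V.card := by
      rintro k ⟨M, _, rfl⟩
      exact Finset.card_filter_le _ _
    refine ⟨Nat.findGreatest (fun k => ∃ M, IsFlow E V V Src Snk M ∧ flowValue V M = k) V.card,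
      ?_, fun M hM => ?_⟩
    · obtain ⟨k, hk⟩ := hne
      exact Nat.findGreatest_spec (P := fun k => ∃ M, IsFlow E V V Src Snk M ∧ flowValue V M = k)
        (hbd k hk) hk
    · exact Nat.le_findGreatest (hbd _ ⟨M, hM, rfl⟩) ⟨M, hM, rfl⟩
  obtain ⟨_, ⟨M, hM, rfl⟩, hmax⟩ := hb
  -- For a flow of maximum value, the vertices at the ends of alternating walks form a closed set; a
  -- sink among their partners would give a larger flow.
  refine ⟨M, V.filter fun w => ∃ k, AltReach E V Src M k w, hM, Finset.filter_subset _ _, ?_, ?_,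
    ?_, ?_⟩
  · exact fun w hw => Finset.mem_filter.2 ⟨hS hw, 0, hw⟩
  · intro w hw u hu
    obtain ⟨hwV, k, hk⟩ := Finset.mem_filter.1 hw
    have huV := hM.mem w hwV u hu
    exact Finset.mem_filter.2 ⟨huV, k + 1, huV, w, hk, u, hu, Or.inl rfl⟩
  · intro w hw u hu v hv huv
    obtain ⟨hwV, k, hk⟩ := Finset.mem_filter.1 hw
    exact Finset.mem_filter.2 ⟨hv, k + 1, hv, w, hk, u, hu, Or.inr huv⟩
  · intro w hw u hu hs
    obtain ⟨hwV, k, hk⟩ := Finset.mem_filter.1 hw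
    obtain ⟨M', h1, h2⟩ := hM.augment hS hk hu hs
    have := hmax M' h1
    omega

end Flow

namespace FinDigraph

variable {α : Type*} [DecidableEq α] {G : FinDigraph α} {A B X Y Z : Finset α}

/-! ### Reachability and separators -/

theorem mem_arcs_deleteVerts {u v : α} :
    (u, v) ∈ (G.deleteVerts X).arcs ↔ (u, v) ∈ G.arcs ∧ u ∉ X ∧ v ∉ X := by
  simp [deleteVerts]

theorem reachSet_base {a : α} (ha : a ∈ A) (haG : a ∈ G.verts) (haX : a ∉ X) :
    a ∈ G.reachSet A X :=
  ⟨a, ha, by simp [deleteVerts, haG, haX], Relation.ReflTransGen.refl⟩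

theorem reachSet_step {u v : α} (hu : u ∈ G.reachSet A X) (huX : u ∉ X) (huv : (u, v) ∈ G.arcs)
    (hv : v ∉ X) : v ∈ G.reachSet A X := by
  obtain ⟨a, ha, haG, h⟩ := hu
  exact ⟨a, ha, haG, h.tail (mem_arcs_deleteVerts.2 ⟨huv, huX, hv⟩)⟩

theorem reachSet_induction {p : α → Prop} (base : ∀ a ∈ A, a ∈ G.verts → a ∉ X → p a)
    (step : ∀ u v, u ∈ G.reachSet A X → p u → (u, v) ∈ G.arcs → u ∉ X → v ∉ X → p v) {v : α}
    (hv : v ∈ G.reachSet A X) : p v := by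
  obtain ⟨a, ha, haG, h⟩ := hv
  have haG' : a ∈ G.verts ∧ a ∉ X := by simpa [deleteVerts] using haG
  induction h with
  | refl => exact base a ha haG'.1 haG'.2
  | tail h1 h2 ih =>
    obtain ⟨h3, h4, h5⟩ := mem_arcs_deleteVerts.1 h2
    exact step _ _ ⟨a, ha, haG, h1⟩ ih h3 h4 h5

theorem reachSet_spec {v : α} (hv : v ∈ G.reachSet A X) : v ∈ G.verts ∧ v ∉ X :=
  reachSet_induction (p := fun v => v ∈ G.verts ∧ v ∉ X) (fun _ _ h h' => ⟨h, h'⟩)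
    (fun _ _ _ _ h _ h' => ⟨G.snd_mem _ h, h'⟩) hv

theorem reachSet_closed {u v : α} (hu : u ∈ G.reachSet A X) (huv : (u, v) ∈ G.arcs)
    (hv : v ∉ X) : v ∈ G.reachSet A X :=
  reachSet_step hu (reachSet_spec hu).2 huv hv

theorem isSeparator_iff : G.IsSeparator A B X ↔ X ⊆ G.verts ∧ ∀ b ∈ B, b ∉ G.reachSet A X := by
  unfold IsSeparator reachSet
  refine and_congr_right fun _ => ⟨fun h b hb ⟨a, ha, hr⟩ => h a ha b hb hr,
    fun h a ha b hb hr => h b hb ⟨a, ha, hr⟩⟩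

/-- Comparison of reach sets: a set `Y` that meets no vertex reached past `X` cannot interrupt any
of the walks that avoid `X`. -/
theorem reachSet_subset_of_disjoint (h : ∀ v ∈ Y, v ∉ G.reachSet A X) :
    G.reachSet A X ⊆ G.reachSet A Y := by
  intro v hv
  refine reachSet_induction (p := fun v => v ∈ G.reachSet A Y) ?_ ?_ hv
  · exact fun a ha haG haX => reachSet_base ha haG fun haY => h a haY (reachSet_base ha haG haX)
  · exact fun u v hu hu' huv _ hvX =>
      reachSet_closed hu' huv fun hvY => h v hvY (reachSet_closed hu huv hvX)

/-- Every vertex of a minimal separator is a source or has a reachable in-neighbour. -/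
theorem IsMinimalSeparator.exists_arc (h : G.IsMinimalSeparator A B X) {x : α} (hx : x ∈ X) :
    x ∈ A ∨ ∃ v ∈ G.reachSet A X, (v, x) ∈ G.arcs := by
  by_contra hcon
  push Not at hcon
  refine h.2 x hx (isSeparator_iff.2 ⟨(Finset.erase_subset _ _).trans h.1.1, fun b hb hbr => ?_⟩)
  refine (isSeparator_iff.1 h.1).2 b hb ?_
  refine reachSet_induction (p := fun v => v ∈ G.reachSet A X) ?_ ?_ hbr
  · intro a ha haG haX
    refine reachSet_base ha haG fun haX' => haX (Finset.mem_erase.2 ⟨?_, haX'⟩)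
    rintro rfl
    exact hcon.1 ha
  · intro u v _ hu huv _ hv
    refine reachSet_closed hu huv fun hvX => hv (Finset.mem_erase.2 ⟨?_, hvX⟩)
    rintro rfl
    exact hcon.2 u hu huv

/-- A minimal separator is the boundary of its reach set: each of its vertices is a source or has a
reached in-neighbour. If such a vertex were not in `Y`, it would be reached past `Y`, hence past
`X`. -/
theorem eq_of_reachSet_eq (hX : G.IsMinimalSeparator A B X)
    (hr : G.reachSet A X = G.reachSet A Y) (hc : Y.card ≤ X.card) : X = Y := by
  refine Finset.eq_of_subset_of_card_le (fun x hx => ?_) hc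
  by_contra hxY
  have hxr : x ∉ G.reachSet A Y := hr ▸ fun h => (reachSet_spec h).2 hx
  rcases hX.exists_arc hx with h | ⟨v, hv, hvx⟩
  · exact hxr (reachSet_base h (hX.1.1 hx) hxY)
  · exact hxr (reachSet_closed (hr ▸ hv) hvx hxY)

/-- Every separator can be pushed to an important one. -/
theorem exists_isImportantSeparator (hX : G.IsSeparator A B X) :
    ∃ Y, G.IsImportantSeparator A B Y ∧ Y.card ≤ X.card ∧
      G.reachSet A X ⊆ G.reachSet A Y := by
  classical
  have hfin : ∀ Y, (G.reachSet A Y).Finite := fun Y =>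
    G.verts.finite_toSet.subset fun v hv => (reachSet_spec hv).1
  let S : Finset (Finset α) := G.verts.powerset.filter fun Y =>
    G.IsSeparator A B Y ∧ Y.card ≤ X.card ∧ G.reachSet A X ⊆ G.reachSet A Y
  have hS : X ∈ S := by
    simp only [S, Finset.mem_filter, Finset.mem_powerset]
    exact ⟨hX.1, hX, le_rfl, subset_rfl⟩
  -- The reach set is maximized first, and then the cardinality is minimized among the separators
  -- reaching at least as much. The first choice excludes competitors, the second gives
  -- inclusion-minimality.
  obtain ⟨Y, hY, hmax⟩ := S.exists_max_image (fun Y => (G.reachSet A Y).ncard) ⟨X, hS⟩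
  let S' := S.filter fun Y' => G.reachSet A Y ⊆ G.reachSet A Y'
  obtain ⟨W, hW, hmin⟩ := S'.exists_min_image Finset.card
    ⟨Y, Finset.mem_filter.2 ⟨hY, subset_rfl⟩⟩
  simp only [S', S, Finset.mem_filter, Finset.mem_powerset] at hW hmin hY hmax
  obtain ⟨⟨hWG, hWsep, hWc, hXW⟩, hYW⟩ := hW
  refine ⟨W, ⟨⟨hWsep, fun v hv hsep => ?_⟩, fun U hU hUc hlt => ?_⟩, hWc, hXW⟩
  · have hsub : G.reachSet A W ⊆ G.reachSet A (W.erase v) :=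
      reachSet_subset_of_disjoint fun u hu hur =>
        (reachSet_spec hur).2 (Finset.mem_of_mem_erase hu)
    have hlt := Finset.card_erase_lt_of_mem hv
    have := hmin (W.erase v) ⟨⟨hsep.1, hsep, by omega, hXW.trans hsub⟩, hYW.trans hsub⟩
    omega
  · have h1 := hmax U ⟨hU.1, hU, by omega, hXW.trans hlt.1⟩
    have h2 := Set.ncard_lt_ncard hlt (hfin U)
    have h3 := Set.ncard_le_ncard hYW (hfin W)
    omega

/-! ### Separations -/

/-- `(P, X)` separates `A ∪ R` from `B`; it may not delete vertices of `R` and must delete `D`. -/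
structure IsSeparation (G : FinDigraph α) (A B D R P X : Finset α) : Prop where
  left_subset : P ⊆ G.verts
  right_subset : X ⊆ G.verts
  disj : Disjoint P X
  closed : ∀ u v, (u, v) ∈ G.arcs → u ∈ P → v ∈ P ∪ X
  forced : D ⊆ X
  kept : R ⊆ P
  src : A ⊆ P ∪ X
  snk : Disjoint P B

variable {D R P P₁ P₂ X₁ X₂ : Finset α}

theorem IsSeparation.mono {A₁ B₁ D₁ R₁ : Finset α} (h : G.IsSeparation A B D R P X)
    (hA : A₁ ⊆ A) (hB : B₁ ⊆ B) (hD : D₁ ⊆ D) (hR : R₁ ⊆ R) : G.IsSeparation A₁ B₁ D₁ R₁ P X :=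
  ⟨h.left_subset, h.right_subset, h.disj, h.closed, hD.trans h.forced, hR.trans h.kept,
    hA.trans h.src, Finset.disjoint_of_subset_right hB h.snk⟩

/-- `R₀` is the source side of `Z`, and `Z` is the only minimum separator between `R₀ ∪ Z` and `B`
that avoids `R₀`. -/
def IsTight (G : FinDigraph α) (B R₀ Z : Finset α) : Prop :=
  ∀ P Y, G.IsSeparation Z B ∅ R₀ P Y → Y.card ≤ Z.card → Y = Z

/-- Everything reached from `A` past `Y` stays in `P`, so `Y` is an `A`-`B` separator; it avoids
`R₀`, so it reaches at least as much as `Z`. Importance excludes a strict gain, and equal reach sets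
determine the separator by `eq_of_reachSet_eq`. -/
theorem IsImportantSeparator.isTight (h : G.IsImportantSeparator A B Z) {R₀ : Finset α}
    (hR : ∀ v, v ∈ R₀ ↔ v ∈ G.reachSet A Z) : G.IsTight B R₀ Z := by
  intro P Y hs hc
  have hYP : ∀ v ∈ G.reachSet A Y, v ∈ P := by
    intro v hv
    have aux : ∀ v, v ∈ P ∪ Y → v ∉ Y → v ∈ P := fun v hv hvY =>
      (Finset.mem_union.1 hv).resolve_right hvY
    refine reachSet_induction (p := fun v => v ∈ P) ?_ ?_ hv
    · intro a ha haG haY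
      by_cases haZ : a ∈ Z
      · exact aux a (hs.src haZ) haY
      · exact hs.kept ((hR a).2 (reachSet_base ha haG haZ))
    · exact fun u v _ hu huv _ hvY => aux v (hs.closed u v huv hu) hvY
  have hsep : G.IsSeparator A B Y := isSeparator_iff.2 ⟨hs.right_subset, fun b hb hbr =>
    Finset.disjoint_left.1 hs.snk (hYP b hbr) hb⟩
  have hsub : G.reachSet A Z ⊆ G.reachSet A Y := reachSet_subset_of_disjoint fun v hv hvr =>
    Finset.disjoint_left.1 hs.disj (hs.kept ((hR v).2 hvr)) hv
  have heq : G.reachSet A Z = G.reachSet A Y := by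
    by_contra hne
    exact h.2 Y hsep hc (hsub.ssubset_of_ne hne)
  exact (eq_of_reachSet_eq h.1 heq hc).symm

theorem IsImportantSeparator.isSeparation (h : G.IsImportantSeparator A B Z) {R₀ : Finset α}
    (hR : ∀ v, v ∈ R₀ ↔ v ∈ G.reachSet A Z) (hA : A ⊆ G.verts) :
    G.IsSeparation A B Z R₀ R₀ Z where
  left_subset v hv := (reachSet_spec ((hR v).1 hv)).1
  right_subset := h.1.1.1
  disj := Finset.disjoint_left.2 fun v hv => (reachSet_spec ((hR v).1 hv)).2
  closed u v huv hu := by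
    by_cases hv : v ∈ Z
    · exact Finset.mem_union_right _ hv
    · exact Finset.mem_union_left _ ((hR v).2 (reachSet_closed ((hR u).1 hu) huv hv))
  forced := Finset.Subset.refl _
  kept := Finset.Subset.refl _
  src a ha := by
    by_cases haZ : a ∈ Z
    · exact Finset.mem_union_right _ haZ
    · exact Finset.mem_union_left _ ((hR a).2 (reachSet_base ha (hA ha) haZ))
  snk := Finset.disjoint_left.2 fun v hv hvB => (isSeparator_iff.1 h.1.1).2 v hvB ((hR v).1 hv)

/-- Few sources suffice to reach all of a minimal separator. -/
theorem IsMinimalSeparator.exists_small_source (h : G.IsMinimalSeparator A B Z) :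
    ∃ A' ⊆ A, A'.card ≤ Z.card ∧
      ∀ z ∈ Z, z ∈ A' ∨ ∃ v ∈ G.reachSet A' Z, (v, z) ∈ G.arcs := by
  classical
  have : ∀ z : α, ∃ a, z ∈ Z → a ∈ A ∧ (z = a ∨ ∃ v ∈ G.reachSet {a} Z, (v, z) ∈ G.arcs) := by
    intro z
    by_cases hz : z ∈ Z
    · rcases h.exists_arc hz with hA | ⟨v, ⟨a, ha, hr⟩, hvz⟩
      · exact ⟨z, fun _ => ⟨hA, Or.inl rfl⟩⟩
      · exact ⟨a, fun _ => ⟨ha, Or.inr ⟨v, ⟨a, by simp, hr⟩, hvz⟩⟩⟩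
    · exact ⟨z, fun h => absurd h hz⟩
  choose f hf using this
  refine ⟨Z.image f, ?_, Finset.card_image_le, fun z hz => ?_⟩
  · intro a ha
    obtain ⟨z, hz, rfl⟩ := Finset.mem_image.1 ha
    exact (hf z hz).1
  · have hfz : f z ∈ Z.image f := Finset.mem_image_of_mem f hz
    rcases (hf z hz).2 with h1 | ⟨v, ⟨a, ha, hr⟩, hvz⟩
    · left; rw [h1]; rwa [← h1] at hfz ⊢
    · refine Or.inr ⟨v, ⟨a, ?_, hr⟩, hvz⟩
      rw [Finset.mem_singleton.1 ha]
      exact hfz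

/-- Few sinks suffice to certify tightness. -/
theorem IsTight.exists_small_sink {R₀ : Finset α} (ht : G.IsTight B R₀ Z)
    (hs : G.IsSeparation A B Z R₀ R₀ Z) :
    ∃ B' ⊆ B, B'.card ≤ 2 * Z.card ∧ G.IsTight B' R₀ Z := by
  classical
  set E : α → α → Prop := fun u w => (u, w) ∈ G.arcs with hE
  set V := G.verts \ R₀ with hV
  have hZV : Z ⊆ V := fun z hz => Finset.mem_sdiff.2 ⟨hs.right_subset hz, fun h =>
    Finset.disjoint_left.1 hs.disj h hz⟩
  -- A maximum family of disjoint paths from `Z` to `B` outside `R₀`. By tightness every closed set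
  -- of this flow gives the cut `Z` itself; in particular the flow has value `|Z|`, and no incoming
  -- half in `Z` is matched.
  obtain ⟨M, Q₀, hM, hQ₀⟩ := exists_flow_isClosedSet E V Z (B ∩ V) hZV
  have cut_tight : ∀ Q, IsClosedSet E V Z (B ∩ V) M Q → Q \ matched Q M = Z := by
    intro Q hQ
    obtain ⟨hcut, hcard⟩ := hQ.isCut hM
    refine ht (R₀ ∪ matched Q M) _ ⟨?_, ?_, ?_, ?_, Finset.empty_subset _,
      Finset.subset_union_left, ?_, ?_⟩ ?_
    · exact Finset.union_subset hs.left_subset (hcut.left_subset.trans Finset.sdiff_subset)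
    · exact hcut.right_subset.trans Finset.sdiff_subset
    · rw [Finset.disjoint_union_left]
      exact ⟨Finset.disjoint_of_subset_right hcut.right_subset Finset.disjoint_sdiff, hcut.disj⟩
    · intro u v huv hu
      by_cases hv : v ∈ R₀
      · exact Finset.mem_union_left _ (Finset.mem_union_left _ hv)
      · rw [Finset.union_assoc]
        apply Finset.mem_union_right
        rcases Finset.mem_union.1 hu with hu | hu
        · exact hcut.src ((Finset.mem_union.1 (hs.closed u v huv hu)).resolve_left hv)
        · exact hcut.closed u hu v (Finset.mem_sdiff.2 ⟨G.snd_mem _ huv, hv⟩) huv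
    · rw [Finset.union_assoc]
      exact hcut.src.trans Finset.subset_union_right
    · rw [Finset.disjoint_union_left]
      refine ⟨hs.snk, Finset.disjoint_left.2 fun v hv hvB => ?_⟩
      exact Finset.disjoint_left.1 hcut.snk hv (Finset.mem_inter.2 ⟨hvB, hcut.left_subset hv⟩)
    · rw [hcard]
      exact Finset.card_le_card fun w hw => hM.src w (Finset.mem_filter.1 hw).1
        (Finset.mem_filter.1 hw).2
  have hval : flowValue V M = Z.card := by
    rw [← (hQ₀.isCut hM).2, cut_tight Q₀ hQ₀]
  have hnone : ∀ w ∈ Z, M w = none := by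
    have : V.filter (fun w => M w = none) = Z :=
      Finset.eq_of_subset_of_card_le (fun w hw => hM.src w (Finset.mem_filter.1 hw).1
        (Finset.mem_filter.1 hw).2) hval.ge
    exact fun w hw => (Finset.mem_filter.1 (this ▸ hw : w ∈ V.filter _)).2
  -- The ends of the paths. With these sinks alone, no separator can have fewer than `|Z|` vertices.
  set B₀ := V \ matched V M with hB₀
  have hB₀B : B₀ ⊆ B := by
    intro b hb
    obtain ⟨hbV, hb⟩ := Finset.mem_sdiff.1 hb
    refine (Finset.mem_inter.1 (hM.snk b hbV fun w hw h => ?_)).1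
    exact hb (mem_matched.2 ⟨w, hw, h⟩)
  have hB₀c : B₀.card = Z.card := by
    have h1 := card_matched hM (Finset.Subset.refl V)
    have h2 : matched V M ⊆ V := fun u hu => by
      obtain ⟨w, hw, h⟩ := mem_matched.1 hu
      exact hM.mem w hw u h
    rw [hB₀, Finset.card_sdiff_of_subset h2]
    unfold flowValue at hval
    omega
  set r : α → α → Prop := fun u u' => ∃ w ∈ V, (u = w ∨ E u w) ∧ M w = some u' with hr
  have hb : ∀ z : α, ∃ b, z ∈ Z → b ∈ B ∧ Relation.ReflTransGen r z b := by
    intro z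
    by_contra hcon
    push Not at hcon
    have hz : z ∈ Z := (hcon z).1
    have hcon' : ∀ b, Relation.ReflTransGen r z b → b ∉ B := fun b h hb => (hcon b).2 hb h
    -- If no residual walk from `z` ended in `B`, the incoming halves seen from `z`, together with
    -- `Z`, would be closed. As `z ∉ B`, its outgoing half is matched inside this set, so the
    -- resulting cut would miss `z`, although it has to be `Z`.
    set Q := Z ∪ V.filter (fun w => ∃ u, Relation.ReflTransGen r z u ∧ (u = w ∨ E u w)) with hQ
    have key : ∀ w ∈ Q, ∀ u, M w = some u → Relation.ReflTransGen r z u := by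
      intro w hw u hu
      rcases Finset.mem_union.1 hw with hw | hw
      · rw [hnone w hw] at hu; cases hu
      · obtain ⟨hwV, v, hv, he⟩ := Finset.mem_filter.1 hw
        exact hv.tail ⟨w, hwV, he, hu⟩
    have hQV : Q ⊆ V := Finset.union_subset hZV (Finset.filter_subset _ _)
    have hcl : IsClosedSet E V Z (B ∩ V) M Q := by
      refine ⟨hQV, Finset.subset_union_left, ?_, ?_, ?_⟩
      · intro w hw u hu
        exact Finset.mem_union_right _ (Finset.mem_filter.2 ⟨hM.mem w (hQV hw) u hu, u,
          key w hw u hu, Or.inl rfl⟩)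
      · intro w hw u hu v hv huv
        exact Finset.mem_union_right _ (Finset.mem_filter.2 ⟨hv, u, key w hw u hu, Or.inr huv⟩)
      · intro w hw u hu huB
        exact hcon' u (key w hw u hu) (Finset.mem_inter.1 huB).1
    have hzm : z ∈ matched Q M := by
      have hzB : z ∉ B := hcon' z Relation.ReflTransGen.refl
      have : ∃ w ∈ V, M w = some z := by
        by_contra hno
        push Not at hno
        exact hzB (Finset.mem_inter.1 (hM.snk z (hZV hz) hno)).1
      obtain ⟨w, hwV, hw⟩ := this
      refine mem_matched.2 ⟨w, Finset.mem_union_right _ (Finset.mem_filter.2 ⟨hwV, z,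
        Relation.ReflTransGen.refl, hM.edge w hwV z hw⟩), hw⟩
    have := cut_tight Q hcl
    rw [← this] at hz
    exact (Finset.mem_sdiff.1 hz).2 hzm
  choose f hf using hb
  refine ⟨B₀ ∪ Z.image f, Finset.union_subset hB₀B ?_, ?_, ?_⟩
  · intro b hb
    obtain ⟨z, hz, rfl⟩ := Finset.mem_image.1 hb
    exact (hf z hz).1
  · refine (Finset.card_union_le _ _).trans ?_
    have := Finset.card_image_le (s := Z) (f := f)
    omega
  · intro P Y hPY hc
    have hM' : IsFlow E V V Z B₀ M := ⟨hM.src, hM.mem, hM.edge, hM.inj, fun u hu h =>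
      Finset.mem_sdiff.2 ⟨hu, fun hum => by
        obtain ⟨w, hw, h'⟩ := mem_matched.1 hum
        exact h w hw h'⟩⟩
    have hYR : ∀ y ∈ Y, y ∉ R₀ := fun y hy hyR =>
      Finset.disjoint_left.1 hPY.disj (hPY.kept hyR) hy
    have aux : ∀ v ∈ V, v ∈ P ∪ Y → v ∈ P \ R₀ ∪ Y := by
      intro v hv hvP
      rcases Finset.mem_union.1 hvP with h | h
      · exact Finset.mem_union_left _ (Finset.mem_sdiff.2 ⟨h, (Finset.mem_sdiff.1 hv).2⟩)
      · exact Finset.mem_union_right _ h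
    have hcut : IsCut E V Z B₀ (P \ R₀) Y := by
      refine ⟨Finset.sdiff_subset_sdiff hPY.left_subset (Finset.Subset.refl _), fun y hy =>
        Finset.mem_sdiff.2 ⟨hPY.right_subset hy, hYR y hy⟩,
        Finset.disjoint_of_subset_left Finset.sdiff_subset hPY.disj,
        fun z hz => aux z (hZV hz) (hPY.src hz), ?_, ?_⟩
      · exact Finset.disjoint_of_subset_left Finset.sdiff_subset
          (Finset.disjoint_of_subset_right Finset.subset_union_left hPY.snk)
      · exact fun u hu w hw huw => aux w hw (hPY.closed u w huw (Finset.mem_sdiff.1 hu).1)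
    -- `Y` is a minimum cut for the flow ending in `B₀`, so residual walks starting in `P` stay in
    -- `P`. A vertex `z` outside `Y` would carry its chosen residual walk, and thus a sink of `B'`,
    -- into `P`.
    have hback := (hM'.weak_duality hcut).2 (by omega)
    refine (Finset.eq_of_subset_of_card_le (fun z hz => ?_) hc).symm
    by_contra hzY
    have hz1 : z ∈ P \ R₀ :=
      (Finset.mem_union.1 (aux z (hZV hz) (hPY.src hz))).resolve_right hzY
    have hall : ∀ u, Relation.ReflTransGen r z u → u ∈ P \ R₀ := by
      intro u hu
      induction hu with
      | refl => exact hz1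
      | tail _ h ih =>
        obtain ⟨w, hw, he, hwu⟩ := h
        refine hback w ?_ _ hwu
        rcases he with rfl | he
        · exact Finset.mem_union_left _ ih
        · exact hcut.closed _ ih w hw he
    have h1 := hall _ (hf z hz).2
    exact Finset.disjoint_left.1 hPY.snk (Finset.mem_sdiff.1 h1).1
      (Finset.mem_union_right _ (Finset.mem_image_of_mem f hz))

/-! ### Branching on the furthest minimum cut -/

/-- `X` together with `D` is the furthest minimum separator of the branching node
`(A, B, D, R)`. -/
structure IsFurthestCut (G : FinDigraph α) (A B D R X : Finset α) : Prop where
  disj : Disjoint X D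
  exists_sep : ∃ P, G.IsSeparation A B D R P (X ∪ D)
  min : ∀ P Y, G.IsSeparation A B D R P Y → X.card + D.card ≤ Y.card
  furthest : ∀ P Y, G.IsSeparation A B D R P Y → Y.card ≤ X.card + D.card → Disjoint X P

/-- Submodularity. The corner with source side `R₀ ∩ P` is again a separation of the node, so it has
at least `|Y|` vertices. The two corners together have `|Z| + |Y|` vertices, which leaves at most
`|Z|` for the corner with source side `R₀ ∪ P`, and tightness identifies that one with `Z`.
Consequently a vertex of `Y` outside `Z` lies in `R₀`. -/
theorem IsSeparation.uncross {R₀ : Finset α} (ht : G.IsTight B R₀ Z)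
    (hZ : G.IsSeparation A B Z R₀ R₀ Z) (hD : D ⊆ Z) (hR : R ⊆ R₀)
    (h2 : G.IsSeparation A B D R P Y)
    (hmin : ∀ P' Y', G.IsSeparation A B D R P' Y' → Y.card ≤ Y'.card) :
    (Z ∪ Y) \ (R₀ ∪ P) = Z := by
  have hI : G.IsSeparation A B D R (R₀ ∩ P) ((Z ∩ Y) ∪ (Z ∩ P) ∪ (Y ∩ R₀)) := by
    have d1 := hZ.disj
    have d2 := h2.disj
    rw [Finset.disjoint_left] at d1 d2
    refine ⟨Finset.inter_subset_left.trans hZ.left_subset, ?_, ?_, ?_, ?_, ?_, ?_, ?_⟩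
    · intro v hv
      simp only [Finset.mem_union, Finset.mem_inter] at hv
      rcases hv with (h | h) | h
      · exact hZ.right_subset h.1
      · exact hZ.right_subset h.1
      · exact h2.right_subset h.1
    · rw [Finset.disjoint_left]
      intro v hv hv'
      simp only [Finset.mem_union, Finset.mem_inter] at hv hv'
      have := d1 hv.1
      have := d2 hv.2
      tauto
    · intro u v huv hu
      have a1 := hZ.closed u v huv (Finset.mem_inter.1 hu).1
      have a2 := h2.closed u v huv (Finset.mem_inter.1 hu).2
      simp only [Finset.mem_union, Finset.mem_inter] at a1 a2 ⊢
      tauto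
    · intro v hv
      simp only [Finset.mem_union, Finset.mem_inter]
      exact Or.inl (Or.inl ⟨hD hv, h2.forced hv⟩)
    · exact Finset.subset_inter hR h2.kept
    · intro v hv
      have a1 := hZ.src hv
      have a2 := h2.src hv
      simp only [Finset.mem_union, Finset.mem_inter] at a1 a2 ⊢
      tauto
    · exact Finset.disjoint_of_subset_left Finset.inter_subset_left hZ.snk
  have hU : G.IsSeparation Z B ∅ R₀ (R₀ ∪ P) ((Z ∪ Y) \ (R₀ ∪ P)) := by
    refine ⟨Finset.union_subset hZ.left_subset h2.left_subset,
      Finset.sdiff_subset.trans (Finset.union_subset hZ.right_subset h2.right_subset),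
      Finset.disjoint_sdiff, ?_, Finset.empty_subset _, Finset.subset_union_left, ?_, ?_⟩
    · intro u v huv hu
      rw [Finset.union_sdiff_self_eq_union]
      rcases Finset.mem_union.1 hu with hu | hu
      · have a1 := hZ.closed u v huv hu
        simp only [Finset.mem_union] at a1 ⊢
        tauto
      · have a1 := h2.closed u v huv hu
        simp only [Finset.mem_union] at a1 ⊢
        tauto
    · rw [Finset.union_sdiff_self_eq_union]
      exact Finset.subset_union_left.trans Finset.subset_union_right
    · exact Finset.disjoint_union_left.2 ⟨hZ.snk, h2.snk⟩
  have hcard : ((Z ∪ Y) \ (R₀ ∪ P)).card + ((Z ∩ Y) ∪ (Z ∩ P) ∪ (Y ∩ R₀)).card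
      = Z.card + Y.card := by
    have e1 : (Z ∪ Y) \ (R₀ ∪ P) ∪ ((Z ∩ Y) ∪ (Z ∩ P) ∪ (Y ∩ R₀)) = Z ∪ Y := by
      ext v
      simp only [Finset.mem_union, Finset.mem_inter, Finset.mem_sdiff]
      have d1 : v ∈ R₀ → v ∉ Z := fun h => Finset.disjoint_left.1 hZ.disj h
      have d2 : v ∈ P → v ∉ Y := fun h => Finset.disjoint_left.1 h2.disj h
      tauto
    have e2 : (Z ∪ Y) \ (R₀ ∪ P) ∩ ((Z ∩ Y) ∪ (Z ∩ P) ∪ (Y ∩ R₀)) = Z ∩ Y := by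
      ext v
      simp only [Finset.mem_union, Finset.mem_inter, Finset.mem_sdiff]
      have d1 : v ∈ R₀ → v ∉ Z := fun h => Finset.disjoint_left.1 hZ.disj h
      have d2 : v ∈ P → v ∉ Y := fun h => Finset.disjoint_left.1 h2.disj h
      tauto
    rw [← Finset.card_union_add_card_inter, e1, e2, Finset.card_union_add_card_inter]
  have := hmin _ _ hI
  exact ht _ _ hU (by omega)

/-- If the branching nodes `N D R` are closed under branching on furthest minimum cuts, which are
collected in `K`, then `K` contains every tight set. -/
theorem subset_of_branching {R₀ K : Finset α} {c : ℕ} {N : Finset α → Finset α → ℕ → Prop}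
    (ht : G.IsTight B R₀ Z) (hZ : G.IsSeparation A B Z R₀ R₀ Z)
    (hA : ∀ z ∈ Z, z ∈ A ∨ ∃ v ∈ G.reachSet A Z, (v, z) ∈ G.arcs) (hc : Z.card ≤ c)
    (h0 : N ∅ ∅ 0)
    (hstep : ∀ D R k, N D R k → (∃ P X, G.IsSeparation A B D R P X ∧ X.card ≤ c) →
      ∃ X ⊆ K, G.IsFurthestCut A B D R X ∧
        (X.Nonempty → k < 2 * c → ∃ x ∈ X, N (insert x D) R (k + 1) ∧ N D (insert x R) (k + 1))) :
    Z ⊆ K := by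
  -- The induction follows the path of the tree that is consistent with `Z`; `d` is the number of
  -- levels left. The last condition says that each kept vertex has raised the minimum by at least
  -- one.
  suffices H : ∀ d D R k, N D R k → k + d = 2 * c → D ⊆ Z → D ⊆ K → R ⊆ R₀ →
      k = D.card + R.card → (∀ P X, G.IsSeparation A B D R P X → R.card ≤ X.card) → Z ⊆ K from
    H (2 * c) ∅ ∅ 0 h0 (by omega) (Finset.empty_subset _) (Finset.empty_subset _)
      (Finset.empty_subset _) (by simp) (by simp)
  intro d
  induction d with
  | zero =>
    intro D R k _ hkd hDZ hDK hRR hk hmin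
    have hZs := hZ.mono (Finset.Subset.refl A) (Finset.Subset.refl B) hDZ hRR
    have h1 := hmin _ _ hZs
    have h2 := Finset.card_le_card hDZ
    -- Here `|D| + |R| = 2 * c` while `|R| ≤ |Z| ≤ c`, so `|D| ≥ |Z|`.
    rw [← Finset.eq_of_subset_of_card_le hDZ (by omega)]
    exact hDK
  | succ d ih =>
    intro D R k hN hkd hDZ hDK hRR hk hmin
    by_cases hDe : D = Z
    · exact hDe ▸ hDK
    have hZs := hZ.mono (Finset.Subset.refl A) (Finset.Subset.refl B) hDZ hRR
    obtain ⟨X, hXK, hX, hch⟩ := hstep D R k hN ⟨_, _, hZs, hc⟩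
    obtain ⟨P, hP⟩ := hX.exists_sep
    have hXD : (X ∪ D).card = X.card + D.card := Finset.card_union_of_disjoint hX.disj
    have hun := IsSeparation.uncross ht hZ hDZ hRR hP (fun P' Y' h => hXD ▸ hX.min P' Y' h)
    -- Otherwise `D` alone would be a separation. A vertex `z ∈ Z \ D` is reached from `A` past `Z`,
    -- hence past `D`, so `z ∈ P`; but uncrossing shows that `Z` avoids `P`.
    have hXne : X.Nonempty := by
      rw [Finset.nonempty_iff_ne_empty]
      rintro rfl
      rw [Finset.empty_union] at hP
      obtain ⟨z, hz, hzD⟩ : ∃ z ∈ Z, z ∉ D := by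
        by_contra hcon
        push Not at hcon
        exact hDe (Finset.Subset.antisymm hDZ hcon)
      have aux : ∀ v, v ∈ P ∪ D → v ∉ D → v ∈ P := fun v hv hvD =>
        (Finset.mem_union.1 hv).resolve_right hvD
      have hzP : z ∈ P := by
        rcases hA z hz with h | ⟨v, hv, hvz⟩
        · exact aux z (hP.src h) hzD
        · refine aux z (hP.closed v z hvz ?_) hzD
          refine reachSet_induction (p := fun v => v ∈ P) ?_ ?_ hv
          · exact fun a ha _ haZ => aux a (hP.src ha) fun h => haZ (hDZ h)
          · exact fun u v _ hu huv _ hvZ => aux v (hP.closed u v huv hu) fun h => hvZ (hDZ h)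
      rw [← hun] at hz
      exact (Finset.mem_sdiff.1 hz).2 (Finset.mem_union_right _ hzP)
    obtain ⟨x, hx, hND, hNR⟩ := hch hXne (by omega)
    have hxD : x ∉ D := Finset.disjoint_left.1 hX.disj hx
    have hxP : x ∉ P := fun h => Finset.disjoint_left.1 hP.disj h (Finset.mem_union_left _ hx)
    have hxR : x ∉ R := fun h => hxP (hP.kept h)
    by_cases hxZ : x ∈ Z
    · refine ih (insert x D) R (k + 1) hND (by omega) (Finset.insert_subset hxZ hDZ)
        (Finset.insert_subset (hXK hx) hDK) hRR ?_ fun P' X' h => ?_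
      · rw [Finset.card_insert_of_notMem hxD]; omega
      · exact hmin P' X' (h.mono (Finset.Subset.refl _) (Finset.Subset.refl _)
          (Finset.subset_insert _ _) (Finset.Subset.refl _))
    · have hxR₀ : x ∈ R₀ := by
        by_contra hxR₀
        refine hxZ (hun ▸ Finset.mem_sdiff.2 ⟨?_, ?_⟩)
        · exact Finset.mem_union_right _ (Finset.mem_union_left _ hx)
        · simp [hxR₀, hxP]
      refine ih D (insert x R) (k + 1) hNR (by omega) hDZ hDK (Finset.insert_subset hxR₀ hRR) ?_
        fun P' X' h => ?_
      · rw [Finset.card_insert_of_notMem hxR]; omega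
      · have h' := h.mono (Finset.Subset.refl _) (Finset.Subset.refl _) (Finset.Subset.refl _)
          (Finset.subset_insert x R)
        rw [Finset.card_insert_of_notMem hxR]
        -- Forbidding `x` strictly raises the minimum: a separation of the new node that is no
        -- larger than `X ∪ D` would have a source side disjoint from `X`, yet it has to contain
        -- `x`.
        have h1 := hmin _ _ hP
        have h2 := hX.min _ _ h'
        by_contra hlt
        exact Finset.disjoint_left.1 (hX.furthest _ _ h' (by omega)) hx
          (h.kept (Finset.mem_insert_self _ _))

end FinDigraph

namespace FinDigraph

variable {α : Type*} [DecidableEq α] {G H : FinDigraph α} {A B X Y K : Finset α}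

/-! ### Torsos -/

/-- There is a directed walk from `w` to `z` with at least one arc and no inner vertex in `K`. -/
def Through (G : FinDigraph α) (K : Finset α) (w z : α) : Prop :=
  ∃ v, Relation.ReflTransGen (fun a b => (a, b) ∈ G.arcs ∧ b ∉ K) w v ∧ (v, z) ∈ G.arcs

/-- `H` is the torso of `G` on the vertex set `K`. -/
structure IsTorso (G : FinDigraph α) (K : Finset α) (H : FinDigraph α) : Prop where
  subset : K ⊆ G.verts
  verts : H.verts = K
  arcs : ∀ w z, (w, z) ∈ H.arcs ↔ w ∈ K ∧ z ∈ K ∧ G.Through K w z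

/-- An arc of the torso stands for a walk whose inner vertices avoid `K`, hence avoid `X`.
Conversely a walk of `G` splits at its visits to `K` into such pieces. -/
theorem IsTorso.mem_reachSet_iff (h : G.IsTorso K H) (hA : A ⊆ K) (hX : X ⊆ K) {v : α}
    (hv : v ∈ K) : v ∈ H.reachSet A X ↔ v ∈ G.reachSet A X := by
  constructor
  · refine reachSet_induction (p := fun v => v ∈ G.reachSet A X) ?_ ?_
    · exact fun a ha haH haX => reachSet_base ha (h.subset (hA ha)) haX
    · intro u v _ hu huv _ hvX
      obtain ⟨_, _, x, hx, hxv⟩ := (h.arcs u v).1 huv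
      refine reachSet_closed ?_ hxv hvX
      clear hxv huv
      induction hx with
      | refl => exact hu
      | tail _ hab ih => exact reachSet_closed ih hab.1 fun hb => hab.2 (hX hb)
  · intro hr
    -- The witness `w` is the last vertex of `K` on the walk so far; the piece from `w` to `v` is an
    -- unfinished arc of the torso.
    have key : (v ∈ K → v ∈ H.reachSet A X) ∧ ∃ w ∈ K, w ∈ H.reachSet A X ∧
        Relation.ReflTransGen (fun a b => (a, b) ∈ G.arcs ∧ b ∉ K) w v := by
      refine reachSet_induction (p := fun v => (v ∈ K → v ∈ H.reachSet A X) ∧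
        ∃ w ∈ K, w ∈ H.reachSet A X ∧
        Relation.ReflTransGen (fun a b => (a, b) ∈ G.arcs ∧ b ∉ K) w v) ?_ ?_ hr
      · intro a ha _ haX
        have := reachSet_base (G := H) ha (h.verts ▸ hA ha) haX
        exact ⟨fun _ => this, a, hA ha, this, Relation.ReflTransGen.refl⟩
      · rintro u v _ ⟨hu, w, hwK, hw, hwu⟩ huv _ hvX
        by_cases hvK : v ∈ K
        · have : v ∈ H.reachSet A X :=
            reachSet_closed hw ((h.arcs w v).2 ⟨hwK, hvK, u, hwu, huv⟩) hvX
          exact ⟨fun _ => this, v, hvK, this, Relation.ReflTransGen.refl⟩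
        · exact ⟨fun h => absurd h hvK, w, hwK, hw, hwu.tail ⟨huv, hvK⟩⟩
    exact key.1 hv

theorem IsTorso.isSeparator_iff (h : G.IsTorso K H) (hA : A ⊆ K) (hB : B ⊆ K) (hX : X ⊆ K) :
    H.IsSeparator A B X ↔ G.IsSeparator A B X := by
  rw [FinDigraph.isSeparator_iff, FinDigraph.isSeparator_iff, h.verts]
  refine and_congr ⟨fun _ => hX.trans h.subset, fun _ => hX⟩ (forall₂_congr fun b hb => ?_)
  rw [h.mem_reachSet_iff hA hX (hB hb)]

theorem IsTorso.isMinimalSeparator_iff (h : G.IsTorso K H) (hA : A ⊆ K) (hB : B ⊆ K)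
    (hX : X ⊆ K) : H.IsMinimalSeparator A B X ↔ G.IsMinimalSeparator A B X := by
  unfold IsMinimalSeparator
  rw [h.isSeparator_iff hA hB hX]
  refine and_congr_right fun _ => forall₂_congr fun v _ => ?_
  rw [h.isSeparator_iff hA hB ((Finset.erase_subset _ _).trans hX)]

theorem IsTorso.reachSet_mem (h : G.IsTorso K H) {v : α} (hv : v ∈ H.reachSet A X) : v ∈ K :=
  h.verts ▸ (reachSet_spec hv).1

theorem IsTorso.isImportantSeparator_of (h : G.IsTorso K H) (hA : A ⊆ K) (hB : B ⊆ K)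
    (hX : X ⊆ K) (hG : G.IsImportantSeparator A B X) : H.IsImportantSeparator A B X := by
  refine ⟨(h.isMinimalSeparator_iff hA hB hX).2 hG.1, fun Y hY hc hlt => ?_⟩
  have hYK : Y ⊆ K := h.verts ▸ hY.1
  refine hG.2 Y ((h.isSeparator_iff hA hB hYK).1 hY) hc ⟨?_, fun hsub => ?_⟩
  · refine reachSet_subset_of_disjoint fun y hy hyr => ?_
    have := hlt.1 ((h.mem_reachSet_iff hA hX (hYK hy)).2 hyr)
    exact (reachSet_spec this).2 hy
  · refine hlt.2 fun v hv => ?_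
    have hvK := h.reachSet_mem hv
    exact (h.mem_reachSet_iff hA hX hvK).2 (hsub ((h.mem_reachSet_iff hA hYK hvK).1 hv))

/-- The backward direction is the delicate one, because a competitor `Y` in `G` need not lie in `K`.
It is pushed to an important separator `Z`, which does lie in `K` since `|Z| ≤ |Y| ≤ c`. In the
torso `Z` reaches at least as much as `X`; if it reaches no more, then `X = Z`, which contradicts
that `Y` reaches more than `X`. -/
theorem IsTorso.isImportantSeparator_iff (h : G.IsTorso K H) (hA : A ⊆ K) (hB : B ⊆ K) {c : ℕ}
    (hK : ∀ Z, G.IsImportantSeparator A B Z → Z.card ≤ c → Z ⊆ K) (hc : X.card ≤ c) :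
    G.IsImportantSeparator A B X ↔ X ⊆ H.verts ∧ H.IsImportantSeparator A B X := by
  rw [h.verts]
  refine ⟨fun hG => ⟨hK X hG hc, h.isImportantSeparator_of hA hB (hK X hG hc) hG⟩, ?_⟩
  rintro ⟨hX, hH⟩
  have hXm := (h.isMinimalSeparator_iff hA hB hX).1 hH.1
  refine ⟨hXm, fun Y hY hYc hlt => ?_⟩
  obtain ⟨Z, hZ, hZc, hYZ⟩ := exists_isImportantSeparator hY
  have hZK := hK Z hZ (by omega)
  refine hH.2 Z ((h.isSeparator_iff hA hB hZK).2 hZ.1.1) (by omega) ⟨fun v hv => ?_, fun hsub => ?_⟩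
  · have hvK := h.reachSet_mem hv
    exact (h.mem_reachSet_iff hA hZK hvK).2 (hYZ (hlt.1 ((h.mem_reachSet_iff hA hX hvK).1 hv)))
  · have heq : H.reachSet A X = H.reachSet A Z := by
      refine Set.Subset.antisymm (fun v hv => ?_) hsub
      have hvK := h.reachSet_mem hv
      exact (h.mem_reachSet_iff hA hZK hvK).2 (hYZ (hlt.1 ((h.mem_reachSet_iff hA hX hvK).1 hv)))
    have := eq_of_reachSet_eq hH.1 heq (by omega)
    subst this
    exact hlt.2 hYZ

theorem minCutSize_le {k : ℕ} (hX : G.IsSeparator A B X) (hk : X.card = k) :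
    G.minCutSize A B ≤ k := Nat.sInf_le ⟨X, hX, hk⟩

theorem exists_isSeparator_card_eq (G : FinDigraph α) (A B : Finset α) :
    ∃ X, G.IsSeparator A B X ∧ X.card = G.minCutSize A B :=
  Nat.sInf_mem (s := {k | ∃ X : Finset α, G.IsSeparator A B X ∧ X.card = k})
    ⟨_, _, G.isSeparator_verts A B, rfl⟩

/-- A minimum cut of `G` can be pushed to an important one of at most the same size, and this one
survives in the torso; separators of the torso are separators of `G`. -/
theorem IsTorso.minCutSize_eq (h : G.IsTorso K H) (hA : A ⊆ K) (hB : B ⊆ K) {c : ℕ}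
    (hK : ∀ Z, G.IsImportantSeparator A B Z → Z.card ≤ c → Z ⊆ K)
    (hc : G.minCutSize A B ≤ c) : H.minCutSize A B = G.minCutSize A B := by
  apply le_antisymm
  · obtain ⟨X, hX, hXc⟩ := G.exists_isSeparator_card_eq A B
    obtain ⟨Z, hZ, hZc, _⟩ := exists_isImportantSeparator hX
    have := minCutSize_le ((h.isSeparator_iff hA hB (hK Z hZ (by omega))).2 hZ.1.1) rfl
    omega
  · obtain ⟨X, hX, hXc⟩ := H.exists_isSeparator_card_eq A B
    exact minCutSize_le ((h.isSeparator_iff hA hB (h.verts ▸ hX.1)).1 hX) hXc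

end FinDigraph

namespace RAM

/-! ### Verifying programs -/

@[simp] theorem State.reg_setReg (s : State) (x k y : ℕ) :
    (s.setReg x k).reg y = if y = x then k else s.reg y := by
  simp [State.setReg, Function.update_apply]

@[simp] theorem State.arr_setReg (s : State) (x k : ℕ) : (s.setReg x k).arr = s.arr := rfl

@[simp] theorem State.reg_setArr (s : State) (a i k : ℕ) : (s.setArr a i k).reg = s.reg := rfl

@[simp] theorem State.arr_setArr (s : State) (a i k b : ℕ) :
    (s.setArr a i k).arr b = if b = a then Function.update (s.arr a) i k else s.arr b := by
  simp [State.setArr, Function.update_apply]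

/-- Started in `s`, the program halts after `t` steps in a state `s'` such that `Q t s'`. -/
def Exec (p : Prog) (s : State) (Q : ℕ → State → Prop) : Prop :=
  ∃ t s', Run p s t s' ∧ Q t s'

theorem Exec.mono {p : Prog} {s : State} {Q Q' : ℕ → State → Prop} (h : Exec p s Q)
    (hQ : ∀ t s', Q t s' → Q' t s') : Exec p s Q' := by
  obtain ⟨t, s', h1, h2⟩ := h
  exact ⟨t, s', h1, hQ t s' h2⟩

section

variable {p q : Prog} {s : State} {Q : ℕ → State → Prop}

/-- Determinism turns `Exec` into an exact weakest precondition, so straight-line code is verified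
by rewriting. -/
theorem exec_iff_of_run {t : ℕ} {s' : State} (h : Run p s t s') : Exec p s Q ↔ Q t s' := by
  refine ⟨fun ⟨t₁, s₁, h1, h2⟩ => ?_, fun hQ => ⟨t, s', h, hQ⟩⟩
  obtain ⟨rfl, rfl⟩ := h.deterministic h1
  exact h2

@[simp] theorem exec_skip : Exec .skip s Q ↔ Q 1 s := exec_iff_of_run (.skip s)

@[simp] theorem exec_const {x k : ℕ} : Exec (.const x k) s Q ↔ Q 1 (s.setReg x k) :=
  exec_iff_of_run (.const x k s)

@[simp] theorem exec_copy {x y : ℕ} : Exec (.copy x y) s Q ↔ Q 1 (s.setReg x (s.reg y)) :=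
  exec_iff_of_run (.copy x y s)

@[simp] theorem exec_succ {x y : ℕ} : Exec (.succ x y) s Q ↔ Q 1 (s.setReg x (s.reg y + 1)) :=
  exec_iff_of_run (.succ x y s)

@[simp] theorem exec_sub {x y z : ℕ} :
    Exec (.sub x y z) s Q ↔ Q 1 (s.setReg x (s.reg y - s.reg z)) :=
  exec_iff_of_run (.sub x y z s)

@[simp] theorem exec_load {x a i : ℕ} :
    Exec (.load x a i) s Q ↔ Q 1 (s.setReg x (s.arr a (s.reg i))) :=
  exec_iff_of_run (.load x a i s)

@[simp] theorem exec_store {a i x : ℕ} :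
    Exec (.store a i x) s Q ↔ Q 1 (s.setArr a (s.reg i) (s.reg x)) :=
  exec_iff_of_run (.store a i x s)

@[simp] theorem exec_seq :
    Exec (.seq p q) s Q ↔ Exec p s fun t s₁ => Exec q s₁ fun t' s₂ => Q (t + t') s₂ := by
  constructor
  · rintro ⟨t, s', h, hQ⟩
    cases h with
    | seq h1 h2 => exact ⟨_, _, h1, _, _, h2, hQ⟩
  · rintro ⟨t, s₁, h1, t', s₂, h2, hQ⟩
    exact ⟨_, _, .seq h1 h2, hQ⟩

theorem exec_cond_true {b : Test} (h : b.Holds s) (hp : Exec p s fun t s' => Q (t + 1) s') :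
    Exec (.cond b p q) s Q := by
  obtain ⟨t, s', h1, h2⟩ := hp
  exact ⟨_, _, .cond_true h h1, h2⟩

theorem exec_cond_false {b : Test} (h : ¬ b.Holds s)
    (hq : Exec q s fun t s' => Q (t + 1) s') : Exec (.cond b p q) s Q := by
  obtain ⟨t, s', h1, h2⟩ := hq
  exact ⟨_, _, .cond_false h h1, h2⟩

@[simp] theorem exec_cond {b : Test} : Exec (.cond b p q) s Q ↔
    (b.Holds s → Exec p s fun t s' => Q (t + 1) s') ∧
      (¬ b.Holds s → Exec q s fun t s' => Q (t + 1) s') := by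
  constructor
  · rintro ⟨t, s', h, hQ⟩
    cases h with
    | cond_true hb h1 => exact ⟨fun _ => ⟨_, _, h1, hQ⟩, fun hn => absurd hb hn⟩
    | cond_false hb h1 => exact ⟨fun hn => absurd hn hb, fun _ => ⟨_, _, h1, hQ⟩⟩
  · rintro ⟨h1, h2⟩
    by_cases hb : b.Holds s
    · exact exec_cond_true hb (h1 hb)
    · exact exec_cond_false hb (h2 hb)

@[simp] theorem holds_eq {x y : ℕ} : (Test.eq x y).Holds s ↔ s.reg x = s.reg y := Iff.rfl
@[simp] theorem holds_ne {x y : ℕ} : (Test.ne x y).Holds s ↔ s.reg x ≠ s.reg y := Iff.rfl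
@[simp] theorem holds_lt {x y : ℕ} : (Test.lt x y).Holds s ↔ s.reg x < s.reg y := Iff.rfl

end

/-! ### Frames: what a program leaves unchanged -/

/-- `p` contains an instruction that writes into register `x`. -/
def Prog.writesReg : Prog → ℕ → Bool
  | .skip, _ => false
  | .const y _, x => x == y
  | .copy y _, x => x == y
  | .succ y _, x => x == y
  | .sub y _ _, x => x == y
  | .load y _ _, x => x == y
  | .store _ _ _, _ => false
  | .seq p q, x => p.writesReg x || q.writesReg x
  | .cond _ p q, x => p.writesReg x || q.writesReg x
  | .loop _ p, x => p.writesReg x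

/-- `p` contains an instruction that writes into array `a`. -/
def Prog.writesArr : Prog → ℕ → Bool
  | .store b _ _, a => a == b
  | .seq p q, a => p.writesArr a || q.writesArr a
  | .cond _ p q, a => p.writesArr a || q.writesArr a
  | .loop _ p, a => p.writesArr a
  | _, _ => false

/-- `s'` differs from `s` only where `p` writes. -/
structure Frame (p : Prog) (s s' : State) : Prop where
  reg : ∀ x, p.writesReg x = false → s'.reg x = s.reg x
  arr : ∀ a, p.writesArr a = false → s'.arr a = s.arr a

theorem Frame.rfl' {p : Prog} {s : State} : Frame p s s := ⟨fun _ _ => rfl, fun _ _ => rfl⟩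

theorem Frame.trans' {p : Prog} {s s₁ s₂ : State} (h : Frame p s s₁) (h' : Frame p s₁ s₂) :
    Frame p s s₂ :=
  ⟨fun x hx => (h'.reg x hx).trans (h.reg x hx), fun a ha => (h'.arr a ha).trans (h.arr a ha)⟩

theorem Run.frame {p : Prog} {s s' : State} {t : ℕ} (h : Run p s t s') : Frame p s s' := by
  induction h with
  | skip | const | copy | succ | sub | load | store =>
    constructor <;> intro x hx <;> simp_all [Prog.writesReg, Prog.writesArr]
  | seq _ _ ih1 ih2 =>
    constructor <;> intro x hx <;>
      simp only [Prog.writesReg, Prog.writesArr, Bool.or_eq_false_iff] at hx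
    · exact (ih2.reg x hx.2).trans (ih1.reg x hx.1)
    · exact (ih2.arr x hx.2).trans (ih1.arr x hx.1)
  | cond_true _ _ ih =>
    constructor <;> intro x hx <;>
      simp only [Prog.writesReg, Prog.writesArr, Bool.or_eq_false_iff] at hx
    · exact ih.reg x hx.1
    · exact ih.arr x hx.1
  | cond_false _ _ ih =>
    constructor <;> intro x hx <;>
      simp only [Prog.writesReg, Prog.writesArr, Bool.or_eq_false_iff] at hx
    · exact ih.reg x hx.2
    · exact ih.arr x hx.2
  | loop_true _ _ _ ih1 ih2 =>
    exact ⟨fun x hx => (ih2.reg x hx).trans (ih1.reg x hx),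
      fun x hx => (ih2.arr x hx).trans (ih1.arr x hx)⟩
  | loop_false => exact Frame.rfl'

theorem Exec.frame {p : Prog} {s : State} {Q : ℕ → State → Prop} (h : Exec p s Q) :
    Exec p s fun t s' => Q t s' ∧ Frame p s s' := by
  obtain ⟨t, s', h1, h2⟩ := h
  exact ⟨t, s', h1, h2, h1.frame⟩

/-- Sequential composition, with the frame of the first program. -/
theorem Exec.seq {p q : Prog} {s : State} {Q Q' : ℕ → State → Prop} (hp : Exec p s Q)
    (hq : ∀ t s₁, Q t s₁ → Frame p s s₁ → Exec q s₁ fun t' s₂ => Q' (t + t') s₂) :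
    Exec (.seq p q) s Q' := by
  rw [exec_seq]
  exact hp.frame.mono fun t s₁ h => hq t s₁ h.1 h.2

/-- Loops with an invariant `I k`, where `k` bounds the remaining number of steps. -/
theorem exec_loop {b : Test} {p : Prog} {s : State} {k : ℕ} (I : ℕ → State → Prop)
    (h : ∀ k s₁, I k s₁ → b.Holds s₁ → Frame p s s₁ →
      Exec p s₁ fun t s' => ∃ k', I k' s' ∧ k' + t + 1 ≤ k) (hs : I k s) :
    Exec (.loop b p) s fun t s' => ∃ k', I k' s' ∧ ¬ b.Holds s' ∧ k' + t ≤ k + 1 := by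
  suffices H : ∀ k s₁, Frame p s s₁ → I k s₁ →
      Exec (.loop b p) s₁ fun t s' => ∃ k', I k' s' ∧ ¬ b.Holds s' ∧ k' + t ≤ k + 1 from
    H k s Frame.rfl' hs
  intro k
  induction k using Nat.strong_induction_on with
  | _ k ih =>
    intro s₁ hf hI
    by_cases hb : b.Holds s₁
    · obtain ⟨t, s₂, hr, k', hI', hk⟩ := h k s₁ hI hb hf
      obtain ⟨t', s₃, hr', k'', hI'', hb'', hk''⟩ := ih k' (by omega) s₂ (hf.trans' hr.frame) hI'
      exact ⟨_, _, .loop_true hb hr hr', k'', hI'', hb'', by omega⟩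
    · exact ⟨1, s₁, .loop_false hb, k, hI, hb, by omega⟩

/-- `for i < n do p`. -/
def Prog.forLt (i n : ℕ) (p : Prog) : Prog :=
  .seq (.const i 0) (.loop (.lt i n) (.seq p (.succ i i)))

/-- The invariant is required after the increment of the counter. Each round costs the body plus one
test and one increment; the final `2` pays for the initialization and for the failing test. -/
theorem exec_forLt {i n N T : ℕ} {p : Prog} {s : State} (J : ℕ → State → Prop)
    (hn : s.reg n = N) (hi : p.writesReg i = false) (hp : p.writesReg n = false) (hne : n ≠ i)
    (h0 : J 0 (s.setReg i 0))
    (hstep : ∀ k s₁, k < N → J k s₁ → s₁.reg i = k → Frame (Prog.forLt i n p) s s₁ →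
      Exec p s₁ fun t s₂ => t ≤ T ∧ J (k + 1) (s₂.setReg i (k + 1))) :
    Exec (Prog.forLt i n p) s fun t s' => t ≤ N * (T + 2) + 2 ∧ J N s' ∧ s'.reg i = N := by
  unfold Prog.forLt
  simp only [exec_seq, exec_const]
  have key := exec_loop (b := .lt i n) (p := .seq p (.succ i i)) (s := s.setReg i 0)
    (k := N * (T + 2))
    (fun k s₁ => ∃ j, j ≤ N ∧ J j s₁ ∧ s₁.reg i = j ∧ k = (N - j) * (T + 2)) ?_ ?_
  · refine key.frame.mono ?_
    rintro t s' ⟨⟨k', ⟨j, hj, hJ, hij, hk⟩, hb, hkt⟩, hf⟩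
    have hn' : s'.reg n = N := by
      rw [hf.reg n (by simp [Prog.writesReg, hp, hne])]
      simp [hne, hn]
    have : j = N := by
      simp only [holds_lt, hij, hn'] at hb
      omega
    subst this
    refine ⟨by omega, hJ, hij⟩
  · rintro k s₁ ⟨j, hj, hJ, hij, hk⟩ hb hf
    have hfr : Frame (Prog.forLt i n p) s s₁ := by
      constructor
      · intro x hx
        simp only [Prog.forLt, Prog.writesReg, Bool.or_eq_false_iff, beq_eq_false_iff_ne] at hx
        rw [hf.reg x (by simp [Prog.writesReg, hx])]
        simp [hx.1]
      · intro a ha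
        simp only [Prog.forLt, Prog.writesArr, Bool.or_false, Bool.false_or] at ha
        rw [hf.arr a (by simp [Prog.writesArr, ha])]
        rfl
    have hn' : s₁.reg n = N := by
      rw [hf.reg n (by simp [Prog.writesReg, hp, hne])]
      simp [hne, hn]
    simp only [holds_lt, hij, hn'] at hb
    simp only [exec_seq, exec_succ]
    refine (hstep j s₁ hb hJ hij hfr).frame.mono ?_
    rintro t s₂ ⟨⟨ht, hJ'⟩, hf₂⟩
    have hi2 : s₂.reg i = j := by rw [hf₂.reg i hi, hij]
    refine ⟨(N - (j + 1)) * (T + 2), ⟨j + 1, hb, by rwa [hi2], by simp [hi2], rfl⟩, ?_⟩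
    have : N - j = (N - (j + 1)) + 1 := by omega
    rw [hk, this, add_mul]
    omega
  · exact ⟨0, Nat.zero_le _, h0, by simp, by simp⟩

end RAM

namespace RAM

notation:67 p:68 ";;" q:67 => Prog.seq p q

/-! ### The input

Registers: `0`–`3` input, `4`, `5` output sizes, `6`, `7`, `29`, `31` the constants `0`, `1`, `2`,
`3`, `8`, `9` the bounds `3 * c` and `2 * c`, `10` the current node of the search tree, `11` the
number of nodes. Arrays: `0`–`2` input, `3`–`5` output, `6`, `7` linked lists of incoming arcs, `8`
the vertices to be kept, `9`–`13`, `23` the search tree, `14`–`22` the flow computation. -/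

/-- `l` lists the values `tl` along the linked list `nx` that starts at `p`; a pointer to the item
`e` is stored as `e + 1`. -/
def Linked (nx tl : ℕ → ℕ) : ℕ → List ℕ → Prop
  | p, [] => p = 0
  | p, w :: l => ∃ e, p = e + 1 ∧ tl e = w ∧ Linked nx tl (nx e) l

/-- An input graph with its lists `L v` of in-neighbours. -/
structure Inst where
  n : ℕ
  m : ℕ
  t : ℕ
  c : ℕ
  G : FinDigraph ℕ
  tl : ℕ → ℕ
  hv : ℕ → ℕ
  tm : ℕ → ℕ
  hd : ℕ → ℕ
  nx : ℕ → ℕ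
  L : ℕ → List ℕ
  verts : G.verts = Finset.range n
  arcs : ∀ u v, (u, v) ∈ G.arcs ↔ ∃ e < m, tl e = u ∧ hv e = v
  linked : ∀ v < n, Linked nx tl (hd v) (L v)
  mem_L : ∀ v < n, ∀ w, w ∈ L v ↔ (w, v) ∈ G.arcs
  sum_L : ∑ v ∈ Finset.range n, (L v).length ≤ m
  tm_lt : ∀ i < t, tm i < n
  tm_inj : ∀ i < t, ∀ j < t, tm i = tm j → i = j

theorem Inst.fst_lt (I : Inst) {u v : ℕ} (h : (u, v) ∈ I.G.arcs) : u < I.n := by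
  have := I.G.fst_mem _ h
  rwa [I.verts, Finset.mem_range] at this

theorem Inst.snd_lt (I : Inst) {u v : ℕ} (h : (u, v) ∈ I.G.arcs) : v < I.n := by
  have := I.G.snd_mem _ h
  rwa [I.verts, Finset.mem_range] at this

theorem Inst.t_le (I : Inst) : I.t ≤ I.n := by
  have := Finset.card_le_card_of_injOn (s := Finset.range I.t) (t := Finset.range I.n) I.tm
    (fun i hi => by simpa using I.tm_lt i (by simpa using hi))
    (fun i hi j hj => I.tm_inj i (by simpa using hi) j (by simpa using hj))
  simpa using this

/-- The state holds the input and the constants. -/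
structure Stat (I : Inst) (s : State) : Prop where
  r0 : s.reg 0 = I.n
  r1 : s.reg 1 = I.m
  r2 : s.reg 2 = I.t
  r3 : s.reg 3 = I.c
  r6 : s.reg 6 = 0
  r7 : s.reg 7 = 1
  r8 : s.reg 8 = 3 * I.c
  r9 : s.reg 9 = 2 * I.c
  r29 : s.reg 29 = 2
  r31 : s.reg 31 = 3
  a0 : s.arr 0 = I.tl
  a1 : s.arr 1 = I.hv
  a2 : s.arr 2 = I.tm
  a6 : s.arr 6 = I.hd
  a7 : s.arr 7 = I.nx

/-- `p` does not write where the input and the constants are stored. -/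
def Prog.keepsStat (p : Prog) : Bool :=
  [0, 1, 2, 3, 6, 7, 8, 9, 29, 31].all (fun x => !p.writesReg x) &&
    [0, 1, 2, 6, 7].all (fun a => !p.writesArr a)

theorem Stat.frame {I : Inst} {p : Prog} {s s' : State} (h : Stat I s) (hf : Frame p s s')
    (hp : p.keepsStat = true) : Stat I s' := by
  simp only [Prog.keepsStat, List.all_cons, List.all_nil, Bool.and_true, Bool.and_eq_true,
    Bool.not_eq_true'] at hp
  obtain ⟨⟨q0, q1, q2, q3, q6, q7, q8, q9, q29, q31⟩, p0, p1, p2, p6, p7⟩ := hp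
  exact ⟨(hf.reg _ q0).trans h.r0, (hf.reg _ q1).trans h.r1, (hf.reg _ q2).trans h.r2,
    (hf.reg _ q3).trans h.r3, (hf.reg _ q6).trans h.r6, (hf.reg _ q7).trans h.r7,
    (hf.reg _ q8).trans h.r8, (hf.reg _ q9).trans h.r9, (hf.reg _ q29).trans h.r29,
    (hf.reg _ q31).trans h.r31, (hf.arr _ p0).trans h.a0, (hf.arr _ p1).trans h.a1,
    (hf.arr _ p2).trans h.a2, (hf.arr _ p6).trans h.a6, (hf.arr _ p7).trans h.a7⟩

theorem Stat.setReg {I : Inst} {s : State} (h : Stat I s) {x k : ℕ}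
    (hx : (Prog.const x k).keepsStat = true) : Stat I (s.setReg x k) :=
  h.frame (Run.const x k s).frame hx

theorem Stat.setArr {I : Inst} {s : State} (h : Stat I s) {a i k : ℕ}
    (ha : (Prog.store a 0 0).keepsStat = true) : Stat I (s.setArr a i k) := by
  refine h.frame (p := .store a 0 0) ⟨fun _ _ => rfl, fun b hb => ?_⟩ ha
  simp only [Prog.writesArr, beq_eq_false_iff_ne] at hb
  simp [hb]

/-! ### Breadth-first search

Arrays: `14` dead vertices, `15` sources, `16` sinks, `17` the flow (`0` for `none`, `u + 1` for
`some u`), `18` visited vertices, `19` queue, `20` parents (`0` for a source, `p + 1` for `p`), `21`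
expanded vertices. Registers: `16`, `17` the ends of the queue, `18` the parent of newly visited
vertices, `20` an augmenting vertex (plus one), if one is found. -/

/-- Visit the vertex in register `21`, unless it is visited or dead. -/
def visit : Prog :=
  .load 13 18 21;; .cond (.eq 13 6)
    (.store 18 21 7;; .store 20 21 18;; .store 19 17 21;; .succ 17 17) .skip

/-- Visit the tails of the list of arcs that starts in register `19`. -/
def scan : Prog :=
  .loop (.ne 19 6) (.sub 14 19 7;; .load 21 0 14;; visit;; .load 19 7 14)

/-- Work off the queue. -/
def bfs : Prog :=
  .loop (.lt 16 17) (.load 24 19 16;; .succ 16 16;; .load 22 17 24;;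
    .cond (.eq 22 6) .skip
      (.sub 22 22 7;; .load 13 16 22;;
        .cond (.eq 13 7) (.succ 20 24)
          (.store 21 22 7;; .succ 18 24;; .copy 21 22;; visit;; .load 19 6 22;; scan)))

/-- `w` may be visited with parent `p` (plus one). -/
def Justified (I : Inst) (Src : ℕ → Prop) (s : State) (i p w : ℕ) : Prop :=
  (p = 0 ∧ Src w) ∨ ∃ j < i, ∃ u, p = s.arr 19 j + 1 ∧ s.arr 17 (s.arr 19 j) = u + 1 ∧
    (u = w ∨ (w, u) ∈ I.G.arcs)

/-- The queue lists the visited vertices. -/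
structure QInv (I : Inst) (V : Finset ℕ) (Src : ℕ → Prop) (s : State) : Prop where
  sub : V ⊆ Finset.range I.n
  alive : ∀ v < I.n, s.arr 18 v = 0 → v ∈ V
  mem : ∀ i < s.reg 17, s.arr 19 i ∈ V
  vis : ∀ i < s.reg 17, s.arr 18 (s.arr 19 i) = 1
  ex : ∀ v < I.n, s.arr 18 v = 1 → ∃ i < s.reg 17, s.arr 19 i = v
  inj : ∀ i < s.reg 17, ∀ j < s.reg 17, s.arr 19 i = s.arr 19 j → i = j
  par : ∀ i < s.reg 17, Justified I Src s i (s.arr 20 (s.arr 19 i)) (s.arr 19 i)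

/-- `s'` arises from `s` by visiting vertices. -/
structure Ext (s s' : State) : Prop where
  qt : s.reg 17 ≤ s'.reg 17
  queue : ∀ i < s.reg 17, s'.arr 19 i = s.arr 19 i
  vis : ∀ v, s'.arr 18 v = s.arr 18 v ∨ (s.arr 18 v = 0 ∧ s'.arr 18 v = 1)
  mate : s'.arr 17 = s.arr 17

theorem Ext.refl' (s : State) : Ext s s := ⟨le_rfl, fun _ _ => rfl, fun _ => Or.inl rfl, rfl⟩

theorem Ext.trans' {s s₁ s₂ : State} (h : Ext s s₁) (h' : Ext s₁ s₂) : Ext s s₂ where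
  qt := h.qt.trans h'.qt
  queue i hi := (h'.queue i (by have := h.qt; omega)).trans (h.queue i hi)
  vis v := by
    have h1 := h.vis v
    have h2 := h'.vis v
    omega
  mate := h'.mate.trans h.mate

theorem Ext.vis_ne {s s' : State} (h : Ext s s') {v : ℕ} (hv : s.arr 18 v ≠ 0) :
    s'.arr 18 v ≠ 0 := by
  have := h.vis v
  omega

theorem Ext.vis_one {s s' : State} (h : Ext s s') {v : ℕ} (hv : s.arr 18 v = 1) :
    s'.arr 18 v = 1 := by
  have := h.vis v
  omega

theorem Ext.justified {I : Inst} {Src : ℕ → Prop} {s s' : State} (h : Ext s s') {i i' p w : ℕ}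
    (hi : i ≤ s.reg 17) (hi' : i ≤ i') (hj : Justified I Src s i p w) :
    Justified I Src s' i' p w := by
  rcases hj with hj | ⟨j, hj, u, h1, h2, h3⟩
  · exact Or.inl hj
  · refine Or.inr ⟨j, by omega, u, ?_, ?_, h3⟩
    · rw [h.queue j (by omega)]; exact h1
    · rw [h.queue j (by omega), h.mate]; exact h2

section

variable {I : Inst} {V : Finset ℕ} {Src : ℕ → Prop} {s : State}

theorem QInv.congr {s' : State} (h : QInv I V Src s) (h17 : s'.reg 17 = s.reg 17)
    (a17 : s'.arr 17 = s.arr 17) (a18 : s'.arr 18 = s.arr 18) (a19 : s'.arr 19 = s.arr 19)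
    (a20 : s'.arr 20 = s.arr 20) : QInv I V Src s' := by
  obtain ⟨h1, h2, h3, h4, h5, h6, h7⟩ := h
  unfold Justified at h7
  refine ⟨h1, ?_, ?_, ?_, ?_, ?_, ?_⟩ <;> simp only [h17, a18, a19, a20, Justified, a17] <;>
    assumption

theorem Ext.of_eq {s' : State} (h17 : s'.reg 17 = s.reg 17)
    (a17 : s'.arr 17 = s.arr 17) (a18 : s'.arr 18 = s.arr 18) (a19 : s'.arr 19 = s.arr 19) :
    Ext s s' := by
  constructor <;> simp [h17, a18, a19, a17]

theorem QInv.le (h : QInv I V Src s) : s.reg 17 ≤ I.n := by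
  have := Finset.card_le_card_of_injOn (s := Finset.range (s.reg 17)) (t := Finset.range I.n)
    (fun i => s.arr 19 i) (fun i hi => h.sub (h.mem i (by simpa using hi)))
    (fun i hi j hj => h.inj i (by simpa using hi) j (by simpa using hj))
  simpa using this

/-- Dead vertices carry a mark other than `0` and `1` in array `18`, so one comparison with `0`
rejects both visited and dead vertices. For this reason the conclusion says "nonzero" and not
"visited". -/
theorem exec_visit (hs : Stat I s) (h : QInv I V Src s) (hw : s.reg 21 < I.n)
    (hj : Justified I Src s (s.reg 17) (s.reg 18) (s.reg 21)) :
    Exec visit s fun t s' => t ≤ 6 ∧ QInv I V Src s' ∧ Ext s s' ∧ s'.arr 18 (s.reg 21) ≠ 0 := by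
  unfold visit
  simp only [exec_seq, exec_load, exec_cond, holds_eq, State.reg_setReg, hs.r6]
  refine ⟨fun h0 => ?_, fun h0 => ?_⟩
  · simp only [if_true, Nat.reduceEqDiff, if_false] at h0
    simp only [exec_store, exec_succ, State.reg_setArr, State.reg_setReg, State.arr_setReg,
      Nat.reduceEqDiff, if_false, hs.r7]
    generalize hS : State.setReg _ 17 _ = s'
    have r17 : s'.reg 17 = s.reg 17 + 1 := by rw [← hS]; simp
    have a17 : s'.arr 17 = s.arr 17 := by rw [← hS]; simp
    have a18 : s'.arr 18 = Function.update (s.arr 18) (s.reg 21) 1 := by rw [← hS]; simp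
    have a19 : s'.arr 19 = Function.update (s.arr 19) (s.reg 17) (s.reg 21) := by
      rw [← hS]; simp
    have a20 : s'.arr 20 = Function.update (s.arr 20) (s.reg 21) (s.reg 18) := by
      rw [← hS]; simp
    have hq : ∀ i < s.reg 17, s'.arr 19 i = s.arr 19 i := fun i hi => by
      rw [a19, Function.update_of_ne (by omega)]
    have hq' : s'.arr 19 (s.reg 17) = s.reg 21 := by rw [a19, Function.update_self]
    have hne : ∀ i < s.reg 17, s.arr 19 i ≠ s.reg 21 := fun i hi he => by
      have := h.vis i hi
      rw [he] at this
      omega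
    have hext : Ext s s' := by
      refine ⟨by omega, hq, fun v => ?_, a17⟩
      rw [a18, Function.update_apply]
      split_ifs with hv
      · right; rw [hv]; exact ⟨h0, rfl⟩
      · left; rfl
    refine ⟨by norm_num, ⟨h.sub, ?_, ?_, ?_, ?_, ?_, ?_⟩, hext, ?_⟩
    · intro v hv hv0
      refine h.alive v hv ?_
      have := hext.vis v
      omega
    · intro i hi
      rcases Nat.lt_succ_iff_lt_or_eq.1 (r17 ▸ hi) with hi | rfl
      · rw [hq i hi]; exact h.mem i hi
      · rw [hq']; exact h.alive _ hw h0
    · intro i hi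
      rcases Nat.lt_succ_iff_lt_or_eq.1 (r17 ▸ hi) with hi | rfl
      · rw [hq i hi]; exact hext.vis_one (h.vis i hi)
      · rw [hq', a18, Function.update_self]
    · intro v hv hv1
      rw [a18, Function.update_apply] at hv1
      split_ifs at hv1 with hvw
      · exact ⟨s.reg 17, by omega, by rw [hq', hvw]⟩
      · obtain ⟨i, hi, he⟩ := h.ex v hv hv1
        exact ⟨i, by omega, by rw [hq i hi, he]⟩
    · intro i hi j hj hij
      rcases Nat.lt_succ_iff_lt_or_eq.1 (r17 ▸ hi) with hi | rfl <;>
        rcases Nat.lt_succ_iff_lt_or_eq.1 (r17 ▸ hj) with hj | rfl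
      · rw [hq i hi, hq j hj] at hij; exact h.inj i hi j hj hij
      · rw [hq i hi, hq'] at hij; exact absurd hij (hne i hi)
      · rw [hq j hj, hq'] at hij; exact absurd hij.symm (hne j hj)
      · rfl
    · intro i hi
      rcases Nat.lt_succ_iff_lt_or_eq.1 (r17 ▸ hi) with hi | rfl
      · rw [hq i hi, a20, Function.update_of_ne (hne i hi)]
        exact hext.justified (by omega) le_rfl (h.par i hi)
      · rw [hq', a20, Function.update_self]
        exact hext.justified le_rfl le_rfl hj
    · simp
  · simp only [if_true, Nat.reduceEqDiff, if_false] at h0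
    simp only [exec_skip]
    exact ⟨by norm_num, h.congr (by simp) rfl rfl rfl rfl, Ext.of_eq (by simp) rfl rfl rfl, h0⟩

theorem exec_scan (l : List ℕ) (hs : Stat I s) (h : QInv I V Src s)
    (hl : Linked I.nx I.tl (s.reg 19) l) (hln : ∀ w ∈ l, w < I.n)
    (hj : ∀ w ∈ l, Justified I Src s (s.reg 17) (s.reg 18) w) :
    Exec scan s fun t s' => t ≤ 10 * l.length + 1 ∧ QInv I V Src s' ∧ Ext s s' ∧
      ∀ w ∈ l, s'.arr 18 w ≠ 0 := by
  unfold scan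
  refine (exec_loop (k := 10 * l.length) (fun k s₁ => ∃ l₁ l₂, l = l₁ ++ l₂ ∧
    k = 10 * l₂.length ∧ QInv I V Src s₁ ∧ Ext s s₁ ∧ Linked I.nx I.tl (s₁.reg 19) l₂ ∧
    ∀ w ∈ l₁, s₁.arr 18 w ≠ 0) ?_ ⟨[], l, rfl, rfl, h, Ext.refl' s, hl, by simp⟩).frame.mono ?_
  · rintro k s₁ ⟨l₁, l₂, rfl, rfl, hq, hext, hlk, hvis⟩ hb hf
    have hs₁ : Stat I s₁ := hs.frame hf rfl
    simp only [holds_ne, hs₁.r6] at hb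
    cases l₂ with
    | nil => exact absurd hlk hb
    | cons w l₂ =>
      obtain ⟨e, he, hw, hlk⟩ := hlk
      simp only [exec_seq, exec_sub, exec_load]
      generalize hS : State.setReg (State.setReg s₁ 14 _) 21 _ = s₂
      have r14 : s₂.reg 14 = e := by rw [← hS]; simp [he, hs₁.r7]
      have r21 : s₂.reg 21 = w := by rw [← hS]; simp [he, hs₁.r7, hs₁.a0, hw]
      have e12 : Ext s₁ s₂ := by rw [← hS]; exact Ext.of_eq (by simp) rfl rfl rfl
      have hq2 : QInv I V Src s₂ := by rw [← hS]; exact hq.congr (by simp) rfl rfl rfl rfl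
      have hs₂ : Stat I s₂ := by rw [← hS]; exact (hs₁.setReg rfl).setReg rfl
      have r18 : s₂.reg 18 = s.reg 18 := by
        rw [← hS]; simp [hf.reg 18 rfl]
      have hwl : w ∈ l₁ ++ w :: l₂ := by simp
      have e02 := hext.trans' e12
      refine (exec_visit hs₂ hq2 (r21 ▸ hln w hwl)
        (by rw [r21, r18]; exact e02.justified le_rfl e02.qt (hj w hwl))).frame.mono ?_
      rintro t s₃ ⟨⟨ht, hq3, e23, hv⟩, hf3⟩
      have r14' : s₃.reg 14 = e := by rw [hf3.reg 14 rfl, r14]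
      have a7 : s₃.arr 7 = I.nx := by rw [hf3.arr 7 rfl, hs₂.a7]
      rw [r21] at hv
      refine ⟨10 * l₂.length, ⟨l₁ ++ [w], l₂, by simp, rfl, hq3.congr (by simp) rfl rfl rfl rfl,
        (e02.trans' e23).trans' (Ext.of_eq (by simp) rfl rfl rfl), ?_, ?_⟩, ?_⟩
      · simpa [r14', a7] using hlk
      · intro v hvm
        rcases List.mem_append.1 hvm with hvm | hvm
        · exact (e12.trans' e23).vis_ne (hvis v hvm)
        · rw [List.mem_singleton.1 hvm]; exact hv
      · simp only [List.length_cons]; omega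
  · rintro t s' ⟨⟨k', ⟨l₁, l₂, rfl, rfl, hq, hext, hlk, hvis⟩, hb, ht⟩, hf⟩
    have hs' : Stat I s' := hs.frame hf rfl
    simp only [holds_ne, hs'.r6, not_not] at hb
    cases l₂ with
    | nil =>
      refine ⟨by omega, hq, hext, fun w hw => hvis w (by simpa using hw)⟩
    | cons w l₂ =>
      obtain ⟨e, he, _⟩ := hlk
      omega

/-- The state of the search. -/
structure BInv (I : Inst) (V : Finset ℕ) (Src : ℕ → Prop) (s : State) : Prop
    extends QInv I V Src s where
  qh : s.reg 16 ≤ s.reg 17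
  minj : ∀ v ∈ V, ∀ v' ∈ V, s.arr 17 v = s.arr 17 v' → s.arr 17 v ≠ 0 → v = v'
  mlt : ∀ v ∈ V, ∀ u, s.arr 17 v = u + 1 → u < I.n
  proc : ∀ i < s.reg 16, ∀ u, s.arr 17 (s.arr 19 i) = u + 1 →
    (s.arr 16 u = 1 ∧ s.reg 20 ≠ 0) ∨ (s.arr 16 u ≠ 1 ∧ s.arr 21 u = 1 ∧ s.arr 18 u ≠ 0 ∧
      ∀ w, (w, u) ∈ I.G.arcs → s.arr 18 w ≠ 0)
  lft : ∀ u < I.n, s.arr 21 u ≠ 0 → ∃ i < s.reg 16, s.arr 17 (s.arr 19 i) = u + 1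
  fnd : s.reg 20 ≠ 0 → ∃ i < s.reg 17, ∃ u, s.reg 20 = s.arr 19 i + 1 ∧
    s.arr 17 (s.arr 19 i) = u + 1 ∧ s.arr 16 u = 1

/-- The potential that pays for the rest of the search. -/
def bfsPot (I : Inst) (s : State) : ℕ :=
  30 * (I.n - s.reg 16) +
    10 * ∑ u ∈ Finset.range I.n, if s.arr 21 u = 0 then (I.L u).length else 0

theorem bfsPot_le (I : Inst) (s : State) : bfsPot I s ≤ 30 * I.n + 10 * I.m := by
  unfold bfsPot
  have : (∑ u ∈ Finset.range I.n, if s.arr 21 u = 0 then (I.L u).length else 0) ≤ I.m := by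
    refine le_trans (Finset.sum_le_sum fun u _ => ?_) I.sum_L
    split_ifs <;> omega
  omega

/-- The queue contains incoming halves, and each of them leads to its partner `u`. If `u` is a sink,
an augmenting walk is recorded; otherwise `u` is expanded through `u` itself and the tails of its
incoming arcs. The potential `bfsPot` pays a constant per queue item and the length of the list for
each vertex not yet expanded, which makes the search linear. -/
theorem exec_bfs (hs : Stat I s) (h : BInv I V Src s) :
    Exec bfs s fun t s' => t ≤ 30 * I.n + 10 * I.m + 1 ∧ BInv I V Src s' ∧
      s'.reg 16 = s'.reg 17 ∧ Ext s s' := by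
  unfold bfs
  refine (exec_loop (k := bfsPot I s) (fun k s₁ => k = bfsPot I s₁ ∧ BInv I V Src s₁ ∧ Ext s s₁) ?_
    ⟨rfl, h, Ext.refl' s⟩).mono ?_
  · rintro k s₁ ⟨rfl, hB, hext⟩ hb hf
    have hs₁ : Stat I s₁ := hs.frame hf rfl
    simp only [holds_lt] at hb
    have hqn := hB.le
    set w := s₁.arr 19 (s₁.reg 16) with hw
    have hwV : w ∈ V := hB.mem _ hb
    simp only [exec_seq, exec_load, exec_succ, exec_cond, exec_skip, exec_sub, exec_store,
      exec_copy, holds_eq, State.reg_setReg, State.arr_setReg, State.reg_setArr, if_true,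
      Nat.reduceEqDiff, if_false, hs₁.r6, hs₁.r7, ← hw]
    refine ⟨fun h0 => ?_, fun h0 => ⟨fun hsk => ?_, fun hsk => ?_⟩⟩
    · generalize hS : State.setReg _ 22 _ = s₂
      have r16 : s₂.reg 16 = s₁.reg 16 + 1 := by rw [← hS]; simp
      have r17 : s₂.reg 17 = s₁.reg 17 := by rw [← hS]; simp
      have r20 : s₂.reg 20 = s₁.reg 20 := by rw [← hS]; simp
      have ea : s₂.arr = s₁.arr := by rw [← hS]; simp
      refine ⟨bfsPot I s₂, ⟨rfl, ⟨hB.toQInv.congr r17 (by rw [ea]) (by rw [ea]) (by rw [ea])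
        (by rw [ea]), ?_, ?_, ?_, ?_, ?_, ?_⟩, hext.trans' (Ext.of_eq r17 (by rw [ea])
        (by rw [ea]) (by rw [ea]))⟩, ?_⟩
      · omega
      · rw [ea]; exact hB.minj
      · rw [ea]; exact hB.mlt
      · intro i hi u hu
        rw [ea] at hu ⊢
        rw [r20]
        rcases Nat.lt_succ_iff_lt_or_eq.1 (r16 ▸ hi) with hi | rfl
        · exact hB.proc i hi u hu
        · rw [← hw] at hu; omega
      · intro u hu hl
        rw [ea] at hl ⊢
        obtain ⟨i, hi, he⟩ := hB.lft u hu hl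
        exact ⟨i, by omega, he⟩
      · rw [ea, r20, r17]; exact hB.fnd
      · unfold bfsPot
        rw [ea, r16]
        omega
    · obtain ⟨u, hu⟩ := Nat.exists_eq_succ_of_ne_zero h0
      rw [hu] at hsk
      simp only [Nat.succ_eq_add_one, Nat.add_sub_cancel] at hsk
      generalize hS : State.setReg _ 20 _ = s₂
      have r16 : s₂.reg 16 = s₁.reg 16 + 1 := by rw [← hS]; simp
      have r17 : s₂.reg 17 = s₁.reg 17 := by rw [← hS]; simp
      have r20 : s₂.reg 20 = w + 1 := by rw [← hS]; simp
      have ea : s₂.arr = s₁.arr := by rw [← hS]; simp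
      refine ⟨bfsPot I s₂, ⟨rfl, ⟨hB.toQInv.congr r17 (by rw [ea]) (by rw [ea]) (by rw [ea])
        (by rw [ea]), ?_, ?_, ?_, ?_, ?_, ?_⟩, hext.trans' (Ext.of_eq r17 (by rw [ea])
        (by rw [ea]) (by rw [ea]))⟩, ?_⟩
      · omega
      · rw [ea]; exact hB.minj
      · rw [ea]; exact hB.mlt
      · intro i hi u' hu'
        rw [ea] at hu' ⊢
        rcases Nat.lt_succ_iff_lt_or_eq.1 (r16 ▸ hi) with hi | rfl
        · exact (hB.proc i hi u' hu').imp (fun h => ⟨h.1, by omega⟩) id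
        · rw [← hw] at hu'
          have : u' = u := by omega
          subst this
          exact Or.inl ⟨hsk, by omega⟩
      · intro u hu hl
        rw [ea] at hl ⊢
        obtain ⟨i, hi, he⟩ := hB.lft u hu hl
        exact ⟨i, by omega, he⟩
      · intro _
        rw [ea, r20, r17]
        exact ⟨_, hb, u, rfl, hu, hsk⟩
      · unfold bfsPot
        rw [ea, r16]
        omega
    · obtain ⟨u, hu⟩ := Nat.exists_eq_succ_of_ne_zero h0
      rw [hu] at hsk ⊢
      simp only [Nat.succ_eq_add_one, Nat.add_sub_cancel] at hsk ⊢
      have hun : u < I.n := hB.mlt w hwV u hu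
      -- Each `u` is expanded only once: the matching is injective and no vertex is queued twice, so
      -- no earlier queue item has the partner `u`.
      have hl0 : s₁.arr 21 u = 0 := by
        by_contra hne
        obtain ⟨i, hi, he⟩ := hB.lft u hun hne
        have hiq : i < s₁.reg 17 := by omega
        have := hB.minj _ (hB.mem i hiq) w hwV (by rw [he, hu]) (by omega)
        have := hB.inj i hiq _ hb this
        omega
      generalize hS : State.setReg _ 21 _ = s₂
      have hs₂ : Stat I s₂ := by
        rw [← hS]
        exact (((((((hs₁.setReg rfl).setReg rfl).setReg rfl).setReg rfl).setReg rfl).setArr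
          rfl).setReg rfl).setReg rfl
      have r16 : s₂.reg 16 = s₁.reg 16 + 1 := by rw [← hS]; simp
      have r17 : s₂.reg 17 = s₁.reg 17 := by rw [← hS]; simp
      have r18 : s₂.reg 18 = w + 1 := by rw [← hS]; simp
      have r20 : s₂.reg 20 = s₁.reg 20 := by rw [← hS]; simp
      have r21 : s₂.reg 21 = u := by rw [← hS]; simp
      have r22 : s₂.reg 22 = u := by rw [← hS]; simp
      have a21 : s₂.arr 21 = Function.update (s₁.arr 21) u 1 := by rw [← hS]; simp
      have ea : ∀ a, a ≠ 21 → s₂.arr a = s₁.arr a := by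
        intro a ha
        rw [← hS]; simp [ha]
      have e12 : Ext s₁ s₂ := Ext.of_eq r17 (ea _ (by decide)) (ea _ (by decide))
        (ea _ (by decide))
      have hq2 : QInv I V Src s₂ := hB.toQInv.congr r17 (ea _ (by decide)) (ea _ (by decide))
        (ea _ (by decide)) (ea _ (by decide))
      have hjust : ∀ v, (u = v ∨ (v, u) ∈ I.G.arcs) →
          Justified I Src s₂ (s₂.reg 17) (s₂.reg 18) v := by
        intro v hv
        refine Or.inr ⟨s₁.reg 16, by omega, u, ?_, ?_, hv⟩
        · rw [r18, ea 19 (by decide)]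
        · rw [ea 19 (by decide), ea 17 (by decide), ← hw, hu]
      refine (exec_visit hs₂ hq2 (r21 ▸ hun) (r21 ▸ hjust u (Or.inl rfl))).frame.mono ?_
      rintro t₂ s₃ ⟨⟨ht₂, hq3, e23, hv3⟩, hf3⟩
      rw [r21] at hv3
      have hs₃ : Stat I s₃ := hs₂.frame hf3 rfl
      generalize hS4 : State.setReg s₃ 19 _ = s₄
      have hs₄ : Stat I s₄ := by rw [← hS4]; exact hs₃.setReg rfl
      have e34 : Ext s₃ s₄ := by rw [← hS4]; exact Ext.of_eq (by simp) rfl rfl rfl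
      have hq4 : QInv I V Src s₄ := by rw [← hS4]; exact hq3.congr (by simp) rfl rfl rfl rfl
      have r19 : s₄.reg 19 = I.hd u := by
        rw [← hS4]; simp [hf3.reg 22 rfl, r22, hs₃.a6]
      have r18' : s₄.reg 18 = s₂.reg 18 := by rw [← hS4]; simp [hf3.reg 18 rfl]
      have e24 := e23.trans' e34
      refine (exec_scan (I.L u) hs₄ hq4 (r19 ▸ I.linked u hun)
        (fun v hv => I.fst_lt ((I.mem_L u hun v).1 hv)) (fun v hv => ?_)).frame.mono ?_
      · rw [r18']
        exact e24.justified le_rfl e24.qt (hjust v (Or.inr ((I.mem_L u hun v).1 hv)))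
      rintro t₅ s₅ ⟨⟨ht₅, hq5, e45, hv5⟩, hf5⟩
      have e25 := e24.trans' e45
      have e15 := e12.trans' e25
      have r16' : s₅.reg 16 = s₁.reg 16 + 1 := by
        rw [hf5.reg 16 rfl, ← hS4, ← r16]; simp [hf3.reg 16 rfl]
      have r20' : s₅.reg 20 = s₁.reg 20 := by
        rw [hf5.reg 20 rfl, ← hS4, ← r20]; simp [hf3.reg 20 rfl]
      have a16 : s₅.arr 16 = s₁.arr 16 := by
        rw [hf5.arr 16 rfl, ← hS4, State.arr_setReg, hf3.arr 16 rfl, ea 16 (by decide)]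
      have a21' : s₅.arr 21 = Function.update (s₁.arr 21) u 1 := by
        rw [hf5.arr 21 rfl, ← hS4, State.arr_setReg, hf3.arr 21 rfl, a21]
      have hqt := e15.qt
      have hq5' : ∀ i < s₁.reg 17, s₅.arr 19 i = s₁.arr 19 i := e15.queue
      refine ⟨bfsPot I s₅, ⟨rfl, ⟨hq5, ?_, ?_, ?_, ?_, ?_, ?_⟩, hext.trans' e15⟩, ?_⟩
      · omega
      · rw [e15.mate]; exact hB.minj
      · rw [e15.mate]; exact hB.mlt
      · intro i hi u' hu'
        rw [hq5' i (by omega), e15.mate] at hu'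
        rw [a16, r20', a21']
        rcases Nat.lt_succ_iff_lt_or_eq.1 (r16' ▸ hi) with hi | rfl
        · refine (hB.proc i hi u' hu').imp id fun ⟨p1, p2, p3, p4⟩ => ⟨p1, ?_, e15.vis_ne p3,
            fun w hw => e15.vis_ne (p4 w hw)⟩
          rw [Function.update_apply]
          split_ifs
          · rfl
          · exact p2
        · rw [← hw] at hu'
          have : u' = u := by omega
          subst this
          refine Or.inr ⟨hsk, by simp, (e34.trans' e45).vis_ne hv3, fun v hv => hv5 v ?_⟩
          exact (I.mem_L _ hun v).2 hv
      · intro u' hu' hl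
        rw [a21', Function.update_apply] at hl
        rw [e15.mate]
        split_ifs at hl with he
        · exact ⟨s₁.reg 16, by omega, by rw [hq5' _ hb, ← hw, hu, he]⟩
        · obtain ⟨i, hi, he⟩ := hB.lft u' hu' hl
          exact ⟨i, by omega, by rw [hq5' i (by omega), he]⟩
      · intro hne
        rw [r20'] at hne
        obtain ⟨i, hi, u', h1, h2, h3⟩ := hB.fnd hne
        refine ⟨i, by omega, u', ?_, ?_, ?_⟩
        · rw [r20', hq5' i hi, h1]
        · rw [hq5' i hi, e15.mate, h2]
        · rw [a16, h3]
      -- Marking `u` as expanded releases the potential that pays for scanning its list.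
      · have hsum : (∑ v ∈ Finset.range I.n, if s₁.arr 21 v = 0 then (I.L v).length else 0) =
            (∑ v ∈ Finset.range I.n, if s₅.arr 21 v = 0 then (I.L v).length else 0) +
              (I.L u).length := by
          rw [← Finset.add_sum_erase _ _ (Finset.mem_range.2 hun),
            ← Finset.add_sum_erase (Finset.range I.n)
              (fun v => if s₅.arr 21 v = 0 then (I.L v).length else 0) (Finset.mem_range.2 hun)]
          have : ∀ v ∈ (Finset.range I.n).erase u,
              (if s₁.arr 21 v = 0 then (I.L v).length else 0) =
                (if s₅.arr 21 v = 0 then (I.L v).length else 0) := by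
            intro v hv
            rw [a21', Function.update_of_ne (Finset.ne_of_mem_erase hv)]
          rw [Finset.sum_congr rfl this, a21']
          simp [hl0]
          omega
        unfold bfsPot
        rw [hsum, r16']
        omega
  · rintro t s' ⟨k', ⟨rfl, hB, hext⟩, hb, ht⟩
    have := bfsPot_le I s
    have h1 := hB.qh
    simp only [holds_lt] at hb
    exact ⟨by omega, hB, by omega, hext⟩

end

end RAM

/-- `w` is an in-neighbour of `u`. -/
def FinDigraph.back {α : Type*} (G : FinDigraph α) (u w : α) : Prop := (w, u) ∈ G.arcs

namespace RAM

/-! ### Maximum flows -/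

/-- Initialize the arrays of visited and of expanded vertices. -/
def clearVisited : Prog := .forLt 12 0 (.load 13 14 12;; .store 18 12 13;; .store 21 12 6)

/-- Empty the queue. -/
def clearQueue : Prog := .const 16 0;; .const 17 0;; .const 18 0;; .const 20 0

/-- Visit all sources. -/
def visitSources : Prog :=
  .forLt 12 0 (.load 13 15 12;; .cond (.eq 13 7) (.copy 21 12;; visit) .skip)

/-- Search for an augmenting walk. -/
def search : Prog := clearVisited;; clearQueue;; visitSources;; bfs

/-- Augment the flow along the walk that ends in the vertex in register `20` (minus one). -/
def augment : Prog :=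
  .sub 24 20 7;; .load 13 20 24;;
    .loop (.ne 13 6) (.sub 13 13 7;; .load 14 17 13;; .store 17 24 14;; .copy 24 13;;
      .load 13 20 24);;
    .store 17 24 6

/-- Augment at most `c` times, and search for another augmenting walk. -/
def maxFlow : Prog := .forLt 23 3 (search;; .cond (.ne 20 6) augment .skip);; search

section

variable {I : Inst} {V : Finset ℕ} {s : State}

theorem exec_clearVisited (hs : Stat I s) :
    Exec clearVisited s fun t s' => t ≤ 5 * I.n + 2 ∧
      ∀ v < I.n, s'.arr 18 v = s.arr 14 v ∧ s'.arr 21 v = 0 := by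
  refine (exec_forLt (T := 3) (fun k s₁ => ∀ v < k, s₁.arr 18 v = s.arr 14 v ∧ s₁.arr 21 v = 0)
    hs.r0 rfl rfl (by decide) (by simp) ?_).mono ?_
  · intro k s₁ _ hJ hk hf
    have hs₁ : Stat I s₁ := hs.frame hf rfl
    have a14 := hf.arr 14 rfl
    simp only [exec_seq, exec_load, exec_store]
    refine ⟨by norm_num, fun v hv => ?_⟩
    rcases Nat.lt_succ_iff_lt_or_eq.1 hv with hv' | rfl
    · have := hJ v hv'
      have hne : v ≠ k := by omega
      simp [hk, hne, this]
    · simp [hk, hs₁.r6, a14]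
  · rintro t s' ⟨ht, hJ, _⟩
    exact ⟨by omega, hJ⟩

theorem exec_clearQueue {Q : ℕ → State → Prop} : Exec clearQueue s Q ↔
    Q 4 ((((s.setReg 16 0).setReg 17 0).setReg 18 0).setReg 20 0) := by
  simp [clearQueue]

theorem exec_search (hs : Stat I s) (hV : V ⊆ Finset.range I.n)
    (hd : ∀ v < I.n, s.arr 14 v = 0 ↔ v ∈ V) (hd1 : ∀ v < I.n, s.arr 14 v ≠ 1)
    (minj : ∀ v ∈ V, ∀ v' ∈ V, s.arr 17 v = s.arr 17 v' → s.arr 17 v ≠ 0 → v = v')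
    (mlt : ∀ v ∈ V, ∀ u, s.arr 17 v = u + 1 → u < I.n) :
    Exec search s fun t s' => t ≤ 50 * (I.n + I.m + 1) ∧
      BInv I V (fun v => s.arr 15 v = 1) s' ∧ s'.reg 16 = s'.reg 17 ∧
      (∀ v ∈ V, s.arr 15 v = 1 → s'.arr 18 v = 1) ∧
      ∀ v ∈ V, s'.arr 18 v ≠ 0 → s'.arr 18 v = 1 := by
  unfold search
  refine (exec_clearVisited hs).seq fun t₁ s₁ ⟨ht₁, hvis⟩ hf₁ => ?_
  have hs₁ : Stat I s₁ := hs.frame hf₁ rfl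
  rw [exec_seq, exec_clearQueue]
  generalize hS : State.setReg _ 20 0 = s₂
  have hs₂ : Stat I s₂ := by
    rw [← hS]
    exact (((hs₁.setReg rfl).setReg rfl).setReg rfl).setReg rfl
  have r16 : s₂.reg 16 = 0 := by rw [← hS]; simp
  have r17 : s₂.reg 17 = 0 := by rw [← hS]; simp
  have r18 : s₂.reg 18 = 0 := by rw [← hS]; simp
  have r20 : s₂.reg 20 = 0 := by rw [← hS]; simp
  have ea : s₂.arr = s₁.arr := by rw [← hS]; simp
  have hvis2 : ∀ v < I.n, s₂.arr 18 v = s.arr 14 v := by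
    rw [ea]; exact fun v hv => (hvis v hv).1
  have hQ : QInv I V (fun v => s.arr 15 v = 1) s₂ := by
    refine ⟨hV, fun v hv h0 => ?_, ?_, ?_, fun v hv h1 => ?_, ?_, ?_⟩
    · exact (hd v hv).1 (hvis2 v hv ▸ h0)
    · simp [r17]
    · simp [r17]
    · exact absurd (hvis2 v hv ▸ h1) (hd1 v hv)
    · simp [r17]
    · simp [r17]
  have a15 : s₂.arr 15 = s.arr 15 := by rw [ea, hf₁.arr 15 rfl]
  have a17 : s₂.arr 17 = s.arr 17 := by rw [ea, hf₁.arr 17 rfl]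
  refine Exec.seq (exec_forLt (T := 9) (s := s₂) (N := I.n)
    (fun k s₃ => QInv I V (fun v => s.arr 15 v = 1) s₃ ∧ Ext s₂ s₃ ∧
      ∀ v < k, s.arr 15 v = 1 → s₃.arr 18 v ≠ 0) hs₂.r0 rfl rfl (by decide)
    ⟨hQ.congr (by simp) rfl rfl rfl rfl, Ext.of_eq (by simp) rfl rfl rfl, by simp⟩ ?_) ?_
  · rintro k s₃ hk ⟨hQ3, e23, hv3⟩ hi hf₃
    have hs₃ : Stat I s₃ := hs₂.frame hf₃ rfl
    have a15' : s₃.arr 15 = s.arr 15 := by rw [hf₃.arr 15 rfl, a15]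
    simp only [exec_seq, exec_load, exec_cond, exec_copy, exec_skip, holds_eq, State.reg_setReg,
      Nat.reduceEqDiff, if_true, if_false, hs₃.r7, a15', hi]
    refine ⟨fun h1 => ?_, fun h1 => ?_⟩
    · generalize hS4 : State.setReg _ 21 k = s₄
      have hs₄ : Stat I s₄ := by rw [← hS4]; exact (hs₃.setReg rfl).setReg rfl
      have e34 : Ext s₃ s₄ := by rw [← hS4]; exact Ext.of_eq (by simp) rfl rfl rfl
      have hQ4 : QInv I V (fun v => s.arr 15 v = 1) s₄ := by
        rw [← hS4]; exact hQ3.congr (by simp) rfl rfl rfl rfl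
      have r21 : s₄.reg 21 = k := by rw [← hS4]; simp
      have r18' : s₄.reg 18 = 0 := by rw [← hS4]; simp [hf₃.reg 18 rfl, r18]
      refine (exec_visit hs₄ hQ4 (r21 ▸ hk) (Or.inl ⟨r18', r21 ▸ h1⟩)).mono ?_
      rintro t s₅ ⟨ht, hQ5, e45, hv5⟩
      rw [r21] at hv5
      have e35 := e34.trans' e45
      refine ⟨by omega, hQ5.congr (by simp) rfl rfl rfl rfl,
        (e23.trans' e35).trans' (Ext.of_eq (by simp) rfl rfl rfl), fun v hv h => ?_⟩
      rcases Nat.lt_succ_iff_lt_or_eq.1 hv with hv | rfl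
      · exact e35.vis_ne (hv3 v hv h)
      · exact hv5
    · refine ⟨by omega, hQ3.congr (by simp) rfl rfl rfl rfl,
        e23.trans' (Ext.of_eq (by simp) rfl rfl rfl), fun v hv h => ?_⟩
      rcases Nat.lt_succ_iff_lt_or_eq.1 hv with hv | rfl
      · exact hv3 v hv h
      · exact absurd h h1
  · rintro t₃ s₃ ⟨ht₃, ⟨hQ3, e23, hv3⟩, _⟩ hf₃
    have hs₃ : Stat I s₃ := hs₂.frame hf₃ rfl
    have a21 : s₃.arr 21 = s₁.arr 21 := by rw [hf₃.arr 21 rfl, ea]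
    have hB : BInv I V (fun v => s.arr 15 v = 1) s₃ := by
      have r16' : s₃.reg 16 = 0 := by rw [hf₃.reg 16 rfl, r16]
      refine ⟨hQ3, by omega, ?_, ?_, ?_, ?_, ?_⟩
      · rw [e23.mate, a17]; exact minj
      · rw [e23.mate, a17]; exact mlt
      · rw [r16']; intro i hi; omega
      · intro u hu hne
        rw [a21] at hne
        exact absurd (hvis u hu).2 hne
      · rw [hf₃.reg 20 rfl, r20]; intro h; exact absurd rfl h
    refine (exec_bfs hs₃ hB).mono ?_
    rintro t₄ s₄ ⟨ht₄, hB4, hq4, e34⟩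
    have hone : ∀ v ∈ V, s₄.arr 18 v ≠ 0 → s₄.arr 18 v = 1 := by
      intro v hv hne
      have hvn := Finset.mem_range.1 (hV hv)
      have h0 : s₂.arr 18 v = 0 := by rw [hvis2 v hvn]; exact (hd v hvn).2 hv
      have := (e23.trans' e34).vis v
      omega
    refine ⟨by omega, hB4, hq4, fun v hv h => hone v hv ?_, hone⟩
    exact e34.vis_ne (hv3 v (Finset.mem_range.1 (hV hv)) h)

/-! The flow in memory. -/

/-- Decode a vertex or `none`. -/
def decode : ℕ → Option ℕ
  | 0 => none
  | u + 1 => some u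

theorem decode_eq_some {k u : ℕ} : decode k = some u ↔ k = u + 1 := by
  cases k <;> simp [decode]

/-- The flow in array `17`. -/
def mateOf (s : State) : ℕ → Option ℕ := fun v => decode (s.arr 17 v)

/-- The state holds a flow problem and a flow. -/
structure FlowState (I : Inst) (V Src Snk : Finset ℕ) (s : State) : Prop where
  sub : V ⊆ Finset.range I.n
  dead : ∀ v < I.n, s.arr 14 v = 0 ↔ v ∈ V
  dead_ne : ∀ v < I.n, s.arr 14 v ≠ 1
  src : ∀ v ∈ V, s.arr 15 v = 1 ↔ v ∈ Src
  src_sub : Src ⊆ V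
  snk : ∀ v ∈ V, s.arr 16 v = 1 ↔ v ∈ Snk
  flow : IsFlow I.G.back V V Src Snk (mateOf s)

variable {Src Snk : Finset ℕ}

theorem FlowState.congr {s' : State} (h : FlowState I V Src Snk s) (a14 : s'.arr 14 = s.arr 14)
    (a15 : s'.arr 15 = s.arr 15) (a16 : s'.arr 16 = s.arr 16) (a17 : s'.arr 17 = s.arr 17) :
    FlowState I V Src Snk s' := by
  obtain ⟨h1, h2, h3, h4, h5, h6, h7⟩ := h
  have : mateOf s' = mateOf s := by unfold mateOf; rw [a17]
  exact ⟨h1, a14 ▸ h2, a14 ▸ h3, a15 ▸ h4, h5, a16 ▸ h6, this ▸ h7⟩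

/-- The search is finished. -/
structure Searched (I : Inst) (V Src Snk : Finset ℕ) (s : State) : Prop
    extends FlowState I V Src Snk s where
  inv : BInv I V (fun v => s.arr 15 v = 1) s
  queue_end : s.reg 16 = s.reg 17
  vis_src : ∀ v ∈ V, s.arr 15 v = 1 → s.arr 18 v = 1
  vis_one : ∀ v ∈ V, s.arr 18 v ≠ 0 → s.arr 18 v = 1

theorem FlowState.exec_search (hs : Stat I s) (h : FlowState I V Src Snk s) :
    Exec search s fun t s' => t ≤ 50 * (I.n + I.m + 1) ∧ Searched I V Src Snk s' ∧
      mateOf s' = mateOf s := by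
  have hm : ∀ v u, s.arr 17 v = u + 1 → mateOf s v = some u := fun v u h => decode_eq_some.2 h
  refine (RAM.exec_search hs h.sub h.dead h.dead_ne ?_ ?_).frame.mono ?_
  · intro v hv v' hv' he h0
    obtain ⟨u, hu⟩ := Nat.exists_eq_succ_of_ne_zero h0
    exact h.flow.inj v hv v' hv' u (hm v u hu) (hm v' u (he ▸ hu))
  · intro v hv u hu
    exact Finset.mem_range.1 (h.sub (h.flow.mem v hv u (hm v u hu)))
  · rintro t s' ⟨⟨ht, hB, hq, h1, h2⟩, hf⟩
    have a15 := hf.arr 15 rfl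
    refine ⟨ht, ⟨h.congr (hf.arr 14 rfl) a15 (hf.arr 16 rfl) (hf.arr 17 rfl), ?_, hq, ?_, h2⟩, ?_⟩
    · rw [a15]; exact hB
    · rw [a15]; exact h1
    · unfold mateOf; rw [hf.arr 17 rfl]

/-- The visited vertices. -/
def visited (V : Finset ℕ) (s : State) : Finset ℕ := V.filter fun v => s.arr 18 v = 1

/-- When the queue is exhausted without success, every visited vertex has been processed, so the
visited set is closed. The expanded vertices are precisely the partners of visited ones; hence the
cut can be read off as "visited but not expanded". -/
theorem Searched.isClosedSet (h : Searched I V Src Snk s) (h0 : s.reg 20 = 0) :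
    IsClosedSet I.G.back V Src Snk (mateOf s) (visited V s) ∧
      ∀ v < I.n, (s.arr 18 v = 1 ∧ s.arr 21 v = 0) ↔
        v ∈ visited V s \ matched (visited V s) (mateOf s) := by
  have key : ∀ w ∈ visited V s, ∀ u, mateOf s w = some u → (s.arr 16 u ≠ 1 ∧ s.arr 21 u = 1 ∧
      s.arr 18 u ≠ 0 ∧ ∀ w, (w, u) ∈ I.G.arcs → s.arr 18 w ≠ 0) := by
    intro w hw u hu
    obtain ⟨hwV, hw1⟩ := Finset.mem_filter.1 hw
    obtain ⟨i, hi, rfl⟩ := h.inv.ex w (Finset.mem_range.1 (h.sub hwV)) hw1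
    rcases h.inv.proc i (by rw [h.queue_end]; exact hi) u (decode_eq_some.1 hu) with h1 | h1
    · exact absurd h0 h1.2
    · exact h1
  have hmem : ∀ w ∈ visited V s, ∀ u, mateOf s w = some u → u ∈ V := fun w hw u hu =>
    h.flow.mem w (Finset.mem_filter.1 hw).1 u hu
  refine ⟨⟨Finset.filter_subset _ _, fun v hv => ?_, fun w hw u hu => ?_,
    fun w hw u hu v hv huv => ?_, fun w hw u hu hs => ?_⟩, fun v hv => ?_⟩
  · have hvV := h.src_sub hv
    exact Finset.mem_filter.2 ⟨hvV, h.vis_src v hvV ((h.src v hvV).2 hv)⟩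
  · exact Finset.mem_filter.2 ⟨hmem w hw u hu, h.vis_one u (hmem w hw u hu) (key w hw u hu).2.2.1⟩
  · exact Finset.mem_filter.2 ⟨hv, h.vis_one v hv ((key w hw u hu).2.2.2 v huv)⟩
  · exact (key w hw u hu).1 ((h.snk u (hmem w hw u hu)).2 hs)
  · rw [Finset.mem_sdiff, mem_matched]
    constructor
    · rintro ⟨h1, h2⟩
      obtain ⟨i, hi, rfl⟩ := h.inv.ex v hv h1
      refine ⟨Finset.mem_filter.2 ⟨h.inv.mem i hi, h1⟩, ?_⟩
      rintro ⟨w, hw, hwu⟩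
      have := (key w hw _ hwu).2.1
      omega
    · rintro ⟨h1, h2⟩
      refine ⟨(Finset.mem_filter.1 h1).2, ?_⟩
      by_contra hne
      obtain ⟨i, hi, he⟩ := h.inv.lft v hv hne
      rw [h.queue_end] at hi
      exact h2 ⟨_, Finset.mem_filter.2 ⟨h.inv.mem i hi, h.inv.vis i hi⟩, decode_eq_some.2 he⟩

/-- A parent precedes its child in the queue, so following parents ends at a source. -/
theorem Searched.altReach (h : Searched I V Src Snk s) : ∀ i < s.reg 17,
    ∃ k, AltReach I.G.back V Src (mateOf s) k (s.arr 19 i) := by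
  intro i
  induction i using Nat.strong_induction_on with
  | _ i ih =>
    intro hi
    have hiV := h.inv.mem i hi
    rcases h.inv.par i hi with ⟨_, h1⟩ | ⟨j, hj, u, _, h1, h2⟩
    · exact ⟨0, (h.src _ hiV).1 h1⟩
    · obtain ⟨k, hk⟩ := ih j hj (by omega)
      exact ⟨k + 1, hiV, _, hk, u, decode_eq_some.2 h1, h2⟩

theorem Searched.altReach_of_visited (h : Searched I V Src Snk s) :
    ∀ v ∈ visited V s, ∃ k, AltReach I.G.back V Src (mateOf s) k v := by
  intro v hv
  obtain ⟨hvV, hv1⟩ := Finset.mem_filter.1 hv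
  obtain ⟨i, hi, rfl⟩ := h.inv.ex v (Finset.mem_range.1 (h.sub hvV)) hv1
  exact h.altReach i hi

theorem Searched.exists_augment (h : Searched I V Src Snk s) (h0 : s.reg 20 ≠ 0) :
    ∃ M', IsFlow I.G.back V V Src Snk M' ∧ flowValue V M' = flowValue V (mateOf s) + 1 := by
  obtain ⟨i, hi, u, _, hu, hsk⟩ := h.inv.fnd h0
  obtain ⟨k, hk⟩ := h.altReach i hi
  have huV : u ∈ V := h.flow.mem _ (h.inv.mem i hi) u (decode_eq_some.2 hu)
  exact h.flow.augment h.src_sub hk (decode_eq_some.2 hu) ((h.snk u huV).1 hsk)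

theorem mateOf_setArr (s : State) (i k : ℕ) :
    mateOf (s.setArr 17 i k) = Function.update (mateOf s) i (decode k) := by
  funext v
  simp only [mateOf, State.arr_setArr, if_true, Function.update_apply]
  split_ifs <;> rfl

/-- The program moves the hole along the parent pointers. Queue positions strictly decrease on the
way, so only entries at later positions have been overwritten when an entry is read. No
shortest-walk argument is needed here. -/
theorem Searched.exec_augment (hs : Stat I s) (h : Searched I V Src Snk s)
    (h0 : s.reg 20 ≠ 0) :
    Exec augment s fun t s' => t ≤ 6 * I.n + 4 ∧ FlowState I V Src Snk s' ∧
      flowValue V (mateOf s') = flowValue V (mateOf s) + 1 := by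
  obtain ⟨i₀, hi₀, u₀, hf₀, hu₀, hsk₀⟩ := h.inv.fnd h0
  have hu₀' : mateOf s (s.arr 19 i₀) = some u₀ := decode_eq_some.2 hu₀
  have huV : u₀ ∈ V := h.flow.mem _ (h.inv.mem i₀ hi₀) u₀ hu₀'
  obtain ⟨hM₀, hval₀⟩ := h.flow.open_hole (h.inv.mem i₀ hi₀) hu₀' ((h.snk u₀ huV).1 hsk₀)
  have hqn := h.inv.le
  unfold augment
  simp only [exec_seq, exec_sub, exec_load, exec_store]
  generalize hS : State.setReg _ 13 _ = s₁
  have hs₁ : Stat I s₁ := by rw [← hS]; exact (hs.setReg rfl).setReg rfl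
  have r24 : s₁.reg 24 = s.arr 19 i₀ := by rw [← hS]; simp [hf₀, hs.r7]
  have r13 : s₁.reg 13 = s.arr 20 (s.arr 19 i₀) := by rw [← hS]; simp [hf₀, hs.r7]
  have ea : s₁.arr = s.arr := by rw [← hS]; simp
  refine (exec_loop (k := 6 * i₀) (fun k s₂ => ∃ i < s.reg 17, k = 6 * i ∧
    s₂.reg 24 = s.arr 19 i ∧ s₂.reg 13 = s.arr 20 (s.arr 19 i) ∧
    IsFlow I.G.back V (V.erase (s.arr 19 i)) Src Snk (mateOf s₂) ∧
    flowValue (V.erase (s.arr 19 i)) (mateOf s₂) = flowValue V (mateOf s) ∧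
    ∀ j < i, s₂.arr 17 (s.arr 19 j) = s.arr 17 (s.arr 19 j)) ?_
    ⟨i₀, hi₀, rfl, r24, r13, ?_, ?_, fun j _ => by rw [ea]⟩).frame.mono ?_
  · rintro k s₂ ⟨i, hi, rfl, q24, q13, hM, hval, hag⟩ hb hf
    have hs₂ : Stat I s₂ := hs₁.frame hf rfl
    simp only [holds_ne, hs₂.r6, q13] at hb
    obtain ⟨h1, _⟩ | ⟨j, hj, u, hp, hju, he⟩ := h.inv.par i hi
    · exact absurd h1 hb
    have hjq : j < s.reg 17 := by omega
    have hju' : s₂.arr 17 (s.arr 19 j) = u + 1 := by rw [hag j hj, hju]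
    simp only [exec_sub, exec_load, exec_store, exec_copy, exec_seq, State.reg_setReg,
      State.arr_setReg, State.reg_setArr, if_true, Nat.reduceEqDiff, if_false, q13, hp, hs₂.r7,
      Nat.add_sub_cancel, hju', q24]
    generalize hS3 : State.setReg (State.setReg _ 24 _) 13 _ = s₃
    have a20 : s₂.arr 20 = s.arr 20 := by rw [hf.arr 20 rfl, ea]
    have a17 : s₃.arr 17 = Function.update (s₂.arr 17) (s.arr 19 i) (u + 1) := by
      rw [← hS3]; simp
    have hmate : mateOf s₃ = Function.update (mateOf s₂) (s.arr 19 i) (some u) := by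
      have := mateOf_setArr s₂ (s.arr 19 i) (u + 1)
      simp only [decode] at this
      rw [← this]
      unfold mateOf
      rw [a17]; simp
    have hne : s.arr 19 j ≠ s.arr 19 i := fun e => by
      have := h.inv.inj j hjq i hi e
      omega
    obtain ⟨m1, m2⟩ := hM.move_hole (h.inv.mem i hi) (h.inv.mem j hjq) hne
      (decode_eq_some.2 hju') he
    refine ⟨6 * j, ⟨j, hjq, rfl, rfl, by simp [a20], hmate ▸ m1, by rw [hmate, m2, hval], ?_⟩,
      by omega⟩
    intro j' hj'
    simp only [State.arr_setArr, if_true, State.arr_setReg]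
    rw [Function.update_of_ne, hag j' (by omega)]
    intro e
    have := h.inv.inj j' (by omega) i hi e
    omega
  · unfold mateOf; rw [ea]; exact hM₀
  · unfold mateOf; rw [ea]; exact hval₀
  · rintro t s₂ ⟨⟨k', ⟨i, hi, rfl, q24, q13, hM, hval, hag⟩, hb, ht⟩, hf⟩
    have hs₂ : Stat I s₂ := hs₁.frame hf rfl
    simp only [holds_ne, hs₂.r6, q13, not_not] at hb
    obtain ⟨_, hsrc⟩ | ⟨j, hj, u, hp, hju, he⟩ := h.inv.par i hi
    swap
    · omega
    have hiV := h.inv.mem i hi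
    obtain ⟨m1, m2⟩ := hM.close_hole hiV ((h.src _ hiV).1 hsrc)
    have hmate : mateOf (s₂.setArr 17 (s₂.reg 24) (s₂.reg 6)) =
        Function.update (mateOf s₂) (s.arr 19 i) none := by
      rw [mateOf_setArr, q24, hs₂.r6]; rfl
    have a14 : s₂.arr 14 = s.arr 14 := by rw [hf.arr 14 rfl, ea]
    have a15 : s₂.arr 15 = s.arr 15 := by rw [hf.arr 15 rfl, ea]
    have a16 : s₂.arr 16 = s.arr 16 := by rw [hf.arr 16 rfl, ea]
    refine ⟨by omega, ⟨h.sub, ?_, ?_, ?_, h.src_sub, ?_, ?_⟩, ?_⟩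
    · simp only [State.arr_setArr, Nat.reduceEqDiff, if_false, a14]; exact h.dead
    · simp only [State.arr_setArr, Nat.reduceEqDiff, if_false, a14]; exact h.dead_ne
    · simp only [State.arr_setArr, Nat.reduceEqDiff, if_false, a15]; exact h.src
    · simp only [State.arr_setArr, Nat.reduceEqDiff, if_false, a16]; exact h.snk
    · rw [hmate]; exact m1
    · rw [hmate, m2, hval]

/-- After `k` rounds the flow has value `k`, or some cut certifies that it is already maximum. If
the extra search after `c` rounds still finds an augmenting walk, the certificate is impossible and
a flow of value `c + 1` exists, so every cut exceeds `c`. -/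
theorem FlowState.exec_maxFlow (hs : Stat I s) (h : FlowState I V Src Snk s)
    (hv : flowValue V (mateOf s) = 0) :
    Exec maxFlow s fun t s' => t ≤ 70 * (I.c + 1) * (I.n + I.m + 1) ∧ Searched I V Src Snk s' ∧
      (s'.reg 20 = 0 → flowValue V (mateOf s') ≤ I.c) ∧
      (s'.reg 20 ≠ 0 → ∀ P Y, IsCut I.G.back V Src Snk P Y → I.c < Y.card) := by
  unfold maxFlow
  refine Exec.seq (exec_forLt (T := 56 * (I.n + I.m + 1) + 6) (N := I.c)
    (fun k s₁ => FlowState I V Src Snk s₁ ∧ flowValue V (mateOf s₁) ≤ k ∧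
      (flowValue V (mateOf s₁) = k ∨ ∃ P Y, IsCut I.G.back V Src Snk P Y ∧
        Y.card = flowValue V (mateOf s₁))) hs.r3 rfl rfl (by decide)
    ⟨h.congr rfl rfl rfl rfl, hv.le, Or.inl hv⟩ ?_) ?_
  · rintro k s₁ hk ⟨hF, hle, hor⟩ hi hf
    have hs₁ : Stat I s₁ := hs.frame hf rfl
    refine Exec.seq (hF.exec_search hs₁) ?_
    rintro t₂ s₂ ⟨ht₂, hS, hm⟩ hf₂
    have hs₂ : Stat I s₂ := hs₁.frame hf₂ rfl
    rw [exec_cond]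
    simp only [holds_ne, hs₂.r6]
    refine ⟨fun h1 => (hS.exec_augment hs₂ h1).mono ?_, fun h1 => ?_⟩
    · rintro t₃ s₃ ⟨ht₃, hF₃, hv₃⟩
      rw [hm] at hv₃
      have hv₃' : flowValue V (mateOf (s₃.setReg 23 (k + 1))) = flowValue V (mateOf s₁) + 1 := hv₃
      refine ⟨by omega, hF₃.congr rfl rfl rfl rfl, by omega, Or.inl ?_⟩
      rcases hor with hor | ⟨P, Y, hc, hY⟩
      · omega
      · have := (hF₃.flow.weak_duality hc).1
        omega
    · simp only [not_not] at h1
      rw [exec_skip]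
      obtain ⟨h2, h3⟩ := (hS.isClosedSet h1).1.isCut hS.flow
      refine ⟨by omega, hS.toFlowState.congr rfl rfl rfl rfl, ?_, Or.inr ⟨_, _, h2, h3⟩⟩
      change flowValue V (mateOf s₂) ≤ k + 1
      rw [hm]; omega
  · rintro t₁ s₁ ⟨ht₁, ⟨hF, hle, hor⟩, _⟩ hf
    have hs₁ : Stat I s₁ := hs.frame hf rfl
    refine (hF.exec_search hs₁).mono ?_
    rintro t₂ s₂ ⟨ht₂, hS, hm⟩
    refine ⟨?_, hS, fun _ => by rw [hm]; exact hle, fun h1 P Y hPY => ?_⟩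
    · have : I.c * (56 * (I.n + I.m + 1) + 6 + 2) ≤ I.c * (64 * (I.n + I.m + 1)) :=
        Nat.mul_le_mul_left _ (by omega)
      nlinarith [Nat.zero_le (I.c * (I.n + I.m + 1))]
    · obtain ⟨M', hM', hv'⟩ := hS.exists_augment h1
      have h2 := (hM'.weak_duality hPY).1
      rw [hm] at hv'
      rcases hor with hor | ⟨P', Y', hc, hY⟩
      · omega
      · have := (hM'.weak_duality hc).1
        omega

/-! Collecting the cut. -/

/-- If the search has failed, mark the vertices of the cut; put one of them (plus one) into
register `25`. -/
def extract : Prog :=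
  .const 25 0;; .cond (.eq 20 6)
    (.forLt 12 0 (.load 13 18 12;; .cond (.eq 13 7)
      (.load 13 21 12;; .cond (.eq 13 6) (.store 8 12 7;; .succ 25 12) .skip) .skip)) .skip

theorem exec_extract_of_ne (hs : Stat I s) (h : s.reg 20 ≠ 0) :
    Exec extract s fun t s' => t = 3 ∧ s'.reg 25 = 0 ∧ s'.arr = s.arr := by
  unfold extract
  simp only [exec_seq, exec_const, exec_cond, holds_eq, State.reg_setReg, Nat.reduceEqDiff,
    if_false, hs.r6, h, false_imp_iff, not_false_eq_true, exec_skip, true_imp_iff,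
    if_true, State.arr_setReg, and_self]

theorem exec_extract {X : Finset ℕ} (hs : Stat I s) (h : s.reg 20 = 0)
    (hX : ∀ v < I.n, (s.arr 18 v = 1 ∧ s.arr 21 v = 0) ↔ v ∈ X) (hXn : X ⊆ Finset.range I.n) :
    Exec extract s fun t s' => t ≤ 8 * I.n + 5 ∧
      (∀ v, s'.arr 8 v = if v ∈ X then 1 else s.arr 8 v) ∧
      ((s'.reg 25 = 0 ∧ X = ∅) ∨ ∃ x ∈ X, s'.reg 25 = x + 1) := by
  unfold extract
  simp only [exec_seq, exec_const, exec_cond, holds_eq, State.reg_setReg, Nat.reduceEqDiff,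
    if_false, hs.r6, h, not_true_eq_false, true_imp_iff, false_imp_iff, and_true]
  have hs₀ : Stat I (s.setReg 25 0) := hs.setReg rfl
  refine (exec_forLt (T := 6) (N := I.n) (s := s.setReg 25 0)
    (fun k s₁ => (∀ v, s₁.arr 8 v = if v ∈ X ∧ v < k then 1 else s.arr 8 v) ∧
      ((s₁.reg 25 = 0 ∧ ∀ v ∈ X, k ≤ v) ∨ ∃ x ∈ X, s₁.reg 25 = x + 1)) hs₀.r0 rfl rfl (by decide)
    ⟨by simp, by simp⟩ ?_).mono ?_
  · rintro k s₁ hk ⟨h1, h2⟩ hi hf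
    have hs₁ : Stat I s₁ := hs₀.frame hf rfl
    have a18 : s₁.arr 18 = s.arr 18 := hf.arr 18 rfl
    have a21 : s₁.arr 21 = s.arr 21 := hf.arr 21 rfl
    have keep : k ∉ X → (∀ v, s₁.arr 8 v = if v ∈ X ∧ v < k + 1 then 1 else s.arr 8 v) ∧
        ((s₁.reg 25 = 0 ∧ ∀ v ∈ X, k + 1 ≤ v) ∨ ∃ x ∈ X, s₁.reg 25 = x + 1) := by
      intro hkX
      have hne : ∀ v ∈ X, v ≠ k := fun v hv e => hkX (e ▸ hv)
      refine ⟨fun v => ?_, h2.imp (fun h => ⟨h.1, fun v hv => ?_⟩) id⟩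
      · rw [h1 v]
        refine if_congr (and_congr_right fun hv => ?_) rfl rfl
        have := hne v hv
        omega
      · have := hne v hv
        have := h.2 v hv
        omega
    simp only [exec_seq, exec_load, exec_cond, exec_store, exec_succ, exec_skip, holds_eq,
      State.reg_setReg, State.arr_setReg, State.reg_setArr, Nat.reduceEqDiff, if_true, if_false,
      hs₁.r6, hs₁.r7, hi, a18, a21]
    refine ⟨fun g1 => ⟨fun g2 => ?_, fun g2 => ?_⟩, fun g1 => ?_⟩
    · have hkX : k ∈ X := (hX k hk).1 ⟨g1, g2⟩
      refine ⟨by norm_num, fun v => ?_, Or.inr ⟨k, hkX, rfl⟩⟩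
      simp only [State.arr_setArr, if_true, State.arr_setReg, Function.update_apply]
      by_cases hv : v = k
      · subst hv; simp [hkX]
      · rw [if_neg hv, h1 v]
        refine if_congr (and_congr_right fun _ => ?_) rfl rfl
        omega
    · exact ⟨by norm_num, keep fun hkX => g2 ((hX k hk).2 hkX).2⟩
    · exact ⟨by norm_num, keep fun hkX => g1 ((hX k hk).2 hkX).1⟩
  · rintro t s' ⟨ht, ⟨h1, h2⟩, _⟩
    refine ⟨by omega, fun v => ?_, h2.imp (fun h => ⟨h.1, ?_⟩) id⟩
    · rw [h1 v]
      exact if_congr (and_iff_left_of_imp fun hv => Finset.mem_range.1 (hXn hv)) rfl rfl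
    · refine Finset.eq_empty_of_forall_notMem fun v hv => ?_
      have := h.2 v hv
      have := Finset.mem_range.1 (hXn hv)
      omega

end

end RAM

namespace FinDigraph

variable {α : Type*} [DecidableEq α] {G : FinDigraph α} {A B D R P X : Finset α}

/-! ### Branching nodes as flow problems -/

/-- The vertices that are neither forced into the separator nor forced to be kept. -/
def freeVerts (G : FinDigraph α) (D R : Finset α) : Finset α := G.verts \ (D ∪ R)

/-- The free vertices that are sources of a branching node. -/
def freeSources (G : FinDigraph α) (A D R : Finset α) : Finset α :=
  (G.freeVerts D R).filter fun v => v ∈ A ∨ ∃ u ∈ R, (u, v) ∈ G.arcs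

theorem mem_freeVerts {v : α} : v ∈ G.freeVerts D R ↔ v ∈ G.verts ∧ v ∉ D ∧ v ∉ R := by
  simp [freeVerts]

/-- The flow runs on reversed arcs from `B`, with `D` and `R` removed. The source side of the
reversed cut is what lies beyond the separation, and out-neighbours of `R` become flow sinks because
`R` has to stay on the side of `A`. -/
theorem IsSeparation.isCut (h : G.IsSeparation A B D R P X) :
    IsCut G.back (G.freeVerts D R) (B ∩ G.freeVerts D R) (G.freeSources A D R)
      (G.freeVerts D R \ (P ∪ X)) (X \ D) := by
  have dj : ∀ v ∈ P, v ∉ X := fun v hv => Finset.disjoint_left.1 h.disj hv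
  have hR : ∀ v ∈ R, v ∈ P := fun v hv => h.kept hv
  refine ⟨Finset.sdiff_subset, ?_, ?_, ?_, ?_, ?_⟩
  · intro v hv
    obtain ⟨h1, h2⟩ := Finset.mem_sdiff.1 hv
    exact mem_freeVerts.2 ⟨h.right_subset h1, h2, fun h3 => dj v (hR v h3) h1⟩
  · rw [Finset.disjoint_left]
    intro v hv hv'
    exact (Finset.mem_sdiff.1 hv).2 (Finset.mem_union_right _ (Finset.mem_sdiff.1 hv').1)
  · intro v hv
    obtain ⟨hB, hV⟩ := Finset.mem_inter.1 hv
    have hP : v ∉ P := fun h' => Finset.disjoint_left.1 h.snk h' hB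
    have hD := (mem_freeVerts.1 hV).2.1
    simp only [Finset.mem_union, Finset.mem_sdiff]
    tauto
  · rw [Finset.disjoint_left]
    intro v hv hv'
    refine (Finset.mem_sdiff.1 hv).2 ?_
    obtain ⟨_, h1 | ⟨u, hu, huv⟩⟩ := Finset.mem_filter.1 hv'
    · exact h.src h1
    · exact h.closed u v huv (hR u hu)
  · intro u hu w hw huw
    have hD := (mem_freeVerts.1 hw).2.1
    have hP : w ∉ P := fun h' => (Finset.mem_sdiff.1 hu).2 (h.closed w u huw h')
    simp only [Finset.mem_union, Finset.mem_sdiff]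
    tauto

theorem IsSeparation.card_sdiff (h : G.IsSeparation A B D R P X) :
    (X \ D).card + D.card = X.card := Finset.card_sdiff_add_card_eq_card h.forced

theorem isSeparation_of_isCut {C Y : Finset α} (hA : A ⊆ G.verts) (hD : D ⊆ G.verts)
    (hR : R ⊆ G.verts) (hDR : Disjoint R D) (hBR : Disjoint R B)
    (h : IsCut G.back (G.freeVerts D R) (B ∩ G.freeVerts D R) (G.freeSources A D R) C Y) :
    G.IsSeparation A B D R (G.verts \ (C ∪ (Y ∪ D))) (Y ∪ D) := by
  have hC : ∀ v ∈ C, v ∈ G.verts ∧ v ∉ D ∧ v ∉ R := fun v hv => mem_freeVerts.1 (h.left_subset hv)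
  have hY : ∀ v ∈ Y, v ∈ G.verts ∧ v ∉ D ∧ v ∉ R := fun v hv => mem_freeVerts.1 (h.right_subset hv)
  have hsnk : ∀ v ∈ C, v ∉ G.freeSources A D R := fun v hv => Finset.disjoint_left.1 h.snk hv
  refine ⟨Finset.sdiff_subset, Finset.union_subset (fun v hv => (hY v hv).1) hD, ?_, ?_,
    Finset.subset_union_right, ?_, ?_, ?_⟩
  · rw [Finset.disjoint_left]
    intro v hv hv'
    exact (Finset.mem_sdiff.1 hv).2 (Finset.mem_union_right _ hv')
  · intro u v huv hu
    obtain ⟨huG, hu⟩ := Finset.mem_sdiff.1 hu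
    by_cases hvC : v ∈ C
    · exfalso
      by_cases huR : u ∈ R
      · exact hsnk v hvC (Finset.mem_filter.2 ⟨h.left_subset hvC, Or.inr ⟨u, huR, huv⟩⟩)
      · simp only [Finset.mem_union, not_or] at hu
        have := h.closed v hvC u (mem_freeVerts.2 ⟨huG, hu.2.2, huR⟩) huv
        simp only [Finset.mem_union] at this
        tauto
    · have := G.snd_mem _ huv
      simp only [Finset.mem_union, Finset.mem_sdiff]
      tauto
  · intro v hv
    have h1 : v ∉ C := fun h' => (hC v h').2.2 hv
    have h2 : v ∉ Y := fun h' => (hY v h').2.2 hv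
    have h3 : v ∉ D := Finset.disjoint_left.1 hDR hv
    simp [h1, h2, h3, hR hv]
  · intro v hv
    have h1 : v ∉ C := fun h' =>
      hsnk v h' (Finset.mem_filter.2 ⟨h.left_subset h', Or.inl hv⟩)
    have := hA hv
    simp only [Finset.mem_union, Finset.mem_sdiff]
    tauto
  · rw [Finset.disjoint_left]
    intro v hv hvB
    obtain ⟨hvG, hv⟩ := Finset.mem_sdiff.1 hv
    simp only [Finset.mem_union, not_or] at hv
    have hvR : v ∉ R := fun h' => Finset.disjoint_left.1 hBR h' hvB
    have := h.src (Finset.mem_inter.2 ⟨hvB, mem_freeVerts.2 ⟨hvG, hv.2.2, hvR⟩⟩)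
    simp only [Finset.mem_union] at this
    tauto

/-- The cut found by the backward search is the furthest minimum cut. -/
theorem isFurthestCut_of_flow {M : α → Option α} {Q : Finset α}
    (hsep : G.IsSeparation A B D R P X)
    (hM : IsFlow G.back (G.freeVerts D R) (G.freeVerts D R) (B ∩ G.freeVerts D R)
      (G.freeSources A D R) M)
    (hQ : IsClosedSet G.back (G.freeVerts D R) (B ∩ G.freeVerts D R) (G.freeSources A D R) M Q)
    (hr : ∀ v ∈ Q, ∃ k, AltReach G.back (G.freeVerts D R) (B ∩ G.freeVerts D R) M k v) :
    G.IsFurthestCut A B D R (Q \ matched Q M) := by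
  obtain ⟨hcut, hcard⟩ := hQ.isCut hM
  have hA : A ⊆ G.verts :=
    hsep.src.trans (Finset.union_subset hsep.left_subset hsep.right_subset)
  refine ⟨?_, ⟨_, isSeparation_of_isCut hA (hsep.forced.trans hsep.right_subset)
    (hsep.kept.trans hsep.left_subset) ?_ ?_ hcut⟩, fun P' Y' h => ?_, fun P' Y' h hle => ?_⟩
  · rw [Finset.disjoint_left]
    exact fun v hv => (mem_freeVerts.1 (hcut.right_subset hv)).2.1
  · exact Finset.disjoint_of_subset_left hsep.kept
      (Finset.disjoint_of_subset_right hsep.forced hsep.disj)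
  · exact Finset.disjoint_of_subset_left hsep.kept hsep.snk
  · have h1 := (hM.weak_duality h.isCut).1
    have h2 := h.card_sdiff
    omega
  · have h2 := h.card_sdiff
    have hb := (hM.weak_duality h.isCut).2 (by omega)
    -- By complementary slackness an alternating walk from `B` cannot cross any other minimum
    -- separation. So `Q`, which consists of ends of such walks, is disjoint from `P'`.
    have key : ∀ k v, AltReach G.back (G.freeVerts D R) (B ∩ G.freeVerts D R) M k v →
        v ∈ G.freeVerts D R \ (P' ∪ Y') ∪ Y' \ D := by
      intro k
      induction k with
      | zero => exact fun v hv => h.isCut.src hv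
      | succ k ih =>
        rintro v ⟨hvV, p, hp, u, hpu, he⟩
        have hu := hb p (ih p hp) u hpu
        rcases he with rfl | he
        · exact Finset.mem_union_left _ hu
        · exact h.isCut.closed u hu v hvV he
    rw [Finset.disjoint_left]
    intro v hv hvP
    obtain ⟨k, hk⟩ := hr v (Finset.mem_sdiff.1 hv).1
    have h3 := key k v hk
    simp only [Finset.mem_union, Finset.mem_sdiff, not_or] at h3
    have := Finset.disjoint_left.1 h.disj hvP
    tauto

end FinDigraph

namespace RAM

/-! ### The search tree

Arrays: `9` parents, `10` kinds (`0` for a source, `1` for a sink, `2` for a vertex of the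
separator, `3` for a vertex to be kept), `11` vertices, `12` numbers of terminals, `13` indices of
the next terminal, `23` numbers of branchings. -/

/-- `l` lists the kinds and vertices on the path from the node `p` to the root. -/
def Path (s : State) : ℕ → List (ℕ × ℕ) → Prop
  | p, [] => p = 0
  | p, x :: l => p ≠ 0 ∧ s.arr 10 p = x.1 ∧ s.arr 11 p = x.2 ∧ Path s (s.arr 9 p) l

/-- The vertices of kind `k`. -/
def select (k : ℕ) (l : List (ℕ × ℕ)) : Finset ℕ :=
  ((l.filter fun x => x.1 = k).map Prod.snd).toFinset

theorem mem_select {k v : ℕ} {l : List (ℕ × ℕ)} : v ∈ select k l ↔ (k, v) ∈ l := by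
  simp [select]

theorem select_cons_self (k v : ℕ) (l : List (ℕ × ℕ)) :
    select k ((k, v) :: l) = insert v (select k l) := by
  ext w
  simp [mem_select]

theorem select_cons_of_ne {k k' : ℕ} (v : ℕ) (l : List (ℕ × ℕ)) (h : k ≠ k') :
    select k ((k', v) :: l) = select k l := by
  ext w
  simp [mem_select, h]

/-- Initialize the flow problem. -/
def prepare : Prog :=
  .forLt 12 0 (.store 14 12 6;; .store 15 12 6;; .store 16 12 6;; .store 22 12 6;; .succ 13 12;;
    .store 17 12 13)

/-- Read the path from the current node to the root. -/
def walk : Prog :=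
  .copy 30 10;; .loop (.ne 30 6) (.load 13 10 30;; .load 14 11 30;;
    .cond (.eq 13 6) (.store 16 14 7) .skip;;
    .cond (.eq 13 7) (.store 15 14 7) .skip;;
    .cond (.eq 13 29) (.store 14 14 29) .skip;;
    .cond (.eq 13 31) (.store 14 14 29;; .store 22 14 7) .skip;;
    .load 30 9 30)

/-- Mark the out-neighbours of the vertices to be kept. -/
def markOut : Prog :=
  .forLt 12 1 (.load 13 0 12;; .load 14 22 13;;
    .cond (.eq 14 7) (.load 14 1 12;; .store 16 14 7) .skip)

section

variable {I : Inst} {s : State}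

theorem exec_prepare (hs : Stat I s) : Exec prepare s fun t s' => t ≤ 8 * I.n + 2 ∧
    ∀ v < I.n, s'.arr 14 v = 0 ∧ s'.arr 15 v = 0 ∧ s'.arr 16 v = 0 ∧ s'.arr 22 v = 0 ∧
      s'.arr 17 v = v + 1 := by
  refine (exec_forLt (T := 6) (fun k s₁ => ∀ v < k, s₁.arr 14 v = 0 ∧ s₁.arr 15 v = 0 ∧
    s₁.arr 16 v = 0 ∧ s₁.arr 22 v = 0 ∧ s₁.arr 17 v = v + 1)
    hs.r0 rfl rfl (by decide) (by simp) ?_).mono ?_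
  · intro k s₁ _ hJ hk hf
    have hs₁ : Stat I s₁ := hs.frame hf rfl
    simp only [exec_seq, exec_succ, exec_store]
    refine ⟨by norm_num, fun v hv => ?_⟩
    rcases Nat.lt_succ_iff_lt_or_eq.1 hv with hv' | rfl
    · have := hJ v hv'
      have hne : v ≠ k := by omega
      simp [hk, hne, this]
    · simp [hk, hs₁.r6]
  · rintro t s' ⟨ht, hJ, _⟩
    exact ⟨by omega, hJ⟩

/-- The marks for the path `l`. -/
structure Marks (I : Inst) (l : List (ℕ × ℕ)) (s : State) : Prop where
  dead : ∀ v < I.n, s.arr 14 v = if (2, v) ∈ l ∨ (3, v) ∈ l then 2 else 0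
  src : ∀ v < I.n, s.arr 15 v = 1 ↔ (1, v) ∈ l
  snk : ∀ v < I.n, s.arr 16 v = 1 ↔ (0, v) ∈ l
  kept : ∀ v < I.n, s.arr 22 v = 1 ↔ (3, v) ∈ l

theorem exec_walk {l : List (ℕ × ℕ)} (hs : Stat I s) (hl : Path s (s.reg 10) l)
    (h0 : ∀ v < I.n, s.arr 14 v = 0 ∧ s.arr 15 v = 0 ∧ s.arr 16 v = 0 ∧ s.arr 22 v = 0) :
    Exec walk s fun t s' => t ≤ 13 * l.length + 2 ∧ Marks I l s' := by
  unfold walk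
  rw [exec_seq, exec_copy]
  have hs₀ : Stat I (s.setReg 30 (s.reg 10)) := hs.setReg rfl
  have hM₀ : Marks I [] (s.setReg 30 (s.reg 10)) := by
    constructor <;> intro v hv <;> simp [h0 v hv]
  refine (exec_loop (k := 13 * l.length) (s := s.setReg 30 (s.reg 10)) (fun k s₁ => ∃ l₁ l₂,
    l = l₁ ++ l₂ ∧ k = 13 * l₂.length ∧ Path s (s₁.reg 30) l₂ ∧ Marks I l₁ s₁) ?_
    ⟨[], l, rfl, rfl, by simpa using hl, hM₀⟩).frame.mono ?_
  · rintro k s₁ ⟨l₁, l₂, rfl, rfl, hp, hM⟩ hb hf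
    have hs₁ : Stat I s₁ := hs₀.frame hf rfl
    simp only [holds_ne, hs₁.r6] at hb
    cases l₂ with
    | nil => exact absurd hp hb
    | cons x l₂ =>
      obtain ⟨hne, hk, hv, hp⟩ := hp
      obtain ⟨k, v⟩ := x
      simp only at hk hv
      have a9 : s₁.arr 9 = s.arr 9 := hf.arr 9 rfl
      have a10 : s₁.arr 10 = s.arr 10 := hf.arr 10 rfl
      have a11 : s₁.arr 11 = s.arr 11 := hf.arr 11 rfl
      refine Exec.mono (Q := fun t s' => t ≤ 12 ∧ s'.reg 30 = s.arr 9 (s₁.reg 30) ∧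
        Marks I (l₁ ++ [(k, v)]) s') ?_ ?_
      · have hcases : (k = 0 ∧ True) ∨ (k = 1 ∧ True) ∨ (k = 2 ∧ True) ∨ (k = 3 ∧ True) ∨
            (k ≠ 0 ∧ k ≠ 1 ∧ k ≠ 2 ∧ k ≠ 3 ∧ 0 ≠ k ∧ 1 ≠ k ∧ 2 ≠ k ∧ 3 ≠ k) := by
          simp only [and_true]; omega
        rcases hcases with ⟨rfl, hcases⟩ | ⟨rfl, hcases⟩ | ⟨rfl, hcases⟩ | ⟨rfl, hcases⟩ | hcases
        all_goals
          simp only [exec_seq, exec_load, exec_cond, exec_store, exec_skip, holds_eq,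
            State.reg_setReg, State.arr_setReg, State.reg_setArr, Nat.reduceEqDiff, if_true,
            if_false, hs₁.r6, hs₁.r7, hs₁.r29, hs₁.r31, a10, a11, hk, hv, not_true_eq_false,
            false_imp_iff, true_imp_iff, and_true, true_and, not_false_eq_true,
            OfNat.ofNat_ne_zero, OfNat.ofNat_ne_one, zero_ne_one, one_ne_zero,
            OfNat.zero_ne_ofNat, OfNat.one_ne_ofNat, hcases]
          refine ⟨by norm_num, by simp [a9], ?_⟩
          constructor
          all_goals
            intro w hw
            have e1 := hM.dead w hw
            have e2 := hM.src w hw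
            have e3 := hM.snk w hw
            have e4 := hM.kept w hw
            by_cases hwv : w = v
            · rw [hwv] at e1 e2 e3 e4
              simp [hwv, e1, e2, e3, e4, hcases]
            · simp [hwv, e1, e2, e3, e4, hcases]
      · rintro t s₂ ⟨ht, h30, hM2⟩
        refine ⟨13 * l₂.length, ⟨l₁ ++ [(k, v)], l₂, by simp, rfl, h30 ▸ hp, hM2⟩, ?_⟩
        simp only [List.length_cons]; omega
  · rintro t s' ⟨⟨k', ⟨l₁, l₂, rfl, rfl, hp, hM⟩, hb, ht⟩, hf⟩
    have hs' : Stat I s' := hs₀.frame hf rfl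
    simp only [holds_ne, hs'.r6, not_not] at hb
    cases l₂ with
    | nil => exact ⟨by simp only [List.length_append] at *; omega, by simpa using hM⟩
    | cons x l₂ => exact absurd hb hp.1

end

end RAM

/-! ### The cut of a node, weights, and creation of nodes -/

namespace RAM

section

variable {I : Inst} {s : State} {l : List (ℕ × ℕ)}

theorem exec_markOut (hs : Stat I s) (h : Marks I l s) : Exec markOut s fun t s' =>
    t ≤ 7 * I.m + 2 ∧ ∀ v < I.n, s'.arr 16 v = 1 ↔
      (0, v) ∈ l ∨ ∃ u, (3, u) ∈ l ∧ (u, v) ∈ I.G.arcs := by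
  refine (exec_forLt (T := 5) (fun k s₁ => ∀ v < I.n, s₁.arr 16 v = 1 ↔
    (0, v) ∈ l ∨ ∃ e < k, (3, I.tl e) ∈ l ∧ I.hv e = v) hs.r1 rfl rfl (by decide) ?_ ?_).mono ?_
  · intro v hv
    simp [h.snk v hv]
  · intro k s₁ hk hJ hi hf
    have hs₁ : Stat I s₁ := hs.frame hf rfl
    have a22 : s₁.arr 22 = s.arr 22 := hf.arr 22 rfl
    have harc : (I.tl k, I.hv k) ∈ I.G.arcs := (I.arcs _ _).2 ⟨k, hk, rfl, rfl⟩
    simp only [exec_seq, exec_load, exec_cond, exec_store, exec_skip, holds_eq,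
      State.reg_setReg, State.arr_setReg, Nat.reduceEqDiff, if_true,
      if_false, hs₁.r7, hi, hs₁.a0, hs₁.a1, a22, h.kept _ (I.fst_lt harc), State.arr_setArr]
    have split : ∀ v, (∃ e < k + 1, (3, I.tl e) ∈ l ∧ I.hv e = v) ↔
        (∃ e < k, (3, I.tl e) ∈ l ∧ I.hv e = v) ∨ ((3, I.tl k) ∈ l ∧ I.hv k = v) := by
      intro v
      constructor
      · rintro ⟨e, he, h1⟩
        rcases Nat.lt_succ_iff_lt_or_eq.1 he with he | rfl
        · exact Or.inl ⟨e, he, h1⟩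
        · exact Or.inr h1
      · rintro (⟨e, he, h1⟩ | h1)
        · exact ⟨e, by omega, h1⟩
        · exact ⟨k, by omega, h1⟩
    refine ⟨fun h3 => ⟨by norm_num, fun v hv => ?_⟩, fun h3 => ⟨by norm_num, fun v hv => ?_⟩⟩
    · rw [split v, Function.update_apply, ← or_assoc, ← hJ v hv]
      by_cases hvk : v = I.hv k
      · simp [hvk, h3]
      · have : I.hv k ≠ v := fun e => hvk e.symm
        simp [hvk, this]
    · rw [split v, ← or_assoc, ← hJ v hv]
      simp [h3]
  · rintro t s' ⟨ht, hJ, _⟩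
    refine ⟨by omega, fun v hv => (hJ v hv).trans (or_congr_right ?_)⟩
    constructor
    · rintro ⟨e, he, h1, rfl⟩
      exact ⟨_, h1, (I.arcs _ _).2 ⟨e, he, rfl, rfl⟩⟩
    · rintro ⟨u, h1, h2⟩
      obtain ⟨e, he, rfl, rfl⟩ := (I.arcs _ _).1 h2
      exact ⟨e, he, h1, rfl⟩

/-- Find the furthest minimum cut of the current node, and mark it. -/
def findCut : Prog := prepare;; walk;; markOut;; maxFlow;; extract

/-- At every node at most `c` vertices get marked, which is needed for the size of the kept set.
That they form the furthest cut is claimed only if the node admits a separation of size at most `c`;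
otherwise the search may give up with no mark. The bound `5 * c` comes from `3 * c` terminals and `2
* c` branchings. -/
theorem exec_findCut (hs : Stat I s) (hl : Path s (s.reg 10) l) (hlen : l.length ≤ 5 * I.c) :
    Exec findCut s fun t s' => t ≤ 200 * (I.c + 1) * (I.n + I.m + 1) ∧
      ∃ X ⊆ I.G.verts, X.card ≤ I.c ∧ (∀ v, s'.arr 8 v = if v ∈ X then 1 else s.arr 8 v) ∧
        ((s'.reg 25 = 0 ∧ X = ∅) ∨ ∃ x ∈ X, s'.reg 25 = x + 1) ∧
        ((∃ P Y, I.G.IsSeparation (select 0 l) (select 1 l) (select 2 l) (select 3 l) P Y ∧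
          Y.card ≤ I.c) →
          I.G.IsFurthestCut (select 0 l) (select 1 l) (select 2 l) (select 3 l) X) := by
  set V := I.G.freeVerts (select 2 l) (select 3 l) with hV
  set Src := select 1 l ∩ V with hSrc
  set Snk := I.G.freeSources (select 0 l) (select 2 l) (select 3 l) with hSnk
  unfold findCut
  refine (exec_prepare hs).seq fun t₁ s₁ ⟨ht₁, hp⟩ hf₁ => ?_
  have hs₁ : Stat I s₁ := hs.frame hf₁ rfl
  have hl₁ : Path s₁ (s₁.reg 10) l := by
    rw [hf₁.reg 10 rfl]
    have : ∀ l p, Path s p l → Path s₁ p l := by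
      intro l
      induction l with
      | nil => exact fun p h => h
      | cons x l ih =>
        rintro p ⟨h1, h2, h3, h4⟩
        refine ⟨h1, ?_, ?_, ?_⟩
        · rw [hf₁.arr 10 rfl, h2]
        · rw [hf₁.arr 11 rfl, h3]
        · rw [hf₁.arr 9 rfl]; exact ih _ h4
    exact this l _ hl
  refine (exec_walk hs₁ hl₁ fun v hv =>
    ⟨(hp v hv).1, (hp v hv).2.1, (hp v hv).2.2.1, (hp v hv).2.2.2.1⟩).seq
    fun t₂ s₂ ⟨ht₂, hM⟩ hf₂ => ?_
  have hs₂ : Stat I s₂ := hs₁.frame hf₂ rfl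
  refine (exec_markOut hs₂ hM).seq fun t₃ s₃ ⟨ht₃, hsnk⟩ hf₃ => ?_
  have hs₃ : Stat I s₃ := hs₂.frame hf₃ rfl
  have hmemV : ∀ v, v ∈ V ↔ v < I.n ∧ (2, v) ∉ l ∧ (3, v) ∉ l := by
    intro v
    rw [hV, FinDigraph.mem_freeVerts, I.verts, Finset.mem_range, mem_select, mem_select]
  have hVn : V ⊆ Finset.range I.n := fun v hv => Finset.mem_range.2 ((hmemV v).1 hv).1
  have hmate : ∀ v ∈ V, mateOf s₃ v = some v := by
    intro v hv
    have hvn := Finset.mem_range.1 (hVn hv)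
    unfold mateOf
    rw [hf₃.arr 17 rfl, hf₂.arr 17 rfl, (hp v hvn).2.2.2.2]
    rfl
  have a14 : s₃.arr 14 = s₂.arr 14 := hf₃.arr 14 rfl
  have a15 : s₃.arr 15 = s₂.arr 15 := hf₃.arr 15 rfl
  have hF : FlowState I V Src Snk s₃ := by
    refine ⟨hVn, fun v hv => ?_, fun v hv => ?_, fun v hv => ?_, Finset.inter_subset_right,
      fun v hv => ?_, IsFlow.of_id.congr hmate⟩
    · rw [a14, hM.dead v hv, hmemV]
      split_ifs with h1
      · simp only [false_iff]; tauto
      · simp only [true_iff]; tauto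
    · rw [a14, hM.dead v hv]
      split_ifs <;> norm_num
    · rw [a15, hM.src v (Finset.mem_range.1 (hVn hv)), hSrc, Finset.mem_inter, mem_select]
      tauto
    · rw [hsnk v (Finset.mem_range.1 (hVn hv)), hSnk, FinDigraph.freeSources, Finset.mem_filter]
      simp only [mem_select]
      tauto
  have hval : flowValue V (mateOf s₃) = 0 := by
    rw [flowValue_congr hmate, flowValue_id]
  refine (hF.exec_maxFlow hs₃ hval).seq fun t₄ s₄ ⟨ht₄, hS, hfound, hnot⟩ hf₄ => ?_
  have hs₄ : Stat I s₄ := hs₃.frame hf₄ rfl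
  have a8 : s₄.arr 8 = s.arr 8 := by
    rw [hf₄.arr 8 rfl, hf₃.arr 8 rfl, hf₂.arr 8 rfl, hf₁.arr 8 rfl]
  have htime : ∀ t₅ ≤ 8 * I.n + 5, t₁ + (t₂ + (t₃ + (t₄ + t₅))) ≤
      200 * (I.c + 1) * (I.n + I.m + 1) := by
    intro t₅ ht₅
    have h1 : 13 * l.length + 2 ≤ 65 * (I.c + 1) * (I.n + I.m + 1) := by
      calc 13 * l.length + 2 ≤ 65 * (I.c + 1) := by omega
        _ ≤ _ := Nat.le_mul_of_pos_right _ (by omega)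
    have h2 : 8 * I.n + 2 + (7 * I.m + 2) + (8 * I.n + 5) ≤
        65 * (I.c + 1) * (I.n + I.m + 1) := by
      calc _ ≤ 65 * (I.n + I.m + 1) := by omega
        _ ≤ _ := Nat.mul_le_mul_right _ (by omega)
    have h3 : 200 * (I.c + 1) * (I.n + I.m + 1) = 70 * (I.c + 1) * (I.n + I.m + 1) +
      65 * (I.c + 1) * (I.n + I.m + 1) + 65 * (I.c + 1) * (I.n + I.m + 1) := by ring
    omega
  by_cases h20 : s₄.reg 20 = 0
  · obtain ⟨hcl, hX⟩ := hS.isClosedSet h20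
    have hXV : visited V s₄ \ matched (visited V s₄) (mateOf s₄) ⊆ V :=
      Finset.sdiff_subset.trans hcl.subset
    refine (exec_extract hs₄ h20 hX (hXV.trans hVn)).mono fun t₅ s₅ ⟨ht₅, h8, h25⟩ => ?_
    refine ⟨htime t₅ ht₅, _, ?_, ?_, a8 ▸ h8, h25, ?_⟩
    · rw [I.verts]; exact hXV.trans hVn
    · rw [(hcl.isCut hS.flow).2]; exact hfound h20
    · rintro ⟨P, Y, hsep, _⟩
      exact FinDigraph.isFurthestCut_of_flow hsep hS.flow hcl hS.altReach_of_visited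
  · refine (exec_extract_of_ne hs₄ h20).mono fun t₅ s₅ ⟨ht₅, h25, ha⟩ => ?_
    refine ⟨htime t₅ (by omega), ∅, Finset.empty_subset _, by simp, ?_, Or.inl ⟨h25, rfl⟩, ?_⟩
    · simp [ha, a8]
    · rintro ⟨P, Y, hsep, hY⟩
      have h1 := hnot h20 _ _ hsep.isCut
      have h2 := hsep.card_sdiff
      omega

/-! Weights bound the sizes of subtrees. -/

/-- The size of a subtree with `b` levels of branching. -/
def branchWeight : ℕ → ℕ
  | 0 => 1
  | b + 1 => 1 + 2 * branchWeight b

/-- The size of a subtree in which up to `j` out of `r` terminals can be selected. -/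
def termWeight (b : ℕ) : ℕ → ℕ → ℕ
  | 0, _ => b
  | j + 1, r => b + 2 * ∑ i ∈ Finset.range r, termWeight b j i

theorem branchWeight_pos (b : ℕ) : 1 ≤ branchWeight b := by
  cases b <;> simp [branchWeight]

theorem branchWeight_le (b : ℕ) : branchWeight b + 1 ≤ 2 ^ (b + 1) := by
  induction b with
  | zero => simp [branchWeight]
  | succ b ih => rw [branchWeight, pow_succ]; omega

/-- Terminals are selected in the order of their indices, so each set of `i` terminals arises once,
with `2 ^ i` labellings. The recursion is summed with the hockey-stick identity. -/
theorem termWeight_le (b j r : ℕ) :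
    termWeight b j r ≤ b * ∑ i ∈ Finset.range (j + 1), 2 ^ i * r.choose i := by
  induction j generalizing r with
  | zero => simp [termWeight]
  | succ j ih =>
    have hockey : ∀ i, ∑ q ∈ Finset.range r, q.choose i = r.choose (i + 1) := by
      intro i
      induction r with
      | zero => simp
      | succ r ihr => rw [Finset.sum_range_succ, ihr, Nat.choose_succ_succ, add_comm]
    rw [termWeight, Finset.sum_range_succ']
    have h1 : ∑ q ∈ Finset.range r, termWeight b j q ≤
        b * ∑ i ∈ Finset.range (j + 1), 2 ^ i * r.choose (i + 1) := by
      calc _ ≤ ∑ q ∈ Finset.range r, b * ∑ i ∈ Finset.range (j + 1), 2 ^ i * q.choose i :=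
            Finset.sum_le_sum fun q _ => ih q
        _ = b * ∑ i ∈ Finset.range (j + 1), 2 ^ i * r.choose (i + 1) := by
            rw [← Finset.mul_sum, Finset.sum_comm]
            simp_rw [← Finset.mul_sum, hockey]
    have h2 : ∑ i ∈ Finset.range (j + 1), 2 ^ (i + 1) * r.choose (i + 1) =
        2 * ∑ i ∈ Finset.range (j + 1), 2 ^ i * r.choose (i + 1) := by
      rw [Finset.mul_sum]
      exact Finset.sum_congr rfl fun i _ => by ring
    rw [h2]
    simp only [pow_zero, Nat.choose_zero_right, mul_add]
    nlinarith [h1]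

/-- A bound for the size of the subtree at the node `p`. -/
def weight (I : Inst) (s : State) (p : ℕ) : ℕ :=
  if s.arr 23 p = 0 then
    termWeight (branchWeight (2 * I.c)) (3 * I.c - s.arr 12 p) (I.t - s.arr 13 p)
  else branchWeight (2 * I.c - s.arr 23 p)

/-! Creating nodes. -/

/-- Append a child of the current node; its kind is in register `k`. -/
def push (k : ℕ) : Prog :=
  .store 9 11 10;; .store 10 11 k;; .store 11 11 25;; .store 12 11 27;; .store 13 11 12;;
    .store 23 11 28;; .succ 11 11

/-- The search tree is well-formed. -/
structure TreeInv (I : Inst) (s : State) : Prop where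
  npos : 0 < s.reg 11
  par : ∀ p < s.reg 11, s.arr 9 p < s.reg 11
  path : ∀ p < s.reg 11, ∃ l, Path s p l ∧ l.length ≤ s.arr 12 p + s.arr 23 p
  terms : ∀ p < s.reg 11, s.arr 12 p ≤ 3 * I.c
  branches : ∀ p < s.reg 11, s.arr 23 p ≤ 2 * I.c

/-- `s'` arises from `s` by creating nodes. -/
structure TreeExt (s s' : State) : Prop where
  le : s.reg 11 ≤ s'.reg 11
  arr : ∀ a ∈ [9, 10, 11, 12, 13, 23], ∀ p < s.reg 11, s'.arr a p = s.arr a p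

theorem TreeExt.of_eq {s s' : State} (h : s'.reg 11 = s.reg 11)
    (ha : ∀ a ∈ [9, 10, 11, 12, 13, 23], s'.arr a = s.arr a) : TreeExt s s' :=
  ⟨h.ge, fun a h' p _ => by rw [ha a h']⟩

theorem TreeExt.trans' {s s₁ s₂ : State} (h : TreeExt s s₁) (h' : TreeExt s₁ s₂) :
    TreeExt s s₂ :=
  ⟨h.le.trans h'.le, fun a ha p hp =>
    (h'.arr a ha p (hp.trans_le h.le)).trans (h.arr a ha p hp)⟩

theorem TreeExt.path {s s' : State} (h : TreeExt s s') (hT : TreeInv I s) {p : ℕ}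
    (hp : p < s.reg 11) (hl : Path s p l) : Path s' p l := by
  induction l generalizing p with
  | nil => exact hl
  | cons x l ih =>
    obtain ⟨h1, h2, h3, h4⟩ := hl
    refine ⟨h1, ?_, ?_, ?_⟩
    · rw [h.arr 10 (by decide) p hp, h2]
    · rw [h.arr 11 (by decide) p hp, h3]
    · rw [h.arr 9 (by decide) p hp]
      exact ih (hT.par p hp) h4

theorem TreeExt.weight {s s' : State} (h : TreeExt s s') {p : ℕ} (hp : p < s.reg 11) :
    weight I s' p = weight I s p := by
  unfold RAM.weight
  rw [h.arr 12 (by decide) p hp, h.arr 13 (by decide) p hp, h.arr 23 (by decide) p hp]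

theorem TreeInv.congr {s' : State} (hT : TreeInv I s) (h : s'.reg 11 = s.reg 11)
    (ha : ∀ a ∈ [9, 10, 11, 12, 13, 23], s'.arr a = s.arr a) : TreeInv I s' := by
  have hx := TreeExt.of_eq h ha
  have e9 := ha 9 (by decide)
  have e12 := ha 12 (by decide)
  have e23 := ha 23 (by decide)
  refine ⟨h ▸ hT.npos, ?_, ?_, ?_, ?_⟩ <;> rw [h]
  · rw [e9]; exact hT.par
  · rw [e12, e23]
    intro p hp
    obtain ⟨l, h1, h2⟩ := hT.path p hp
    exact ⟨l, hx.path hT hp h1, h2⟩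
  · rw [e12]; exact hT.terms
  · rw [e23]; exact hT.branches

/-- A node is written at the first free index, so older nodes and their paths to the root are
unaffected. -/
theorem exec_push {k : ℕ} (hT : TreeInv I s) (hq : s.reg 10 < s.reg 11)
    (hl : Path s (s.reg 10) l) (hlen : l.length + 1 ≤ s.reg 27 + s.reg 28)
    (h27 : s.reg 27 ≤ 3 * I.c) (h28 : s.reg 28 ≤ 2 * I.c) :
    Exec (push k) s fun t s' => t = 7 ∧ TreeInv I s' ∧ s'.reg 11 = s.reg 11 + 1 ∧
      TreeExt s s' ∧ Path s' (s.reg 11) ((s.reg k, s.reg 25) :: l) ∧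
      s'.arr 12 (s.reg 11) = s.reg 27 ∧ s'.arr 13 (s.reg 11) = s.reg 12 ∧
      s'.arr 23 (s.reg 11) = s.reg 28 := by
  unfold push
  simp only [exec_seq, exec_store, exec_succ, State.reg_setArr]
  generalize hS : State.setReg _ 11 _ = s'
  have r11 : s'.reg 11 = s.reg 11 + 1 := by rw [← hS]; simp
  have a9 : s'.arr 9 = Function.update (s.arr 9) (s.reg 11) (s.reg 10) := by rw [← hS]; simp
  have a10 : s'.arr 10 = Function.update (s.arr 10) (s.reg 11) (s.reg k) := by rw [← hS]; simp
  have a11 : s'.arr 11 = Function.update (s.arr 11) (s.reg 11) (s.reg 25) := by rw [← hS]; simp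
  have a12 : s'.arr 12 = Function.update (s.arr 12) (s.reg 11) (s.reg 27) := by rw [← hS]; simp
  have a13 : s'.arr 13 = Function.update (s.arr 13) (s.reg 11) (s.reg 12) := by rw [← hS]; simp
  have a23 : s'.arr 23 = Function.update (s.arr 23) (s.reg 11) (s.reg 28) := by rw [← hS]; simp
  have hx : TreeExt s s' := by
    refine ⟨by omega, fun a ha p hp => ?_⟩
    have hne : p ≠ s.reg 11 := by omega
    simp only [List.mem_cons, List.not_mem_nil, or_false] at ha
    rcases ha with rfl | rfl | rfl | rfl | rfl | rfl
    · rw [a9, Function.update_of_ne hne]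
    · rw [a10, Function.update_of_ne hne]
    · rw [a11, Function.update_of_ne hne]
    · rw [a12, Function.update_of_ne hne]
    · rw [a13, Function.update_of_ne hne]
    · rw [a23, Function.update_of_ne hne]
  have hpath : Path s' (s.reg 11) ((s.reg k, s.reg 25) :: l) := by
    refine ⟨hT.npos.ne', by rw [a10, Function.update_self], by rw [a11, Function.update_self], ?_⟩
    rw [a9, Function.update_self]
    exact hx.path hT hq hl
  have b12 : s'.arr 12 (s.reg 11) = s.reg 27 := by rw [a12, Function.update_self]
  have b23 : s'.arr 23 (s.reg 11) = s.reg 28 := by rw [a23, Function.update_self]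
  have cases : ∀ p, p < s'.reg 11 → p < s.reg 11 ∨ p = s.reg 11 := fun p hp => by omega
  refine ⟨by norm_num, ⟨by omega, fun p hp => ?_, fun p hp => ?_, fun p hp => ?_, fun p hp => ?_⟩,
    r11, hx,
    hpath, b12, by rw [a13, Function.update_self], b23⟩
  · rcases cases p hp with hp | rfl
    · have := hT.par p hp
      rw [hx.arr 9 (by decide) p hp]; omega
    · rw [a9, Function.update_self]; omega
  · rcases cases p hp with hp | rfl
    · obtain ⟨l', h1, h2⟩ := hT.path p hp
      refine ⟨l', hx.path hT hp h1, ?_⟩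
      rw [hx.arr 12 (by decide) p hp, hx.arr 23 (by decide) p hp]
      exact h2
    · refine ⟨_, hpath, ?_⟩
      rw [b12, b23]
      simpa using hlen
  · rcases cases p hp with hp | rfl
    · rw [hx.arr 12 (by decide) p hp]; exact hT.terms p hp
    · rw [b12]; exact h27
  · rcases cases p hp with hp | rfl
    · rw [hx.arr 23 (by decide) p hp]; exact hT.branches p hp
    · rw [b23]; exact h28

end

end RAM

/-! ### Children of a node -/

namespace RAM

/-- Branch on the vertex in register `25` (minus one). -/
def branch : Prog :=
  .load 27 12 10;; .load 28 23 10;; .load 12 13 10;;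
    .cond (.eq 25 6) .skip
      (.cond (.lt 28 9) (.sub 25 25 7;; .succ 28 28;; push 29;; push 31) .skip)

/-- Append further terminals to a node without branching. -/
def terminals : Prog :=
  .load 27 12 10;; .load 28 23 10;; .load 12 13 10;;
    .cond (.eq 28 6)
      (.cond (.lt 27 8)
        (.succ 27 27;; .loop (.lt 12 2) (.load 25 2 12;; .succ 12 12;; push 6;; push 7)) .skip)
      .skip

section

variable {I : Inst} {s : State} {l : List (ℕ × ℕ)}

theorem weight_sum_succ {s s' : State} {a : ℕ} (hx : TreeExt s s') (ha : a ≤ s.reg 11)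
    (h : s'.reg 11 = s.reg 11 + 1) :
    ∑ p ∈ Finset.Ico a (s'.reg 11), weight I s' p =
      ∑ p ∈ Finset.Ico a (s.reg 11), weight I s p + weight I s' (s.reg 11) := by
  rw [h, Finset.sum_Ico_succ_top ha]
  congr 1
  exact Finset.sum_congr rfl fun p hp => hx.weight (Finset.mem_Ico.1 hp).2

/-- The `+ 1` pays for the node itself: two children of weight `branchWeight b` and their parent add
up to `branchWeight (b + 1)`. -/
theorem exec_branch (hs : Stat I s) (hT : TreeInv I s) (hq : s.reg 10 < s.reg 11)
    (hl : Path s (s.reg 10) l) (hlen : l.length ≤ s.arr 12 (s.reg 10) + s.arr 23 (s.reg 10)) :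
    Exec branch s fun t s' => t ≤ 21 ∧ TreeInv I s' ∧ TreeExt s s' ∧
      ∑ p ∈ Finset.Ico (s.reg 11) (s'.reg 11), weight I s' p + 1 ≤
        branchWeight (2 * I.c - s.arr 23 (s.reg 10)) ∧
      ∀ x, s.reg 25 = x + 1 → s.arr 23 (s.reg 10) < 2 * I.c → ∀ k, k = 2 ∨ k = 3 →
        ∃ p < s'.reg 11, Path s' p ((k, x) :: l) ∧
          s'.arr 23 p = s.arr 23 (s.reg 10) + 1 := by
  unfold branch
  have hpos := branchWeight_pos (2 * I.c - s.arr 23 (s.reg 10))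
  simp only [exec_seq, exec_load, State.reg_setReg, State.arr_setReg, Nat.reduceEqDiff, if_false]
  generalize hS : State.setReg _ 12 _ = s₁
  have hs₁ : Stat I s₁ := by rw [← hS]; exact ((hs.setReg rfl).setReg rfl).setReg rfl
  have r10 : s₁.reg 10 = s.reg 10 := by rw [← hS]; simp
  have r11 : s₁.reg 11 = s.reg 11 := by rw [← hS]; simp
  have r25 : s₁.reg 25 = s.reg 25 := by rw [← hS]; simp
  have r27 : s₁.reg 27 = s.arr 12 (s.reg 10) := by rw [← hS]; simp
  have r28 : s₁.reg 28 = s.arr 23 (s.reg 10) := by rw [← hS]; simp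
  have ea : s₁.arr = s.arr := by rw [← hS]; simp
  have hx₁ : TreeExt s s₁ := TreeExt.of_eq r11 fun a _ => by rw [ea]
  have hT₁ : TreeInv I s₁ := hT.congr r11 fun a _ => by rw [ea]
  rw [exec_cond, holds_eq, hs₁.r6, r25]
  refine ⟨fun h0 => ?_, fun h0 => ?_⟩
  · rw [exec_skip]
    refine ⟨by norm_num, hT₁, hx₁, ?_, fun x hx => by omega⟩
    simpa [r11] using hpos
  rw [exec_cond, holds_lt, hs₁.r9, r28]
  refine ⟨fun hb => ?_, fun hb => ?_⟩
  swap
  · rw [exec_skip]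
    refine ⟨by norm_num, hT₁, hx₁, ?_, fun x _ hb' => absurd hb' hb⟩
    simpa [r11] using hpos
  obtain ⟨x, hx⟩ := Nat.exists_eq_succ_of_ne_zero h0
  simp only [exec_seq, exec_sub, exec_succ, State.reg_setReg, Nat.reduceEqDiff, if_false,
    hs₁.r7, r25, r28, hx, Nat.succ_eq_add_one, Nat.add_sub_cancel]
  generalize hS2 : State.setReg _ 28 _ = s₂
  have hs₂ : Stat I s₂ := by rw [← hS2]; exact (hs₁.setReg rfl).setReg rfl
  have q10 : s₂.reg 10 = s.reg 10 := by rw [← hS2]; simp [r10]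
  have q11 : s₂.reg 11 = s.reg 11 := by rw [← hS2]; simp [r11]
  have q25 : s₂.reg 25 = x := by rw [← hS2]; simp
  have q27 : s₂.reg 27 = s.arr 12 (s.reg 10) := by rw [← hS2]; simp [r27]
  have q28 : s₂.reg 28 = s.arr 23 (s.reg 10) + 1 := by rw [← hS2]; simp
  have ea₂ : s₂.arr = s.arr := by rw [← hS2]; simp [ea]
  have hx₂ : TreeExt s s₂ := TreeExt.of_eq q11 fun a _ => by rw [ea₂]
  have hT₂ : TreeInv I s₂ := hT.congr q11 fun a _ => by rw [ea₂]
  have hd := hT.terms _ hq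
  refine (exec_push (k := 29) hT₂ (by omega) (q10 ▸ hx₂.path hT hq hl) (by omega) (by omega)
    (by omega)).frame.mono ?_
  rintro t₃ s₃ ⟨⟨ht₃, hT₃, c11, hx₃, hp₃, _, _, hb₃⟩, hf₃⟩
  have c10 : s₃.reg 10 = s.reg 10 := by rw [hf₃.reg 10 rfl, q10]
  have c25 : s₃.reg 25 = x := by rw [hf₃.reg 25 rfl, q25]
  have c27 : s₃.reg 27 = s.arr 12 (s.reg 10) := by rw [hf₃.reg 27 rfl, q27]
  have c28 : s₃.reg 28 = s.arr 23 (s.reg 10) + 1 := by rw [hf₃.reg 28 rfl, q28]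
  have hs₃ : Stat I s₃ := hs₂.frame hf₃ rfl
  have hx03 := hx₂.trans' hx₃
  refine (exec_push (k := 31) hT₃ (by omega) (c10 ▸ hx03.path hT hq hl) (by omega) (by omega)
    (by omega)).mono ?_
  rintro t₄ s₄ ⟨ht₄, hT₄, d11, hx₄, hp₄, _, _, hb₄⟩
  refine ⟨by omega, hT₄, hx03.trans' hx₄, ?_, ?_⟩
  · have w₃ : weight I s₃ (s₂.reg 11) = branchWeight (2 * I.c - (s.arr 23 (s.reg 10) + 1)) := by
      unfold weight; rw [hb₃, q28, if_neg (by omega)]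
    have w₄ : weight I s₄ (s₃.reg 11) = branchWeight (2 * I.c - (s.arr 23 (s.reg 10) + 1)) := by
      unfold weight; rw [hb₄, c28, if_neg (by omega)]
    rw [weight_sum_succ hx₄ (by omega) d11, weight_sum_succ hx₃ (by omega) c11, w₃, w₄, q11,
      Finset.Ico_self, Finset.sum_empty]
    have : 2 * I.c - s.arr 23 (s.reg 10) = 2 * I.c - (s.arr 23 (s.reg 10) + 1) + 1 := by omega
    rw [this, branchWeight]
    omega
  · rintro y hy _ k hk
    have hyx : y = x := by omega
    subst hyx
    rw [hs₂.r29, q25] at hp₃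
    rw [hs₃.r31, c25] at hp₄
    rcases hk with rfl | rfl
    · refine ⟨s₂.reg 11, by omega, hx₄.path hT₃ (by omega) hp₃, ?_⟩
      rw [hx₄.arr 23 (by decide) _ (by omega), hb₃, q28]
    · exact ⟨s₃.reg 11, by omega, hp₄, by rw [hb₄, c28]⟩

/-- The weight of a node without branchings splits into its branching part, which `exec_branch`
consumes, and the weights of a source child and a sink child for each later terminal. Nodes that
have branched already receive no further terminals. -/
theorem exec_terminals (hs : Stat I s) (hT : TreeInv I s) (hq : s.reg 10 < s.reg 11)
    (hl : Path s (s.reg 10) l) (hlen : l.length ≤ s.arr 12 (s.reg 10) + s.arr 23 (s.reg 10)) :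
    Exec terminals s fun t s' => t ≤ 17 * I.n + 8 ∧ TreeInv I s' ∧ TreeExt s s' ∧
      ∑ p ∈ Finset.Ico (s.reg 11) (s'.reg 11), weight I s' p +
        branchWeight (2 * I.c - s.arr 23 (s.reg 10)) ≤ weight I s (s.reg 10) ∧
      (s.arr 23 (s.reg 10) = 0 → s.arr 12 (s.reg 10) < 3 * I.c →
        ∀ i, s.arr 13 (s.reg 10) ≤ i → i < I.t → ∀ k, k = 0 ∨ k = 1 →
        ∃ p < s'.reg 11, Path s' p ((k, I.tm i) :: l) ∧ s'.arr 23 p = 0 ∧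
          s'.arr 12 p = s.arr 12 (s.reg 10) + 1 ∧ s'.arr 13 p = i + 1) := by
  unfold terminals
  simp only [exec_seq, exec_load, State.reg_setReg, State.arr_setReg, Nat.reduceEqDiff, if_false]
  generalize hS : State.setReg _ 12 _ = s₁
  have hs₁ : Stat I s₁ := by rw [← hS]; exact ((hs.setReg rfl).setReg rfl).setReg rfl
  have r10 : s₁.reg 10 = s.reg 10 := by rw [← hS]; simp
  have r11 : s₁.reg 11 = s.reg 11 := by rw [← hS]; simp
  have r12 : s₁.reg 12 = s.arr 13 (s.reg 10) := by rw [← hS]; simp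
  have r27 : s₁.reg 27 = s.arr 12 (s.reg 10) := by rw [← hS]; simp
  have r28 : s₁.reg 28 = s.arr 23 (s.reg 10) := by rw [← hS]; simp
  have ea : s₁.arr = s.arr := by rw [← hS]; simp
  have hx₁ : TreeExt s s₁ := TreeExt.of_eq r11 fun a _ => by rw [ea]
  have hT₁ : TreeInv I s₁ := hT.congr r11 fun a _ => by rw [ea]
  rw [exec_cond, holds_eq, hs₁.r6, r28]
  refine ⟨fun h0 => ?_, fun h0 => ?_⟩
  swap
  · rw [exec_skip]
    refine ⟨by omega, hT₁, hx₁, ?_, fun h => absurd h h0⟩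
    unfold weight
    rw [r11, if_neg h0]
    simp
  rw [exec_cond, holds_lt, hs₁.r8, r27]
  refine ⟨fun hd => ?_, fun hd => ?_⟩
  swap
  · rw [exec_skip]
    refine ⟨by omega, hT₁, hx₁, ?_, fun _ h => absurd h hd⟩
    have : 3 * I.c - s.arr 12 (s.reg 10) = 0 := by omega
    unfold weight
    rw [r11, if_pos h0, h0, this]
    simp [termWeight]
  rw [exec_seq, exec_succ]
  generalize hS2 : State.setReg _ 27 _ = s₂
  have hs₂ : Stat I s₂ := by rw [← hS2]; exact hs₁.setReg rfl
  have q10 : s₂.reg 10 = s.reg 10 := by rw [← hS2]; simp [r10]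
  have q11 : s₂.reg 11 = s.reg 11 := by rw [← hS2]; simp [r11]
  have q12 : s₂.reg 12 = s.arr 13 (s.reg 10) := by rw [← hS2]; simp [r12]
  have q27 : s₂.reg 27 = s.arr 12 (s.reg 10) + 1 := by rw [← hS2]; simp [r27]
  have q28 : s₂.reg 28 = 0 := by rw [← hS2]; simp [r28, h0]
  have ea₂ : s₂.arr = s.arr := by rw [← hS2]; simp [ea]
  have hx₂ : TreeExt s s₂ := TreeExt.of_eq q11 fun a _ => by rw [ea₂]
  have hT₂ : TreeInv I s₂ := hT.congr q11 fun a _ => by rw [ea₂]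
  set j := 3 * I.c - (s.arr 12 (s.reg 10) + 1) with hj
  set W := fun r => termWeight (branchWeight (2 * I.c)) j r with hW
  refine (exec_loop (k := 17 * (I.t - s.arr 13 (s.reg 10))) (fun k s₃ => ∃ i, s₃.reg 12 = i ∧
    s.arr 13 (s.reg 10) ≤ i ∧ k = 17 * (I.t - i) ∧ TreeInv I s₃ ∧ TreeExt s s₃ ∧
    ∑ p ∈ Finset.Ico (s.reg 11) (s₃.reg 11), weight I s₃ p +
      2 * ∑ r ∈ Finset.range (I.t - i), W r ≤
        2 * ∑ r ∈ Finset.range (I.t - s.arr 13 (s.reg 10)), W r ∧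
    ∀ i', s.arr 13 (s.reg 10) ≤ i' → i' < i → ∀ k, k = 0 ∨ k = 1 →
      ∃ p < s₃.reg 11, Path s₃ p ((k, I.tm i') :: l) ∧ s₃.arr 23 p = 0 ∧
        s₃.arr 12 p = s.arr 12 (s.reg 10) + 1 ∧ s₃.arr 13 p = i' + 1) ?_
    ⟨_, q12, le_rfl, rfl, hT₂, hx₂, ?_, fun i' h1 h2 => by omega⟩).frame.mono ?_
  · rintro k s₃ ⟨i, hi, hli, rfl, hT₃, hx₃, hsum, hch⟩ hb hf₃
    have hs₃ : Stat I s₃ := hs₂.frame hf₃ rfl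
    rw [holds_lt, hs₃.r2, hi] at hb
    simp only [exec_seq, exec_load, exec_succ, State.reg_setReg, Nat.reduceEqDiff, if_false,
      hs₃.a2, hi]
    generalize hS4 : State.setReg _ 12 _ = s₄
    have hs₄ : Stat I s₄ := by rw [← hS4]; exact (hs₃.setReg rfl).setReg rfl
    have u10 : s₄.reg 10 = s.reg 10 := by rw [← hS4]; simp [hf₃.reg 10 rfl, q10]
    have u11 : s₄.reg 11 = s₃.reg 11 := by rw [← hS4]; simp
    have u12 : s₄.reg 12 = i + 1 := by rw [← hS4]; simp
    have u25 : s₄.reg 25 = I.tm i := by rw [← hS4]; simp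
    have u27 : s₄.reg 27 = s.arr 12 (s.reg 10) + 1 := by rw [← hS4]; simp [hf₃.reg 27 rfl, q27]
    have u28 : s₄.reg 28 = 0 := by rw [← hS4]; simp [hf₃.reg 28 rfl, q28]
    have ea₄ : s₄.arr = s₃.arr := by rw [← hS4]; simp
    have hx34 : TreeExt s₃ s₄ := TreeExt.of_eq u11 fun a _ => by rw [ea₄]
    have hT₄ : TreeInv I s₄ := hT₃.congr u11 fun a _ => by rw [ea₄]
    have hx04 := hx₃.trans' hx34
    have hle := hx04.le
    refine (exec_push (k := 6) hT₄ (by omega) (u10 ▸ hx04.path hT hq hl) (by omega) (by omega)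
      (by omega)).frame.mono ?_
    rintro t₅ s₅ ⟨⟨ht₅, hT₅, v11, hx45, hp₅, hd₅, hi₅, hb₅⟩, hf₅⟩
    have hs₅ : Stat I s₅ := hs₄.frame hf₅ rfl
    have v10 : s₅.reg 10 = s.reg 10 := by rw [hf₅.reg 10 rfl, u10]
    have v12 : s₅.reg 12 = i + 1 := by rw [hf₅.reg 12 rfl, u12]
    have v25 : s₅.reg 25 = I.tm i := by rw [hf₅.reg 25 rfl, u25]
    have v27 : s₅.reg 27 = s.arr 12 (s.reg 10) + 1 := by rw [hf₅.reg 27 rfl, u27]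
    have v28 : s₅.reg 28 = 0 := by rw [hf₅.reg 28 rfl, u28]
    have hx05 := hx04.trans' hx45
    refine (exec_push (k := 7) hT₅ (by omega) (v10 ▸ hx05.path hT hq hl) (by omega) (by omega)
      (by omega)).frame.mono ?_
    rintro t₆ s₆ ⟨⟨ht₆, hT₆, w11, hx56, hp₆, hd₆, hi₆, hb₆⟩, hf₆⟩
    have w12 : s₆.reg 12 = i + 1 := by rw [hf₆.reg 12 rfl, v12]
    rw [hs₄.r6, u25] at hp₅
    rw [hs₅.r7, v25] at hp₆
    have W₅ : weight I s₅ (s₄.reg 11) = W (I.t - (i + 1)) := by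
      unfold weight; rw [hb₅, u28, if_pos rfl, hd₅, u27, hi₅, u12]
    have W₆ : weight I s₆ (s₅.reg 11) = W (I.t - (i + 1)) := by
      unfold weight; rw [hb₆, v28, if_pos rfl, hd₆, v27, hi₆, v12]
    refine ⟨17 * (I.t - (i + 1)), ⟨i + 1, w12, by omega, rfl, hT₆, hx05.trans' hx56, ?_, ?_⟩,
      by omega⟩
    · have e0 : ∑ p ∈ Finset.Ico (s.reg 11) (s₄.reg 11), weight I s₄ p =
          ∑ p ∈ Finset.Ico (s.reg 11) (s₃.reg 11), weight I s₃ p := by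
        rw [u11]
        exact Finset.sum_congr rfl fun p hp => hx34.weight (Finset.mem_Ico.1 hp).2
      rw [weight_sum_succ hx56 (by omega) w11, weight_sum_succ hx45 (by omega) v11, W₅, W₆, e0]
      have : I.t - i = I.t - (i + 1) + 1 := by omega
      rw [this, Finset.sum_range_succ] at hsum
      omega
    · intro i' h1 h2 k hk
      rcases Nat.lt_succ_iff_lt_or_eq.1 h2 with h2 | rfl
      · obtain ⟨p, hp, g1, g2, g3, g4⟩ := hch i' h1 h2 k hk
        have hx36 := hx34.trans' (hx45.trans' hx56)
        refine ⟨p, by omega, hx36.path hT₃ hp g1, ?_, ?_, ?_⟩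
        · rw [hx36.arr 23 (by decide) p hp, g2]
        · rw [hx36.arr 12 (by decide) p hp, g3]
        · rw [hx36.arr 13 (by decide) p hp, g4]
      · rcases hk with rfl | rfl
        · have hp : s₄.reg 11 < s₅.reg 11 := by omega
          refine ⟨s₄.reg 11, by omega, hx56.path hT₅ hp hp₅, ?_, ?_, ?_⟩
          · rw [hx56.arr 23 (by decide) _ hp, hb₅, u28]
          · rw [hx56.arr 12 (by decide) _ hp, hd₅, u27]
          · rw [hx56.arr 13 (by decide) _ hp, hi₅, u12]
        · exact ⟨s₅.reg 11, by omega, hp₆, by rw [hb₆, v28], by rw [hd₆, v27], by rw [hi₆, v12]⟩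
  · rw [q11]; simp
  · rintro t s₃ ⟨⟨k', ⟨i, hi, hli, rfl, hT₃, hx₃, hsum, hch⟩, hb, ht⟩, hf₃⟩
    have hs₃ : Stat I s₃ := hs₂.frame hf₃ rfl
    rw [holds_lt, hs₃.r2, hi] at hb
    have htn := I.t_le
    refine ⟨by omega, hT₃, hx₃, ?_, fun _ _ i' h1 h2 => hch i' h1 (by omega)⟩
    have : 3 * I.c - s.arr 12 (s.reg 10) = j + 1 := by omega
    unfold weight at hsum ⊢
    rw [if_pos h0, h0, this, termWeight, Nat.sub_zero]
    change _ ≤ _ + 2 * ∑ r ∈ Finset.range (I.t - s.arr 13 (s.reg 10)), W r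
    omega

end

end RAM

/-! ### Growing the whole search tree -/

namespace RAM

/-- Expand the node in register `10`. -/
def node : Prog := findCut;; branch;; terminals

/-- Expand all nodes. -/
def grow : Prog := .loop (.lt 10 11) (node;; .succ 10 10)

/-- The set of kept vertices. -/
def Keeps (s : State) (K : Finset ℕ) : Prop := ∀ v, s.arr 8 v = if v ∈ K then 1 else 0

/-- The node `p`, which represents the choices in `l`, has its cut and its children. -/
structure Expanded (I : Inst) (s : State) (K : Finset ℕ) (p : ℕ) (l : List (ℕ × ℕ)) : Prop where
  path : Path s p l
  cut : (∃ P Y, I.G.IsSeparation (select 0 l) (select 1 l) (select 2 l) (select 3 l) P Y ∧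
    Y.card ≤ I.c) → ∃ X ⊆ K,
      I.G.IsFurthestCut (select 0 l) (select 1 l) (select 2 l) (select 3 l) X ∧
      (X.Nonempty → s.arr 23 p < 2 * I.c → ∃ x ∈ X, ∀ k, k = 2 ∨ k = 3 →
        ∃ p' < s.reg 11, Path s p' ((k, x) :: l) ∧ s.arr 23 p' = s.arr 23 p + 1)
  terms : s.arr 23 p = 0 → s.arr 12 p < 3 * I.c → ∀ i, s.arr 13 p ≤ i → i < I.t →
    ∀ k, k = 0 ∨ k = 1 → ∃ p' < s.reg 11, Path s p' ((k, I.tm i) :: l) ∧ s.arr 23 p' = 0 ∧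
      s.arr 12 p' = s.arr 12 p + 1 ∧ s.arr 13 p' = i + 1

section

variable {I : Inst} {s : State} {l : List (ℕ × ℕ)} {K : Finset ℕ}

/-- Identifies the choices under which a node was created with those for which it is known to be
expanded. -/
theorem Path.unique {p : ℕ} {l' : List (ℕ × ℕ)} (h : Path s p l) (h' : Path s p l') : l = l' := by
  induction l generalizing p l' with
  | nil =>
    cases l' with
    | nil => rfl
    | cons x l' => exact absurd h h'.1
  | cons x l ih =>
    cases l' with
    | nil => exact absurd h' h.1
    | cons y l' =>
      obtain ⟨_, h2, h3, h4⟩ := h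
      obtain ⟨_, h2', h3', h4'⟩ := h'
      rw [ih h4 h4', Prod.ext (h2.symm.trans h2') (h3.symm.trans h3')]

theorem Expanded.mono {s' : State} {K' : Finset ℕ} {p : ℕ} (h : Expanded I s K p l)
    (hT : TreeInv I s) (hx : TreeExt s s') (hK : K ⊆ K') (hp : p < s.reg 11) :
    Expanded I s' K' p l := by
  have e12 := hx.arr 12 (by decide)
  have e23 := hx.arr 23 (by decide)
  have e13 := hx.arr 13 (by decide)
  refine ⟨hx.path hT hp h.path, fun hs => ?_, fun h0 h1 i h2 h3 k hk => ?_⟩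
  · obtain ⟨X, hX, hc, hb⟩ := h.cut hs
    refine ⟨X, hX.trans hK, hc, fun hn hlt => ?_⟩
    rw [e23 p hp] at hlt ⊢
    obtain ⟨x, hxX, hch⟩ := hb hn hlt
    refine ⟨x, hxX, fun k hk => ?_⟩
    obtain ⟨p', g1, g2, g3⟩ := hch k hk
    exact ⟨p', g1.trans_le hx.le, hx.path hT g1 g2, by rw [e23 p' g1, g3]⟩
  · rw [e23 p hp] at h0
    rw [e12 p hp] at h1 ⊢
    rw [e13 p hp] at h2
    obtain ⟨p', g1, g2, g3, g4, g5⟩ := h.terms h0 h1 i h2 h3 k hk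
    exact ⟨p', g1.trans_le hx.le, hx.path hT g1 g2, by rw [e23 p' g1, g3], by rw [e12 p' g1, g4],
      by rw [e13 p' g1, g5]⟩

/-- The weights of all new children plus one are at most the weight of the expanded node; summed
over the tree, this bounds the number of nodes. The `3` extra steps are reserved for the surrounding
loop. -/
theorem exec_node (hs : Stat I s) (hT : TreeInv I s) (hq : s.reg 10 < s.reg 11)
    (hK : Keeps s K) :
    Exec node s fun t s' => t + 3 ≤ 250 * (I.c + 1) * (I.n + I.m + 1) ∧ TreeInv I s' ∧
      TreeExt s s' ∧
      ∑ p ∈ Finset.Ico (s.reg 11) (s'.reg 11), weight I s' p + 1 ≤ weight I s (s.reg 10) ∧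
      ∃ X ⊆ I.G.verts, X.card ≤ I.c ∧ Keeps s' (K ∪ X) ∧
        ∃ l, Expanded I s' (K ∪ X) (s.reg 10) l := by
  obtain ⟨l, hl, hlen⟩ := hT.path _ hq
  have hd := hT.terms _ hq
  have hb := hT.branches _ hq
  unfold node
  refine (exec_findCut hs hl (by omega)).seq fun t₁ s₁ ⟨ht₁, X, hXG, hXc, h8, h25, hcut⟩ hf₁ => ?_
  have hs₁ : Stat I s₁ := hs.frame hf₁ rfl
  have r10 : s₁.reg 10 = s.reg 10 := hf₁.reg 10 rfl
  have r11 : s₁.reg 11 = s.reg 11 := hf₁.reg 11 rfl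
  have ea : ∀ a ∈ [9, 10, 11, 12, 13, 23], s₁.arr a = s.arr a := by
    intro a ha
    refine hf₁.arr a ?_
    simp only [List.mem_cons, List.not_mem_nil, or_false] at ha
    rcases ha with rfl | rfl | rfl | rfl | rfl | rfl <;> rfl
  have e12 := ea 12 (by decide)
  have e13 := ea 13 (by decide)
  have e23 := ea 23 (by decide)
  have hx₁ : TreeExt s s₁ := TreeExt.of_eq r11 ea
  have hT₁ : TreeInv I s₁ := hT.congr r11 ea
  have hq₁ : s₁.reg 10 < s₁.reg 11 := by omega
  have hl₁ : Path s₁ (s₁.reg 10) l := r10 ▸ hx₁.path hT hq hl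
  refine (exec_branch hs₁ hT₁ hq₁ hl₁ (by rw [e12, e23, r10]; exact hlen)).seq
    fun t₂ s₂ ⟨ht₂, hT₂, hx₂, hw₂, hc₂⟩ hf₂ => ?_
  have hs₂ : Stat I s₂ := hs₁.frame hf₂ rfl
  have q10 : s₂.reg 10 = s.reg 10 := by rw [hf₂.reg 10 rfl, r10]
  have hle₂ := hx₂.le
  have hx02 := hx₁.trans' hx₂
  have f12 := hx02.arr 12 (by decide) _ hq
  have f13 := hx02.arr 13 (by decide) _ hq
  have f23 := hx02.arr 23 (by decide) _ hq
  refine (exec_terminals hs₂ hT₂ (by omega) (q10 ▸ hx02.path hT hq hl)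
    (by rw [q10, f12, f23]; exact hlen)).frame.mono ?_
  rintro t₃ s₃ ⟨⟨ht₃, hT₃, hx₃, hw₃, hc₃⟩, hf₃⟩
  rw [q10, f23, hx02.weight hq] at hw₃
  rw [r10, e23, r11] at hw₂
  rw [q10, f12, f13, f23] at hc₃
  have hx03 := hx02.trans' hx₃
  have g12 := hx03.arr 12 (by decide) _ hq
  have g13 := hx03.arr 13 (by decide) _ hq
  have g23 := hx03.arr 23 (by decide) _ hq
  refine ⟨?_, hT₃, hx03, ?_, X, hXG, hXc, ?_, l, hx03.path hT hq hl, ?_, ?_⟩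
  · have h1 : 17 * I.n + 32 ≤ 50 * (I.c + 1) * (I.n + I.m + 1) := by
      calc _ ≤ 50 * (I.n + I.m + 1) := by omega
        _ ≤ _ := Nat.mul_le_mul_right _ (by omega)
    have h2 : 250 * (I.c + 1) * (I.n + I.m + 1) = 200 * (I.c + 1) * (I.n + I.m + 1) +
      50 * (I.c + 1) * (I.n + I.m + 1) := by ring
    omega
  · have hle₃ := hx₃.le
    rw [← Finset.sum_Ico_consecutive _ (show s.reg 11 ≤ s₂.reg 11 by omega) hle₃,
      Finset.sum_congr rfl fun p hp => hx₃.weight (Finset.mem_Ico.1 hp).2]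
    omega
  · intro v
    rw [hf₃.arr 8 rfl, hf₂.arr 8 rfl, h8 v, hK v]
    by_cases h1 : v ∈ X <;> by_cases h2 : v ∈ K <;> simp [h1, h2]
  · intro hsep
    refine ⟨X, Finset.subset_union_right, hcut hsep, fun hn hlt => ?_⟩
    rw [g23] at hlt ⊢
    rcases h25 with ⟨_, h0⟩ | ⟨x, hxX, h0⟩
    · exact absurd h0 hn.ne_empty
    · refine ⟨x, hxX, fun k hk => ?_⟩
      obtain ⟨p, k1, k2, k3⟩ := hc₂ x h0 (by rw [r10, e23]; exact hlt) k hk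
      refine ⟨p, k1.trans_le hx₃.le, hx₃.path hT₂ k1 k2, ?_⟩
      rw [hx₃.arr 23 (by decide) p k1, k3, r10, e23]
  · rw [g12, g13, g23]
    exact hc₃

/-- The number of expanded nodes plus the total weight of the waiting ones never exceeds the weight
of the root. So the loop ends after at most that many rounds, each adding at most `c` vertices to
the kept set. -/
theorem exec_grow (hs : Stat I s) (hT : TreeInv I s) (h10 : s.reg 10 = 0) (h11 : s.reg 11 = 1)
    (hK : Keeps s K) (hKG : K ⊆ I.G.verts) :
    Exec grow s fun t s' => t ≤ 250 * (I.c + 1) * (I.n + I.m + 1) * weight I s 0 + 1 ∧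
      TreeInv I s' ∧ TreeExt s s' ∧ ∃ K', K ⊆ K' ∧ K' ⊆ I.G.verts ∧
        K'.card ≤ K.card + I.c * weight I s 0 ∧ Keeps s' K' ∧
        ∀ p < s'.reg 11, ∃ l, Expanded I s' K' p l := by
  unfold grow
  set C := 250 * (I.c + 1) * (I.n + I.m + 1) with hC
  refine (exec_loop (k := C * weight I s 0) (fun k s₁ => s₁.reg 10 ≤ s₁.reg 11 ∧
    s₁.reg 10 + ∑ p ∈ Finset.Ico (s₁.reg 10) (s₁.reg 11), weight I s₁ p ≤ weight I s 0 ∧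
    k = C * ∑ p ∈ Finset.Ico (s₁.reg 10) (s₁.reg 11), weight I s₁ p ∧
      TreeInv I s₁ ∧ TreeExt s s₁ ∧ ∃ K', K ⊆ K' ∧ K' ⊆ I.G.verts ∧
        K'.card ≤ K.card + I.c * s₁.reg 10 ∧ Keeps s₁ K' ∧
        ∀ p < s₁.reg 10, ∃ l, Expanded I s₁ K' p l) ?_
    ⟨by omega, by simp [h10, h11], by simp [h10, h11], hT, TreeExt.of_eq rfl fun _ _ => rfl, K,
      subset_rfl, hKG, by omega, hK, fun p hp => by omega⟩).mono ?_
  · rintro k s₁ ⟨hle, hsum, rfl, hT₁, hx₁, K₁, hKK, hK₁G, hcard, hK₁, hproc⟩ hb hf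
    have hs₁ : Stat I s₁ := hs.frame hf rfl
    rw [holds_lt] at hb
    simp only [exec_seq, exec_succ]
    refine (exec_node hs₁ hT₁ hb hK₁).frame.mono ?_
    rintro t s₂ ⟨⟨ht, hT₂, hx₂, hw, X, hXG, hXc, hK₂, l, hP⟩, hf₂⟩
    have q10 : s₂.reg 10 = s₁.reg 10 := hf₂.reg 10 rfl
    generalize hS : State.setReg s₂ 10 _ = s₃
    have c10 : s₃.reg 10 = s₁.reg 10 + 1 := by rw [← hS]; simp [q10]
    have c11 : s₃.reg 11 = s₂.reg 11 := by rw [← hS]; simp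
    have ea : s₃.arr = s₂.arr := by rw [← hS]; simp
    have hx₃ : TreeExt s₂ s₃ := TreeExt.of_eq c11 fun a _ => by rw [ea]
    have hT₃ : TreeInv I s₃ := hT₂.congr c11 fun a _ => by rw [ea]
    have hle₂ := hx₂.le
    have hx13 := hx₂.trans' hx₃
    have hsplit : ∑ p ∈ Finset.Ico (s₁.reg 10 + 1) (s₃.reg 11), weight I s₃ p =
        ∑ p ∈ Finset.Ico (s₁.reg 10 + 1) (s₁.reg 11), weight I s₁ p +
        ∑ p ∈ Finset.Ico (s₁.reg 11) (s₂.reg 11), weight I s₂ p := by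
      rw [c11, ← Finset.sum_Ico_consecutive _ (show s₁.reg 10 + 1 ≤ s₁.reg 11 by omega) hle₂]
      congr 1
      · exact Finset.sum_congr rfl fun p hp => hx13.weight (Finset.mem_Ico.1 hp).2
      · exact Finset.sum_congr rfl fun p hp => hx₃.weight (Finset.mem_Ico.1 hp).2
    rw [Finset.sum_eq_sum_Ico_succ_bot hb] at hsum ⊢
    rw [c10, hsplit]
    refine ⟨_, ⟨by omega, by omega, rfl, hT₃, hx₁.trans' hx13, K₁ ∪ X,
      hKK.trans Finset.subset_union_left, Finset.union_subset hK₁G hXG, ?_, ?_, ?_⟩, ?_⟩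
    · have := Finset.card_union_le K₁ X
      rw [Nat.mul_add, Nat.mul_one]
      omega
    · intro v; rw [ea]; exact hK₂ v
    · intro p hp
      rcases Nat.lt_succ_iff_lt_or_eq.1 hp with hp | rfl
      · obtain ⟨l', hl'⟩ := hproc p hp
        exact ⟨l', hl'.mono hT₁ hx13 Finset.subset_union_left (by omega)⟩
      · exact ⟨l, hP.mono hT₂ hx₃ subset_rfl (by omega)⟩
    · have := Nat.mul_le_mul_left C hw
      simp only [Nat.mul_add, Nat.mul_one] at this ⊢
      omega
  · rintro t s' ⟨k', ⟨hle, hsum, rfl, hT', hx, K', hKK, hKG', hcard, hK', hproc⟩, hb, ht⟩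
    rw [holds_lt] at hb
    have he : s'.reg 10 = s'.reg 11 := by omega
    refine ⟨by omega, hT', hx, K', hKK, hKG', ?_, hK', he ▸ hproc⟩
    refine hcard.trans (Nat.add_le_add_left (Nat.mul_le_mul_left _ (by omega)) _)

end

end RAM

/-! ### Completeness of the search tree -/

namespace RAM

section

variable {I : Inst} {s : State} {K : Finset ℕ}

/-- The first `i` terminals. -/
def Inst.terms (I : Inst) (i : ℕ) : Finset ℕ := (Finset.range i).image I.tm

theorem Inst.terms_succ (I : Inst) (i : ℕ) : I.terms (i + 1) = insert (I.tm i) (I.terms i) := by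
  rw [terms, Finset.range_add_one, Finset.image_insert, terms]

theorem Inst.tm_notMem_terms (I : Inst) {i : ℕ} (hi : i < I.t) : I.tm i ∉ I.terms i := by
  intro h
  obtain ⟨j, hj, he⟩ := Finset.mem_image.1 h
  rw [Finset.mem_range] at hj
  have := I.tm_inj j (by omega) i hi he
  omega

theorem Inst.terms_subset (I : Inst) : I.terms I.t ⊆ I.G.verts := by
  intro v hv
  obtain ⟨j, hj, rfl⟩ := Finset.mem_image.1 hv
  rw [I.verts, Finset.mem_range]
  exact I.tm_lt j (Finset.mem_range.1 hj)

/-- The complete search tree has a node for every small pair of sets of terminals. -/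
theorem exists_node (h0 : 0 < s.reg 11) (h12 : s.arr 12 0 = 0) (h13 : s.arr 13 0 = 0)
    (h23 : s.arr 23 0 = 0) (hP : ∀ p < s.reg 11, ∃ l, Expanded I s K p l) {A B : Finset ℕ}
    (hAB : Disjoint A B) (hc : (A ∪ B).card ≤ 3 * I.c) (i : ℕ) (hi : i ≤ I.t) :
    ∃ p < s.reg 11, ∃ l, Path s p l ∧ s.arr 23 p = 0 ∧ s.arr 13 p ≤ i ∧
      s.arr 12 p ≤ ((A ∪ B) ∩ I.terms i).card ∧ select 0 l = A ∩ I.terms i ∧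
      select 1 l = B ∩ I.terms i ∧ select 2 l = ∅ ∧ select 3 l = ∅ := by
  induction i with
  | zero =>
    refine ⟨0, h0, [], rfl, h23, by omega, by omega, ?_⟩
    simp [Inst.terms, select]
  | succ i ih =>
    obtain ⟨p, hp, l, hl, e23, e13, e12, l0, l1, l2, l3⟩ := ih (by omega)
    obtain ⟨l', hpr⟩ := hP p hp
    obtain rfl := hl.unique hpr.path
    have hni := I.tm_notMem_terms (i := i) (by omega)
    rw [I.terms_succ]
    have hins : ∀ S : Finset ℕ, I.tm i ∈ S → S ∩ insert (I.tm i) (I.terms i) =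
        insert (I.tm i) (S ∩ I.terms i) := fun S h => Finset.inter_insert_of_mem h
    have hnot : ∀ S : Finset ℕ, I.tm i ∉ S → S ∩ insert (I.tm i) (I.terms i) =
        S ∩ I.terms i := fun S h => Finset.inter_insert_of_notMem h
    -- A terminal outside `A ∪ B` is skipped by staying at the same node: its children may start
    -- with any later index.
    by_cases hmem : I.tm i ∈ A ∪ B
    · have hcard : ((A ∪ B) ∩ insert (I.tm i) (I.terms i)).card =
          ((A ∪ B) ∩ I.terms i).card + 1 := by
        rw [hins _ hmem, Finset.card_insert_of_notMem fun h => hni (Finset.mem_inter.1 h).2]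
      have hle := Finset.card_le_card (Finset.inter_subset_left (s₁ := A ∪ B)
        (s₂ := insert (I.tm i) (I.terms i)))
      have hch := hpr.terms e23 (by omega) i e13 (by omega)
      rcases Finset.mem_union.1 hmem with hA | hB
      · obtain ⟨p', g1, g2, g3, g4, g5⟩ := hch 0 (Or.inl rfl)
        have hB : I.tm i ∉ B := Finset.disjoint_left.1 hAB hA
        refine ⟨p', g1, _, g2, g3, g5.le, by omega, ?_, ?_, ?_, ?_⟩
        · rw [select_cons_self, l0, hins A hA]
        · rw [select_cons_of_ne _ _ (by decide), l1, hnot B hB]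
        · rw [select_cons_of_ne _ _ (by decide), l2]
        · rw [select_cons_of_ne _ _ (by decide), l3]
      · obtain ⟨p', g1, g2, g3, g4, g5⟩ := hch 1 (Or.inr rfl)
        have hA : I.tm i ∉ A := Finset.disjoint_right.1 hAB hB
        refine ⟨p', g1, _, g2, g3, g5.le, by omega, ?_, ?_, ?_, ?_⟩
        · rw [select_cons_of_ne _ _ (by decide), l0, hnot A hA]
        · rw [select_cons_self, l1, hins B hB]
        · rw [select_cons_of_ne _ _ (by decide), l2]
        · rw [select_cons_of_ne _ _ (by decide), l3]
    · have hA : I.tm i ∉ A := fun h => hmem (Finset.mem_union_left _ h)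
      have hB : I.tm i ∉ B := fun h => hmem (Finset.mem_union_right _ h)
      rw [hnot _ hmem, hnot _ hA, hnot _ hB]
      exact ⟨p, hp, l, hl, e23, by omega, e12, l0, l1, l2, l3⟩

/-- The complete search tree finds all vertices of small important separators. -/
theorem subset_of_isImportantSeparator (h0 : 0 < s.reg 11) (h12 : s.arr 12 0 = 0)
    (h13 : s.arr 13 0 = 0) (h23 : s.arr 23 0 = 0)
    (hP : ∀ p < s.reg 11, ∃ l, Expanded I s K p l) {A B Z : Finset ℕ} (hAB : Disjoint A B)
    (hT : A ∪ B = I.terms I.t) (hZ : I.G.IsImportantSeparator A B Z) (hc : Z.card ≤ I.c) :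
    Z ⊆ K := by
  classical
  have hAG : A ⊆ I.G.verts := Finset.subset_union_left.trans (hT.subset.trans I.terms_subset)
  set R₀ := I.G.verts.filter (· ∈ I.G.reachSet A Z) with hR₀
  have hR : ∀ v, v ∈ R₀ ↔ v ∈ I.G.reachSet A Z := fun v => by
    rw [hR₀, Finset.mem_filter]
    exact ⟨fun h => h.2, fun h => ⟨(FinDigraph.reachSet_spec h).1, h⟩⟩
  have hsep := hZ.isSeparation hR hAG
  -- At most `c` sources and `2 * c` sinks are needed, which fits the `3 * c` selectable terminals.
  obtain ⟨A', hA', hA'c, hA'Z⟩ := hZ.1.exists_small_source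
  obtain ⟨B', hB', hB'c, hB't⟩ := (hZ.isTight hR).exists_small_sink hsep
  have hdisj : Disjoint A' B' := Finset.disjoint_of_subset_left hA'
    (Finset.disjoint_of_subset_right hB' hAB)
  have hcard := Finset.card_union_le A' B'
  obtain ⟨p, hp, l, hl, e23, _, _, l0, l1, l2, l3⟩ :=
    exists_node h0 h12 h13 h23 hP hdisj (by omega) I.t le_rfl
  rw [← hT, Finset.inter_eq_left.2 (hA'.trans Finset.subset_union_left)] at l0
  rw [← hT, Finset.inter_eq_left.2 (hB'.trans Finset.subset_union_right)] at l1
  refine FinDigraph.subset_of_branching (N := fun D R k => ∃ p < s.reg 11, ∃ l, Path s p l ∧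
    s.arr 23 p = k ∧ select 0 l = A' ∧ select 1 l = B' ∧ select 2 l = D ∧ select 3 l = R)
    hB't { hsep with
      src := hA'.trans hsep.src
      snk := Finset.disjoint_of_subset_right hB' hsep.snk } hA'Z hc
    ⟨p, hp, l, hl, e23, l0, l1, l2, l3⟩ ?_
  rintro D R k ⟨p, hp, l, hl, rfl, rfl, rfl, rfl, rfl⟩ hex
  obtain ⟨l', hpr⟩ := hP p hp
  obtain rfl := hl.unique hpr.path
  obtain ⟨X, hXK, hX, hb⟩ := hpr.cut hex
  refine ⟨X, hXK, hX, fun hn hlt => ?_⟩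
  obtain ⟨x, hx, hch⟩ := hb hn hlt
  obtain ⟨p₂, g1, g2, g3⟩ := hch 2 (Or.inl rfl)
  obtain ⟨p₃, k1, k2, k3⟩ := hch 3 (Or.inr rfl)
  refine ⟨x, hx, ⟨p₂, g1, _, g2, g3, ?_, ?_, ?_, ?_⟩, ⟨p₃, k1, _, k2, k3, ?_, ?_, ?_, ?_⟩⟩ <;>
    first
    | exact select_cons_self _ _ _
    | exact select_cons_of_ne _ _ (by decide)

end

end RAM

namespace RAM

/-! ### The torso -/

/-- List the kept vertices, and prepare the searches. -/
def listVerts : Prog :=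
  .const 4 0;; .forLt 12 0 (.load 13 8 12;;
    .cond (.eq 13 7) (.store 3 4 12;; .succ 4 4;; .store 17 12 6) (.succ 13 12;; .store 17 12 13);;
    .store 16 12 6;; .store 14 12 6)

/-- Find the tails of the arcs of the torso into the vertex in register `30`. -/
def searchInto : Prog := clearVisited;; clearQueue;; .load 19 6 30;; scan;; bfs

/-- List the arcs of the torso into the vertex in register `30`. -/
def listArcsInto : Prog :=
  .forLt 12 0 (.load 13 18 12;; .load 14 8 12;;
    .cond (.eq 13 7) (.cond (.eq 14 7) (.store 4 5 12;; .store 5 5 30;; .succ 5 5) .skip) .skip)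

/-- List the arcs of the torso. -/
def listArcs : Prog :=
  .const 5 0;; .forLt 23 4 (.load 30 3 23;; searchInto;; listArcsInto)

/-- The searches expand exactly the vertices outside `K`. -/
structure TorsoPrep (I : Inst) (K : Finset ℕ) (s : State) : Prop where
  dead : ∀ v < I.n, s.arr 14 v = 0
  snk : ∀ v < I.n, s.arr 16 v = 0
  mate : ∀ v < I.n, s.arr 17 v = if v ∈ K then 0 else v + 1

theorem map_range_succ {β : Type*} {f g : ℕ → β} {r : ℕ} {x : β} (h : ∀ i < r, g i = f i)
    (hx : g r = x) : (List.range (r + 1)).map g = (List.range r).map f ++ [x] := by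
  rw [List.range_succ, List.map_append, List.map_singleton, hx]
  congr 1
  exact List.map_congr_left fun i hi => h i (List.mem_range.1 hi)

section

variable {I : Inst} {s : State} {K : Finset ℕ}

theorem exec_listVerts (hs : Stat I s) (hK : Keeps s K) :
    Exec listVerts s fun t s' => t ≤ 9 * I.n + 3 ∧ TorsoPrep I K s' ∧
      (List.range (s'.reg 4)).map (s'.arr 3) = (List.range I.n).filter (· ∈ K) := by
  unfold listVerts
  rw [exec_seq, exec_const]
  refine (exec_forLt (T := 7) (s := s.setReg 4 0) (N := I.n) (fun k s₁ =>
    (∀ v < k, s₁.arr 14 v = 0 ∧ s₁.arr 16 v = 0 ∧ s₁.arr 17 v = if v ∈ K then 0 else v + 1) ∧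
      (List.range (s₁.reg 4)).map (s₁.arr 3) = (List.range k).filter (· ∈ K))
    (by simp [hs.r0]) rfl rfl (by decide) (by simp) ?_).mono ?_
  · rintro k s₁ hk ⟨hJ, hL⟩ h12 hf
    have hs₁ : Stat I s₁ := (hs.setReg (x := 4) (k := 0) rfl).frame hf rfl
    have a8 : s₁.arr 8 k = if k ∈ K then 1 else 0 := by
      rw [hf.arr 8 rfl]; exact hK k
    simp only [exec_seq, exec_load, exec_cond, exec_store, exec_succ, holds_eq, State.reg_setReg,
      State.arr_setReg, State.reg_setArr, Nat.reduceEqDiff, if_true, if_false, hs₁.r6, hs₁.r7, h12,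
      a8]
    have hlt : ∀ v, v < k → v ≠ k := fun v hv => by omega
    refine ⟨fun h1 => ⟨by norm_num, ?_, ?_⟩, fun h1 => ⟨by norm_num, ?_, ?_⟩⟩
    · have hkK : k ∈ K := by by_contra h; simp [h] at h1
      intro v hv
      rcases Nat.lt_succ_iff_lt_or_eq.1 hv with hv | rfl
      · simpa [hlt v hv] using hJ v hv
      · simp [hkK]
    · have hkK : k ∈ K := by by_contra h; simp [h] at h1
      rw [List.range_succ (n := k), List.filter_append, ← hL]
      simp only [State.arr_setReg, State.arr_setArr, Nat.reduceEqDiff, if_true, if_false]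
      rw [map_range_succ (f := s₁.arr 3) (x := k) (fun i hi => ?_) (by simp)]
      · simp [hkK]
      · rw [Function.update_of_ne (by omega)]
    · have hkK : k ∉ K := fun h => by simp [h] at h1
      intro v hv
      rcases Nat.lt_succ_iff_lt_or_eq.1 hv with hv | rfl
      · simpa [hlt v hv] using hJ v hv
      · simp [hkK]
    · have hkK : k ∉ K := fun h => by simp [h] at h1
      rw [List.range_succ, List.filter_append, ← hL]
      simp [hkK]
  · rintro t s' ⟨ht, ⟨hJ, hL⟩, _⟩
    exact ⟨by omega, ⟨fun v hv => (hJ v hv).1, fun v hv => (hJ v hv).2.1,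
      fun v hv => (hJ v hv).2.2⟩, hL⟩

/-- The flow search serves as plain backward search: with the identity matching outside `K`, no
partner on `K` and no sinks, a visited vertex is expanded exactly if it lies outside `K`. The search
starts from the in-neighbours of `z` instead of `z`, so walks have at least one arc and may return
to `z`. -/
theorem exec_searchInto (hs : Stat I s) (h : TorsoPrep I K s) (hz : s.reg 30 < I.n) :
    Exec searchInto s fun t s' => t ≤ 40 * (I.n + I.m + 1) ∧
      ∀ w < I.n, s'.arr 18 w = 1 ↔ I.G.Through K w (s.reg 30) := by
  set z := s.reg 30 with hzd
  set Src : ℕ → Prop := fun w => (w, z) ∈ I.G.arcs with hSrc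
  unfold searchInto
  refine (exec_clearVisited hs).seq fun t₁ s₁ ⟨ht₁, hvis⟩ hf₁ => ?_
  have hs₁ : Stat I s₁ := hs.frame hf₁ rfl
  have hvis0 : ∀ v < I.n, s₁.arr 18 v = 0 := fun v hv => by rw [(hvis v hv).1, h.dead v hv]
  rw [exec_seq, exec_clearQueue, exec_seq, exec_load]
  generalize hS : State.setReg _ 19 _ = s₂
  have hs₂ : Stat I s₂ := by
    rw [← hS]
    exact ((((hs₁.setReg rfl).setReg rfl).setReg rfl).setReg rfl).setReg rfl
  have r16 : s₂.reg 16 = 0 := by rw [← hS]; simp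
  have r17 : s₂.reg 17 = 0 := by rw [← hS]; simp
  have r18 : s₂.reg 18 = 0 := by rw [← hS]; simp
  have r19 : s₂.reg 19 = I.hd z := by rw [← hS]; simp [hf₁.reg 30 rfl, hs₁.a6, hzd]
  have r20 : s₂.reg 20 = 0 := by rw [← hS]; simp
  have ea : s₂.arr = s₁.arr := by rw [← hS]; simp
  have a16 : s₂.arr 16 = s.arr 16 := by rw [ea, hf₁.arr 16 rfl]
  have a17 : s₂.arr 17 = s.arr 17 := by rw [ea, hf₁.arr 17 rfl]
  have hQ : QInv I (Finset.range I.n) Src s₂ := by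
    refine ⟨subset_rfl, fun v hv _ => Finset.mem_range.2 hv, ?_, ?_, fun v hv h1 => ?_, ?_, ?_⟩
    · simp [r17]
    · simp [r17]
    · rw [ea, hvis0 v hv] at h1; exact absurd h1 (by decide)
    · simp [r17]
    · simp [r17]
  have hL : ∀ w, w ∈ I.L z ↔ (w, z) ∈ I.G.arcs := I.mem_L z hz
  refine (exec_scan (I.L z) hs₂ hQ (r19 ▸ I.linked z hz) (fun w hw => I.fst_lt ((hL w).1 hw))
    fun w hw => Or.inl ⟨r18, (hL w).1 hw⟩).seq fun t₃ s₃ ⟨ht₃, hQ3, e23, hv3⟩ hf₃ => ?_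
  have hs₃ : Stat I s₃ := hs₂.frame hf₃ rfl
  have hm3 : s₃.arr 17 = s.arr 17 := by rw [e23.mate, a17]
  have mate_eq : ∀ v < I.n, ∀ u, s.arr 17 v = u + 1 → v ∉ K ∧ u = v := by
    intro v hv u hu
    rw [h.mate v hv] at hu
    split_ifs at hu with hvK
    exact ⟨hvK, by omega⟩
  have hB : BInv I (Finset.range I.n) Src s₃ := by
    have r16' : s₃.reg 16 = 0 := by rw [hf₃.reg 16 rfl, r16]
    refine ⟨hQ3, by omega, ?_, ?_, ?_, ?_, ?_⟩
    · rw [hm3]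
      intro v hv v' hv' he hne
      obtain ⟨u, hu⟩ := Nat.exists_eq_succ_of_ne_zero hne
      have h1 := mate_eq v (Finset.mem_range.1 hv) u hu
      have h2 := mate_eq v' (Finset.mem_range.1 hv') u (he ▸ hu)
      omega
    · rw [hm3]
      intro v hv u hu
      rw [Finset.mem_range] at hv
      have := mate_eq v hv u hu
      omega
    · rw [r16']; intro i hi; omega
    · intro u hu hne
      rw [hf₃.arr 21 rfl, ea] at hne
      exact absurd (hvis u hu).2 hne
    · rw [hf₃.reg 20 rfl, r20]; intro h; exact absurd rfl h
  refine (exec_bfs hs₃ hB).frame.mono ?_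
  rintro t₄ s₄ ⟨⟨ht₄, hB4, hq4, e34⟩, hf₄⟩
  have hm4 : s₄.arr 17 = s.arr 17 := by rw [e34.mate, hm3]
  have hone : ∀ v < I.n, s₄.arr 18 v ≠ 0 → s₄.arr 18 v = 1 := by
    intro v hv hne
    have h0 : s₂.arr 18 v = 0 := by rw [ea, hvis0 v hv]
    have := (e23.trans' e34).vis v
    omega
  have hlen : (I.L z).length ≤ I.m :=
    (Finset.single_le_sum (f := fun v => (I.L v).length) (fun _ _ => Nat.zero_le _)
      (Finset.mem_range.2 hz)).trans I.sum_L
  refine ⟨by omega, fun w hw => ⟨fun h1 => ?_, fun h1 => ?_⟩⟩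
  · have key : ∀ i < s₄.reg 17, I.G.Through K (s₄.arr 19 i) z := by
      intro i
      induction i using Nat.strong_induction_on with
      | _ i ih =>
        intro hi
        rcases hB4.par i hi with ⟨_, hsrc⟩ | ⟨j, hj, u, _, h2, h3⟩
        · exact ⟨_, .refl, hsrc⟩
        · rw [hm4] at h2
          have hjq : j < s₄.reg 17 := by omega
          obtain ⟨hnK, rfl⟩ := mate_eq _ (Finset.mem_range.1 (hB4.mem j hjq)) u h2
          have hth := ih j hj hjq
          rcases h3 with h3 | h3
          · rwa [← h3]
          · obtain ⟨v, g1, g2⟩ := hth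
            exact ⟨v, .head ⟨h3, hnK⟩ g1, g2⟩
    obtain ⟨i, hi, rfl⟩ := hB4.ex w hw h1
    exact key i hi
  · obtain ⟨v, hwv, hvz⟩ := h1
    refine hone w hw ?_
    clear hw
    induction hwv using Relation.ReflTransGen.head_induction_on with
    | refl => exact e34.vis_ne (hv3 v ((hL v).2 hvz))
    | @head a b hab _ ih =>
      have hbn := I.snd_lt hab.1
      obtain ⟨i, hi, hib⟩ := hB4.ex b hbn (hone b hbn ih)
      have hmb : s₄.arr 17 (s₄.arr 19 i) = b + 1 := by
        rw [hib, hm4, h.mate b hbn, if_neg hab.2]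
      rcases hB4.proc i (by omega) b hmb with ⟨h1, _⟩ | ⟨_, _, _, h4⟩
      · rw [hf₄.arr 16 rfl, hf₃.arr 16 rfl, a16, h.snk b hbn] at h1
        exact absurd h1 (by decide)
      · exact h4 a hab.1

/-- The arcs listed so far. -/
def arcList (s : State) : List (ℕ × ℕ) :=
  (List.range (s.reg 5)).map fun i => (s.arr 4 i, s.arr 5 i)

theorem exec_listArcsInto (hs : Stat I s) (hK : Keeps s K) :
    Exec listArcsInto s fun t s' => t ≤ 9 * I.n + 2 ∧ arcList s' = arcList s ++
      ((List.range I.n).filter fun w => w ∈ K ∧ s.arr 18 w = 1).map fun w => (w, s.reg 30) := by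
  unfold listArcsInto
  refine (exec_forLt (T := 7) (N := I.n) (fun k s₁ => arcList s₁ = arcList s ++
      ((List.range k).filter fun w => w ∈ K ∧ s.arr 18 w = 1).map fun w => (w, s.reg 30))
    hs.r0 rfl rfl (by decide) (by simp [arcList]) ?_).mono ?_
  · intro k s₁ hk hJ h12 hf
    have hs₁ : Stat I s₁ := hs.frame hf rfl
    have a8 : s₁.arr 8 k = if k ∈ K then 1 else 0 := by
      rw [hf.arr 8 rfl]; exact hK k
    have a18 : s₁.arr 18 k = s.arr 18 k := by rw [hf.arr 18 rfl]
    have r30 : s₁.reg 30 = s.reg 30 := hf.reg 30 rfl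
    simp only [exec_seq, exec_load, exec_cond, exec_store, exec_succ, exec_skip, holds_eq,
      State.reg_setReg, State.arr_setReg, State.reg_setArr, Nat.reduceEqDiff, if_true, if_false,
      hs₁.r7, h12, a8, a18]
    refine ⟨fun h1 => ⟨fun h2 => ⟨by norm_num, ?_⟩, fun h2 => ⟨by norm_num, ?_⟩⟩,
      fun h1 => ⟨by norm_num, ?_⟩⟩
    · have hkK : k ∈ K := by by_contra h; simp [h] at h2
      rw [List.range_succ, List.filter_append, List.map_append, ← List.append_assoc, ← hJ]
      unfold arcList
      simp only [State.reg_setReg, State.reg_setArr, State.arr_setReg, State.arr_setArr,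
        Nat.reduceEqDiff, if_true, if_false]
      rw [map_range_succ (f := fun i => (s₁.arr 4 i, s₁.arr 5 i)) (x := (k, s.reg 30))
        (fun i hi => ?_) (by simp [r30])]
      · simp [hkK, h1]
      · rw [Function.update_of_ne (by omega), Function.update_of_ne (by omega)]
    · have hkK : k ∉ K := fun h => by simp [h] at h2
      rw [List.range_succ, List.filter_append, List.map_append, ← List.append_assoc, ← hJ]
      simp [hkK, arcList]
    · rw [List.range_succ, List.filter_append, List.map_append, ← List.append_assoc, ← hJ]
      simp [h1, arcList]
  · rintro t s' ⟨ht, hJ, _⟩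
    exact ⟨by omega, hJ⟩

/-- Different searches contribute arcs with different heads and each search lists every tail once,
so no arc is repeated. -/
theorem exec_listArcs (hs : Stat I s) (hK : Keeps s K) (hKn : K ⊆ Finset.range I.n)
    (h : TorsoPrep I K s)
    (hL : (List.range (s.reg 4)).map (s.arr 3) = (List.range I.n).filter (· ∈ K)) :
    Exec listArcs s fun t s' => t ≤ K.card * (60 * (I.n + I.m + 1)) + 3 ∧
      (arcList s').Nodup ∧
      ∀ w z, (w, z) ∈ arcList s' ↔ w ∈ K ∧ z ∈ K ∧ I.G.Through K w z := by
  have hfin : ((List.range I.n).filter (· ∈ K)).toFinset = K := by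
    ext v
    simp only [List.mem_toFinset, List.mem_filter, List.mem_range, decide_eq_true_eq]
    exact ⟨fun h => h.2, fun h => ⟨Finset.mem_range.1 (hKn h), h⟩⟩
  have hnd : ((List.range I.n).filter (· ∈ K)).Nodup := List.nodup_range.filter _
  have h4 : s.reg 4 = K.card := by
    have := List.toFinset_card_of_nodup hnd
    rw [hfin, ← hL] at this
    simpa using this.symm
  have hnd' := hnd
  rw [← hL] at hnd'
  have hinj : ∀ i < K.card, ∀ j < K.card, s.arr 3 i = s.arr 3 j → i = j := by
    intro i hi j hj he
    exact List.inj_on_of_nodup_map hnd' (by simp [h4, hi]) (by simp [h4, hj]) he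
  have hmem : ∀ z, z ∈ K ↔ ∃ i < K.card, s.arr 3 i = z := by
    intro z
    have : z ∈ K ↔ z ∈ (List.range (s.reg 4)).map (s.arr 3) := by
      rw [hL, ← List.mem_toFinset, hfin]
    rw [this, List.mem_map]
    simp only [List.mem_range, h4]
  unfold listArcs
  rw [exec_seq, exec_const]
  refine (exec_forLt (T := 60 * (I.n + I.m + 1) - 2) (s := s.setReg 5 0) (N := K.card)
    (fun k s₁ => (arcList s₁).Nodup ∧ ∀ w z, (w, z) ∈ arcList s₁ ↔
      w ∈ K ∧ (∃ i < k, s.arr 3 i = z) ∧ I.G.Through K w z)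
    (by simp [h4]) rfl rfl (by decide) (by simp [arcList]) ?_).mono ?_
  · rintro k s₁ hk ⟨hN, hM⟩ h23 hf
    have hs₁ : Stat I s₁ := (hs.setReg (x := 5) (k := 0) rfl).frame hf rfl
    have a3 : s₁.arr 3 = s.arr 3 := hf.arr 3 rfl
    rw [exec_seq, exec_load, h23, a3]
    set z := s.arr 3 k with hz
    have hzK : z ∈ K := (hmem z).2 ⟨k, hk, rfl⟩
    have hzn := Finset.mem_range.1 (hKn hzK)
    generalize hS : State.setReg _ 30 _ = s₂
    have hs₂ : Stat I s₂ := by rw [← hS]; exact hs₁.setReg rfl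
    have r30 : s₂.reg 30 = z := by rw [← hS]; simp
    have hl2 : arcList s₂ = arcList s₁ := by rw [← hS]; simp [arcList]
    have ea : s₂.arr = s₁.arr := by rw [← hS]; simp
    have hp2 : TorsoPrep I K s₂ := by
      refine ⟨?_, ?_, ?_⟩
      · rw [ea, hf.arr 14 rfl]; exact h.dead
      · rw [ea, hf.arr 16 rfl]; exact h.snk
      · rw [ea, hf.arr 17 rfl]; exact h.mate
    refine (exec_searchInto hs₂ hp2 (r30 ▸ hzn)).seq fun t₃ s₃ ⟨ht₃, hth⟩ hf₃ => ?_
    have hs₃ : Stat I s₃ := hs₂.frame hf₃ rfl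
    have hl3 : arcList s₃ = arcList s₁ := by
      rw [← hl2]; unfold arcList; rw [hf₃.reg 5 rfl, hf₃.arr 4 rfl, hf₃.arr 5 rfl]
    have hK3 : Keeps s₃ K := by
      intro v; rw [hf₃.arr 8 rfl, ea, hf.arr 8 rfl]; exact hK v
    refine (exec_listArcsInto hs₃ hK3).mono fun t₄ s₄ ⟨ht₄, hl4⟩ => ?_
    have hl5 : arcList (s₄.setReg 23 (k + 1)) = arcList s₄ := by simp [arcList]
    rw [hl5, hl4, hl3, hf₃.reg 30 rfl, r30]
    rw [r30] at hth
    have hfil : ∀ w, w ∈ (List.range I.n).filter (fun w => w ∈ K ∧ s₃.arr 18 w = 1) ↔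
        w ∈ K ∧ I.G.Through K w z := by
      intro w
      simp only [List.mem_filter, List.mem_range, decide_eq_true_eq]
      constructor
      · rintro ⟨h1, h2, h3⟩; exact ⟨h2, (hth w h1).1 h3⟩
      · rintro ⟨h1, h2⟩
        have hw := Finset.mem_range.1 (hKn h1)
        exact ⟨hw, h1, (hth w hw).2 h2⟩
    refine ⟨by omega, ?_, ?_⟩
    · refine List.Nodup.append hN ((List.nodup_range.filter _).map fun a b hab => ?_) ?_
      · exact (Prod.ext_iff.1 hab).1
      · rintro ⟨w, y⟩ h1 h2
        obtain ⟨w', _, hw'⟩ := List.mem_map.1 h2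
        obtain ⟨_, ⟨i, hi, hiy⟩, _⟩ := (hM w y).1 h1
        have : z = y := (Prod.ext_iff.1 hw').2
        have := hinj i (by omega) k hk (by rw [hiy, ← hz, this])
        omega
    · intro w y
      rw [List.mem_append, hM, List.mem_map]
      constructor
      · rintro (⟨h1, ⟨i, hi, hiy⟩, h3⟩ | ⟨w', h1, h2⟩)
        · exact ⟨h1, ⟨i, by omega, hiy⟩, h3⟩
        · obtain ⟨rfl, rfl⟩ := Prod.ext_iff.1 h2
          have := (hfil _).1 h1
          exact ⟨this.1, ⟨k, by omega, rfl⟩, this.2⟩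
      · rintro ⟨h1, ⟨i, hi, hiy⟩, h3⟩
        rcases Nat.lt_succ_iff_lt_or_eq.1 hi with hi | rfl
        · exact Or.inl ⟨h1, ⟨i, hi, hiy⟩, h3⟩
        · refine Or.inr ⟨w, (hfil w).2 ⟨h1, ?_⟩, by rw [hz, hiy]⟩
          rw [hz, hiy]; exact h3
  · rintro t s' ⟨ht, ⟨hN, hM⟩, _⟩
    refine ⟨?_, hN, fun w z => ?_⟩
    · have : 60 * (I.n + I.m + 1) - 2 + 2 = 60 * (I.n + I.m + 1) := by omega
      rw [this] at ht
      omega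
    · rw [hM, hmem z]

/-- Compute the torso on the kept vertices. -/
def torso : Prog := listVerts;; listArcs

theorem exec_torso (hs : Stat I s) (hK : Keeps s K) (hKG : K ⊆ I.G.verts) :
    Exec torso s fun t s' => t ≤ (K.card + 1) * (60 * (I.n + I.m + 1)) ∧
      ∃ H, Outputs s' H ∧ I.G.IsTorso K H := by
  have hKn : K ⊆ Finset.range I.n := I.verts ▸ hKG
  unfold torso
  refine (exec_listVerts hs hK).seq fun t₁ s₁ ⟨ht₁, hp, hL⟩ hf₁ => ?_
  have hs₁ : Stat I s₁ := hs.frame hf₁ rfl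
  have hK₁ : Keeps s₁ K := by intro v; rw [hf₁.arr 8 rfl]; exact hK v
  refine (exec_listArcs hs₁ hK₁ hKn hp hL).frame.mono ?_
  rintro t₂ s₂ ⟨⟨ht₂, hN, hM⟩, hf₂⟩
  have hfin : ((List.range I.n).filter (· ∈ K)).toFinset = K := by
    ext v
    simp only [List.mem_toFinset, List.mem_filter, List.mem_range, decide_eq_true_eq]
    exact ⟨fun h => h.2, fun h => ⟨Finset.mem_range.1 (hKn h), h⟩⟩
  refine ⟨?_, ⟨K, (arcList s₂).toFinset, fun e he => ?_, fun e he => ?_⟩, ⟨?_, ?_, hN, rfl⟩,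
    hKG, rfl, fun w z => ?_⟩
  · rw [add_mul]; omega
  · exact ((hM e.1 e.2).1 (List.mem_toFinset.1 he)).1
  · exact ((hM e.1 e.2).1 (List.mem_toFinset.1 he)).2.1
  · rw [hf₂.reg 4 rfl, hf₂.arr 3 rfl, hL]; exact List.nodup_range.filter _
  · rw [hf₂.reg 4 rfl, hf₂.arr 3 rfl, hL]; exact hfin
  · rw [List.mem_toFinset, hM]

end

end RAM

namespace RAM

/-! ### Initialization -/

/-- Compute `3 * c` and `2 * c`. -/
def setBounds : Prog :=
  .forLt 12 3 (.succ 8 8;; .succ 8 8;; .succ 8 8;; .succ 9 9;; .succ 9 9)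

/-- Build the linked lists of incoming arcs. -/
def buildLists : Prog :=
  .forLt 12 1 (.load 13 1 12;; .load 14 6 13;; .store 7 12 14;; .succ 14 12;; .store 6 13 14)

/-- Keep the terminals. -/
def keepTerminals : Prog := .forLt 12 2 (.load 13 2 12;; .store 8 13 7)

/-- Initialize the constants, the linked lists, the set of kept vertices and the search tree. -/
def setUp : Prog :=
  .const 7 1;; .const 29 2;; .const 31 3;; .const 11 1;; setBounds;; buildLists;; keepTerminals

/-- The arcs among the first `k` ones with head `v`, the last one first. -/
def items (hv : ℕ → ℕ) (k v : ℕ) : List ℕ := ((List.range k).filter fun e => hv e = v).reverse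

theorem items_succ (hv : ℕ → ℕ) (k v : ℕ) :
    items hv (k + 1) v = if hv k = v then k :: items hv k v else items hv k v := by
  unfold items
  rw [List.range_succ, List.filter_append, List.reverse_append]
  split_ifs with h <;> simp [h]

theorem mem_items {hv : ℕ → ℕ} {k v e : ℕ} : e ∈ items hv k v ↔ e < k ∧ hv e = v := by
  simp [items]

theorem sum_length_items_le (hv : ℕ → ℕ) (n k : ℕ) :
    ∑ v ∈ Finset.range n, (items hv k v).length ≤ k := by
  induction k with
  | zero => simp [items]
  | succ k ih =>
    have : ∀ v, (items hv (k + 1) v).length =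
        (items hv k v).length + if hv k = v then 1 else 0 := by
      intro v
      rw [items_succ]
      split_ifs <;> simp
    simp only [this, Finset.sum_add_distrib, Finset.sum_ite_eq]
    split_ifs <;> omega

/-- Inserting arc `k` at the front of one list overwrites only the pointer at `k`, which no list
uses yet. -/
theorem Linked.update {nx : ℕ → ℕ} {p : ℕ} {l : List ℕ} (h : Linked nx id p l) {k x : ℕ}
    (hk : k ∉ l) : Linked (Function.update nx k x) id p l := by
  induction l generalizing p with
  | nil => exact h
  | cons w l ih =>
    obtain ⟨e, rfl, rfl, h⟩ := h
    simp only [id_eq, List.mem_cons, not_or] at hk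
    refine ⟨e, rfl, rfl, ?_⟩
    rw [Function.update_of_ne (Ne.symm hk.1)]
    exact ih h hk.2

theorem Linked.map {nx : ℕ → ℕ} {p : ℕ} {l : List ℕ} (h : Linked nx id p l) (tl : ℕ → ℕ) :
    Linked nx tl p (l.map tl) := by
  induction l generalizing p with
  | nil => exact h
  | cons w l ih =>
    obtain ⟨e, rfl, rfl, h⟩ := h
    exact ⟨e, rfl, rfl, ih h⟩

section

variable {s : State}

theorem exec_setBounds (h8 : s.reg 8 = 0) (h9 : s.reg 9 = 0) :
    Exec setBounds s fun t s' => t ≤ 7 * s.reg 3 + 2 ∧ s'.reg 8 = 3 * s.reg 3 ∧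
      s'.reg 9 = 2 * s.reg 3 := by
  refine (exec_forLt (T := 5) (fun k s₁ => s₁.reg 8 = 3 * k ∧ s₁.reg 9 = 2 * k) rfl rfl rfl
    (by decide) (by simp [h8, h9]) ?_).mono ?_
  · rintro k s₁ _ ⟨h1, h2⟩ _ _
    simp [h1, h2]
    omega
  · rintro t s' ⟨ht, h, _⟩
    exact ⟨by omega, h⟩

theorem exec_buildLists (h6 : ∀ v, s.arr 6 v = 0) :
    Exec buildLists s fun t s' => t ≤ 7 * s.reg 1 + 2 ∧
      ∀ v, Linked (s'.arr 7) id (s'.arr 6 v) (items (s.arr 1) (s.reg 1) v) := by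
  refine (exec_forLt (T := 5) (fun k s₁ => ∀ v, Linked (s₁.arr 7) id (s₁.arr 6 v)
    (items (s.arr 1) k v)) rfl rfl rfl (by decide) (fun v => by simp [items, Linked, h6])
    ?_).mono ?_
  · intro k s₁ _ hJ h12 hf
    have a1 : s₁.arr 1 = s.arr 1 := hf.arr 1 rfl
    simp only [exec_seq, exec_load, exec_store, exec_succ, State.reg_setReg, State.arr_setReg,
      State.reg_setArr, Nat.reduceEqDiff, if_true, if_false, h12, a1]
    refine ⟨by norm_num, fun v => ?_⟩
    simp only [State.arr_setReg, State.arr_setArr, Nat.reduceEqDiff, if_true, if_false]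
    have hup := fun v => (hJ v).update (k := k) (x := s₁.arr 6 (s.arr 1 k))
      fun h => by have := mem_items.1 h; omega
    rw [items_succ]
    split_ifs with hv
    · rw [← hv, Function.update_self]
      refine ⟨k, rfl, rfl, ?_⟩
      rw [Function.update_self]
      exact hup _
    · rw [Function.update_of_ne (Ne.symm hv)]
      exact hup v
  · rintro t s' ⟨ht, h, _⟩
    exact ⟨by omega, h⟩

theorem exec_keepTerminals (h7 : s.reg 7 = 1) (h8 : ∀ v, s.arr 8 v = 0) :
    Exec keepTerminals s fun t s' => t ≤ 4 * s.reg 2 + 2 ∧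
      Keeps s' ((Finset.range (s.reg 2)).image (s.arr 2)) := by
  refine (exec_forLt (T := 2) (fun k s₁ => Keeps s₁ ((Finset.range k).image (s.arr 2))) rfl rfl rfl
    (by decide) (fun v => by simp [h8]) ?_).mono ?_
  · intro k s₁ _ hJ h12 hf
    have a2 : s₁.arr 2 = s.arr 2 := hf.arr 2 rfl
    have r7 : s₁.reg 7 = 1 := (hf.reg 7 rfl).trans h7
    simp only [exec_seq, exec_load, exec_store, State.reg_setReg, Nat.reduceEqDiff, if_true,
      if_false, h12, a2, r7]
    refine ⟨by norm_num, fun v => ?_⟩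
    have := hJ v
    simp only [State.arr_setReg, State.arr_setArr, if_true]
    rw [Finset.range_add_one, Finset.image_insert, Function.update_apply, this]
    by_cases h1 : v = s.arr 2 k
    · simp [h1]
    · simp [Finset.mem_insert, h1]
  · rintro t s' ⟨ht, h, _⟩
    exact ⟨by omega, h⟩

end

section

variable {n c : ℕ} {G : FinDigraph ℕ} {T : Finset ℕ} {es : List (ℕ × ℕ)} {ts : List ℕ}

theorem inputState_arcs (he : es.toFinset = G.arcs) (u v : ℕ) : (u, v) ∈ G.arcs ↔
    ∃ e < es.length, (inputState n es ts c).arr 0 e = u ∧ (inputState n es ts c).arr 1 e = v := by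
  rw [← he, List.mem_toFinset, List.mem_iff_getElem]
  refine exists_congr fun e => ⟨fun ⟨h, hh⟩ => ⟨h, ?_⟩, fun ⟨h, hh⟩ => ⟨h, ?_⟩⟩
  · simp [inputState, h, hh]
  · simp only [inputState, List.getD_eq_getElem?_getD, List.getElem?_map, h,
      List.getElem?_eq_getElem, Option.map_some, Option.getD_some] at hh
    exact Prod.ext hh.1 hh.2

theorem inputState_terminal {i : ℕ} (h : i < ts.length) :
    (inputState n es ts c).arr 2 i = ts[i] := by
  simp [inputState, h]

theorem image_terminals (ht : ts.toFinset = T) :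
    (Finset.range ts.length).image ((inputState n es ts c).arr 2) = T := by
  ext v
  rw [← ht, List.mem_toFinset, List.mem_iff_getElem, Finset.mem_image]
  constructor
  · rintro ⟨i, hi, rfl⟩
    exact ⟨i, Finset.mem_range.1 hi, (inputState_terminal (Finset.mem_range.1 hi)).symm⟩
  · rintro ⟨i, hi, rfl⟩
    exact ⟨i, Finset.mem_range.2 hi, inputState_terminal hi⟩

theorem exec_setUp (hV : G.verts = Finset.range n) (hT : T ⊆ G.verts)
    (he : es.toFinset = G.arcs) (hnd : ts.Nodup) (ht : ts.toFinset = T) :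
    Exec setUp (inputState n es ts c) fun t s => t ≤ 7 * c + 7 * es.length + 4 * ts.length + 10 ∧
      ∃ I : Inst, I.n = n ∧ I.m = es.length ∧ I.t = ts.length ∧ I.c = c ∧ I.G = G ∧
        I.terms I.t = T ∧ Stat I s ∧ Keeps s T ∧ s.reg 10 = 0 ∧ s.reg 11 = 1 ∧
        s.arr 9 0 = 0 ∧ s.arr 12 0 = 0 ∧ s.arr 13 0 = 0 ∧ s.arr 23 0 = 0 := by
  set s₀ := inputState n es ts c with hs₀
  unfold setUp
  simp only [exec_seq, exec_const]
  generalize hS : State.setReg _ 11 1 = s₁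
  have q7 : s₁.reg 7 = 1 := by rw [← hS]; simp
  have q11 : s₁.reg 11 = 1 := by rw [← hS]; simp
  have q29 : s₁.reg 29 = 2 := by rw [← hS]; simp
  have q31 : s₁.reg 31 = 3 := by rw [← hS]; simp
  have q : ∀ x, x ≠ 7 → x ≠ 11 → x ≠ 29 → x ≠ 31 → s₁.reg x = s₀.reg x := by
    intro x h1 h2 h3 h4
    rw [← hS]; simp [h1, h2, h3, h4]
  have ea : s₁.arr = s₀.arr := by rw [← hS]; simp
  have q3 : s₁.reg 3 = c := q 3 (by decide) (by decide) (by decide) (by decide)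
  refine (exec_setBounds (q 8 (by decide) (by decide) (by decide) (by decide))
    (q 9 (by decide) (by decide) (by decide) (by decide))).frame.mono ?_
  rintro t₂ s₂ ⟨⟨ht₂, h8, h9⟩, hf₂⟩
  have a2 : ∀ a, s₂.arr a = s₀.arr a := fun a => by rw [hf₂.arr a rfl, ea]
  have q1 : s₂.reg 1 = es.length := by
    rw [hf₂.reg 1 rfl]; exact q 1 (by decide) (by decide) (by decide) (by decide)
  refine (exec_buildLists fun v => by rw [a2]; rfl).frame.mono ?_
  rintro t₃ s₃ ⟨⟨ht₃, hL⟩, hf₃⟩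
  rw [q1, a2] at hL
  have q2 : s₃.reg 2 = ts.length := by
    rw [hf₃.reg 2 rfl, hf₂.reg 2 rfl]; exact q 2 (by decide) (by decide) (by decide) (by decide)
  have a32 : s₃.arr 2 = s₀.arr 2 := by rw [hf₃.arr 2 rfl, a2]
  refine (exec_keepTerminals (by rw [hf₃.reg 7 rfl, hf₂.reg 7 rfl, q7])
    fun v => by rw [hf₃.arr 8 rfl, a2]; rfl).frame.mono ?_
  rintro t₄ s₄ ⟨⟨ht₄, hK⟩, hf₄⟩
  rw [q2, a32, image_terminals ht] at hK
  have r : ∀ x, keepTerminals.writesReg x = false → buildLists.writesReg x = false →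
      setBounds.writesReg x = false → s₄.reg x = s₁.reg x := fun x h1 h2 h3 => by
    rw [hf₄.reg x h1, hf₃.reg x h2, hf₂.reg x h3]
  have a : ∀ x, keepTerminals.writesArr x = false → buildLists.writesArr x = false →
      s₄.arr x = s₀.arr x := fun x h1 h2 => by
    rw [hf₄.arr x h1, hf₃.arr x h2, a2]
  refine ⟨by omega, ⟨n, es.length, ts.length, c, G, s₀.arr 0, s₀.arr 1, s₀.arr 2, s₃.arr 6,
    s₃.arr 7, fun v => (items (s₀.arr 1) es.length v).map (s₀.arr 0), hV, inputState_arcs he,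
    fun v _ => (hL v).map _, fun v _ w => ?_, ?_, fun i hi => ?_, fun i hi j hj hij => ?_⟩,
    rfl, rfl, rfl, rfl, rfl, image_terminals ht (n := n) (es := es) (c := c), ?_, hK, ?_, ?_, ?_,
    ?_, ?_, ?_⟩
  · rw [inputState_arcs he (n := n) (ts := ts) (c := c), List.mem_map]
    simp only [mem_items]
    exact exists_congr fun e => by tauto
  · simpa using sum_length_items_le (s₀.arr 1) n es.length
  · have : s₀.arr 2 i ∈ T := by
      rw [← image_terminals ht (n := n) (es := es) (c := c)]
      exact Finset.mem_image_of_mem _ (Finset.mem_range.2 hi)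
    simpa [hV] using hT this
  · rw [hs₀, inputState_terminal hi, inputState_terminal hj] at hij
    exact (hnd.getElem_inj_iff).1 hij
  · constructor
    · exact (r 0 rfl rfl rfl).trans (q 0 (by decide) (by decide) (by decide) (by decide))
    · exact (r 1 rfl rfl rfl).trans (q 1 (by decide) (by decide) (by decide) (by decide))
    · exact (r 2 rfl rfl rfl).trans (q 2 (by decide) (by decide) (by decide) (by decide))
    · exact (r 3 rfl rfl rfl).trans q3
    · exact (r 6 rfl rfl rfl).trans (q 6 (by decide) (by decide) (by decide) (by decide))
    · exact (r 7 rfl rfl rfl).trans q7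
    · rw [hf₄.reg 8 rfl, hf₃.reg 8 rfl, h8, q3]
    · rw [hf₄.reg 9 rfl, hf₃.reg 9 rfl, h9, q3]
    · exact (r 29 rfl rfl rfl).trans q29
    · exact (r 31 rfl rfl rfl).trans q31
    · exact a 0 rfl rfl
    · exact a 1 rfl rfl
    · exact a 2 rfl rfl
    · exact hf₄.arr 6 rfl
    · exact hf₄.arr 7 rfl
  · exact (r 10 rfl rfl rfl).trans (q 10 (by decide) (by decide) (by decide) (by decide))
  · exact (r 11 rfl rfl rfl).trans q11
  · rw [a 9 rfl rfl]; rfl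
  · rw [a 12 rfl rfl]; rfl
  · rw [a 13 rfl rfl]; rfl
  · rw [a 23 rfl rfl]; rfl

/-! ### The algorithm -/

/-- The algorithm. -/
def sparsify : Prog := .cond (.eq 2 6) .skip (setUp;; grow;; torso)

theorem exec_sparsify_of_nonempty (hV : G.verts = Finset.range n) (hT : T ⊆ G.verts)
    (he : es.toFinset = G.arcs) (hnd : ts.Nodup) (ht : ts.toFinset = T) (hne : T.Nonempty)
    {W : ℕ} (hW : W = termWeight (branchWeight (2 * c)) (3 * c) ts.length) :
    Exec sparsify (inputState n es ts c) fun t s =>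
      t ≤ 7 * c + 7 * es.length + 4 * ts.length + 12 +
        250 * (c + 1) * (n + es.length + 1) * W +
        (T.card + c * W + 1) * (60 * (n + es.length + 1)) ∧
      ∃ H K, Outputs s H ∧ G.IsTorso K H ∧ T ⊆ K ∧ K.card ≤ T.card + c * W ∧
        ∀ A B Z, Disjoint A B → A ∪ B = T → G.IsImportantSeparator A B Z → Z.card ≤ c → Z ⊆ K := by
  unfold sparsify
  have hts : ts ≠ [] := by
    rintro rfl
    rw [← ht] at hne
    simp at hne
  refine exec_cond_false ?_ ?_
  · rw [holds_eq]
    exact fun h => hts (List.length_eq_zero_iff.1 h)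
  refine (exec_setUp hV hT he hnd ht).seq ?_
  rintro t₁ s₁ ⟨ht₁, I, rfl, hm, htt, rfl, rfl, rfl, hs₁, hK₁, h10, h11, h9, h12, h13, h23⟩ -
  have hTree : TreeInv I s₁ := by
    refine ⟨by omega, ?_, ?_, ?_, ?_⟩ <;> intro p hp <;> obtain rfl : p = 0 := by omega
    · omega
    · exact ⟨[], rfl, Nat.zero_le _⟩
    · omega
    · omega
  have hw : weight I s₁ 0 = W := by
    unfold weight
    rw [h23, if_pos rfl, h12, h13, Nat.sub_zero, Nat.sub_zero, hW, htt]
  refine (exec_grow hs₁ hTree h10 h11 hK₁ I.terms_subset).seq ?_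
  rintro t₂ s₂ ⟨ht₂, hT₂, hx, K, hKT, hKG, hcard, hK₂, hproc⟩ hf₂
  rw [hw] at ht₂ hcard
  have hs₂ : Stat I s₂ := hs₁.frame hf₂ rfl
  refine (exec_torso hs₂ hK₂ hKG).mono ?_
  rintro t₃ s₃ ⟨ht₃, H, hH, htor⟩
  refine ⟨?_, H, K, hH, htor, hKT, hcard, fun A B Z hd hu hZ hc => ?_⟩
  · have h1 : (K.card + 1) * (60 * (I.n + I.m + 1)) ≤
        ((I.terms I.t).card + I.c * W + 1) * (60 * (I.n + I.m + 1)) :=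
      Nat.mul_le_mul_right _ (by omega)
    rw [← hm]
    omega
  · have hlt : 0 < s₁.reg 11 := by omega
    refine subset_of_isImportantSeparator hT₂.npos ?_ ?_ ?_ hproc hd hu hZ hc
    · rw [hx.arr 12 (by decide) 0 hlt, h12]
    · rw [hx.arr 13 (by decide) 0 hlt, h13]
    · rw [hx.arr 23 (by decide) 0 hlt, h23]

end

end RAM

/-! ### Bounds -/

theorem le_chooseLE (t : ℕ) {a : ℕ} (ha : 1 ≤ a) : t ≤ chooseLE t a := by
  unfold chooseLE
  have := Finset.single_le_sum (f := fun i => t.choose i) (fun _ _ => Nat.zero_le _)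
    (Finset.mem_Icc.2 ⟨le_rfl, ha⟩)
  simpa using this

/-- The factors are `2 ^ (2 * c + 1)` for branching, `2 ^ (3 * c)` for labels, and `2` to absorb the
empty selection, which `chooseLE` omits; the last needs `t ≥ 1`. Finally `5 * c + 2 ≤ 7 * c`. -/
theorem termWeight_le_chooseLE {t c : ℕ} (hc : 1 ≤ c) (ht : 1 ≤ t) :
    RAM.termWeight (RAM.branchWeight (2 * c)) (3 * c) t ≤ chooseLE t (3 * c) * 2 ^ (7 * c) := by
  have hS := le_chooseLE t (a := 3 * c) (by omega)
  have h1 : ∑ i ∈ Finset.range (3 * c + 1), 2 ^ i * t.choose i ≤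
      2 ^ (3 * c) * (2 * chooseLE t (3 * c)) := by
    have h2 : ∑ i ∈ Finset.range (3 * c + 1), t.choose i = chooseLE t (3 * c) + 1 := by
      rw [Finset.sum_range_succ', chooseLE, Nat.choose_zero_right, Finset.range_eq_Ico,
        Finset.sum_Ico_add' (fun i => t.choose i) 0 (3 * c) 1]
      rfl
    calc _ ≤ ∑ i ∈ Finset.range (3 * c + 1), 2 ^ (3 * c) * t.choose i :=
          Finset.sum_le_sum fun i hi => Nat.mul_le_mul_right _
            (Nat.pow_le_pow_right (by decide) (by have := Finset.mem_range.1 hi; omega))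
      _ = 2 ^ (3 * c) * (chooseLE t (3 * c) + 1) := by rw [← Finset.mul_sum, h2]
      _ ≤ _ := Nat.mul_le_mul_left _ (by omega)
  have hb : RAM.branchWeight (2 * c) ≤ 2 ^ (2 * c + 1) := by
    have := RAM.branchWeight_le (2 * c); omega
  calc _ ≤ _ := RAM.termWeight_le _ _ _
    _ ≤ 2 ^ (2 * c + 1) * (2 ^ (3 * c) * (2 * chooseLE t (3 * c))) := Nat.mul_le_mul hb h1
    _ = chooseLE t (3 * c) * 2 ^ (5 * c + 2) := by ring
    _ ≤ _ := Nat.mul_le_mul_left _ (Nat.pow_le_pow_right (by decide) (by omega))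

/-! ### From the torso to the theorem -/

namespace FinDigraph

theorem IsTorso.isVertexCutSparsifier_and_iff {α : Type*} [DecidableEq α]
    {G H : FinDigraph α} {K T : Finset α} {c : ℕ} (h : G.IsTorso K H) (hT : T ⊆ K)
    (hK : ∀ A B Z, Disjoint A B → A ∪ B = T → G.IsImportantSeparator A B Z → Z.card ≤ c → Z ⊆ K) :
    G.IsVertexCutSparsifier T c H ∧ ∀ A B : Finset α, A ∪ B = T → Disjoint A B →
      ∀ X : Finset α, X ⊆ G.verts → X.card ≤ c →
        (G.IsImportantSeparator A B X ↔ X ⊆ H.verts ∧ H.IsImportantSeparator A B X) := by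
  have hAB : ∀ A B : Finset α, A ∪ B = T → A ⊆ K ∧ B ⊆ K := fun A B hu =>
    ⟨(Finset.subset_union_left.trans hu.subset).trans hT,
      (Finset.subset_union_right.trans hu.subset).trans hT⟩
  refine ⟨⟨h.verts ▸ hT, fun A B hu hd hc => ?_⟩, fun A B hu hd X _ hc => ?_⟩
  · exact h.minCutSize_eq (hAB A B hu).1 (hAB A B hu).2 (fun Z => hK A B Z hd hu) hc
  · exact h.isImportantSeparator_iff (hAB A B hu).1 (hAB A B hu).2 (fun Z => hK A B Z hd hu) hc

theorem IsImportantSeparator.eq_empty {α : Type*} [DecidableEq α] {G : FinDigraph α}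
    {B Z : Finset α} (h : G.IsImportantSeparator ∅ B Z) : Z = ∅ := by
  rw [Finset.eq_empty_iff_forall_notMem]
  intro z hz
  exact h.1.2 z hz ⟨(Finset.erase_subset _ _).trans h.1.1.1, by simp⟩

end FinDigraph

theorem mainTheorem6 :
    ∃ (κ K : ℕ) (P : RAM.Prog),
      ∀ (n : ℕ) (G : FinDigraph ℕ) (T : Finset ℕ) (c : ℕ),
        G.verts = Finset.range n → T ⊆ G.verts → 1 ≤ c →
        ∀ (es : List (ℕ × ℕ)) (ts : List ℕ),
          es.Nodup → es.toFinset = G.arcs → ts.Nodup → ts.toFinset = T →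
          ∃ (t : ℕ) (s : RAM.State) (G' : FinDigraph ℕ),
            RAM.Run P (RAM.inputState n es ts c) t s ∧
            RAM.Outputs s G' ∧
            t ≤ K * (chooseLE T.card (3 * c) * 2 ^ (κ * c) * (G.arcs.card + n) + 1) ∧
            G.IsVertexCutSparsifier T c G' ∧
            G'.verts.card ≤ chooseLE T.card (3 * c) * 2 ^ (κ * c) ∧
            T ⊆ G'.verts ∧ G'.verts ⊆ G.verts ∧
            ∀ A B : Finset ℕ, A ∪ B = T → Disjoint A B →
              ∀ X : Finset ℕ, X ⊆ G.verts → X.card ≤ c →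
                (G.IsImportantSeparator A B X ↔
                  X ⊆ G'.verts ∧ G'.IsImportantSeparator A B X) := by
  -- The exponent `9 * c` is `7 * c` for the size of the tree, `c` for the factor `c + 1` per node,
  -- and `c` for a factor `2` that absorbs additive terms such as `|T|`. The constant `1000` exceeds
  -- `30 + 500 + 240`.
  refine ⟨9, 1000, RAM.sparsify, fun n G T c hV hT hc es ts hes he hts ht => ?_⟩
  rcases T.eq_empty_or_nonempty with rfl | hne
  -- Without terminals the size bound is `0`, so the output must be the empty graph. The initial
  -- registers already encode it, and the program stops after one test.
  · have hnil : ts = [] := by simpa using ht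
    subst hnil
    have htor : G.IsTorso ∅ ⟨∅, ∅, by simp, by simp⟩ := ⟨by simp, rfl, by simp⟩
    obtain ⟨h1, h2⟩ := htor.isVertexCutSparsifier_and_iff (T := ∅) (c := c) subset_rfl
      fun A B Z _ hu hZ _ => by
      obtain ⟨rfl, rfl⟩ := Finset.union_eq_empty.1 hu
      rw [hZ.eq_empty]
    refine ⟨_, _, _, .cond_true (rfl : (RAM.inputState n es [] c).reg 2 = _) (.skip _),
      ⟨?_, ?_, ?_, ?_⟩, by omega, h1, by simp, by simp, by simp, h2⟩ <;> simp [RAM.inputState]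
  · obtain ⟨t, s, hrun, htime, H, K, hout, htor, hTK, hcard, hK⟩ :=
      RAM.exec_sparsify_of_nonempty hV hT he hts ht hne rfl
    obtain ⟨h1, h2⟩ := htor.isVertexCutSparsifier_and_iff hTK hK
    have hm : es.length = G.arcs.card := by rw [← he, List.toFinset_card_of_nodup hes]
    have htl : ts.length = T.card := by rw [← ht, List.toFinset_card_of_nodup hts]
    have hTn : T.card ≤ n := by simpa [hV] using Finset.card_le_card hT
    have hT1 : 1 ≤ T.card := hne.card_pos
    have hS := le_chooseLE T.card (a := 3 * c) (by omega)
    have hW := termWeight_le_chooseLE (c := c) hc hT1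
    have hc2 : c + 1 ≤ 2 ^ c := Nat.lt_two_pow_self
    rw [htl] at htime hcard
    rw [hm] at htime
    generalize RAM.termWeight (RAM.branchWeight (2 * c)) (3 * c) T.card = W at *
    generalize chooseLE T.card (3 * c) = S at *
    have hcW : (c + 1) * W ≤ S * 2 ^ (8 * c) := by
      calc _ ≤ 2 ^ c * (S * 2 ^ (7 * c)) := Nat.mul_le_mul hc2 hW
        _ = _ := by ring
    have hQ : 2 * (S * 2 ^ (8 * c)) ≤ S * 2 ^ (9 * c) := by
      calc _ ≤ 2 ^ c * (S * 2 ^ (8 * c)) := Nat.mul_le_mul_right _ (by omega)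
        _ = _ := by ring
    have hSQ : S ≤ S * 2 ^ (8 * c) := Nat.le_mul_of_pos_right _ (by positivity)
    have hcQ : c + 1 ≤ S * 2 ^ (8 * c) := by
      calc c + 1 ≤ 2 ^ c := hc2
        _ ≤ 2 ^ (8 * c) := Nat.pow_le_pow_right (by decide) (by omega)
        _ ≤ _ := Nat.le_mul_of_pos_left _ (by omega)
    have hcW' : c * W ≤ (c + 1) * W := Nat.mul_le_mul_right _ (by omega)
    have hKQ : T.card + c * W ≤ S * 2 ^ (9 * c) := by omega
    refine ⟨t, s, H, hrun, hout, ?_, h1, ?_, htor.verts ▸ hTK, htor.verts ▸ htor.subset, h2⟩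
    · set Q := S * 2 ^ (9 * c) with hQd
      set N := G.arcs.card + n with hN
      -- Since there is a terminal, `n ≥ 1`, so the additive `1` is absorbed.
      have hN1 : n + G.arcs.card + 1 ≤ 2 * N := by omega
      have e1 : 7 * c + 7 * G.arcs.card + 4 * T.card + 12 ≤ 30 * (Q * N) := by
        have : c ≤ Q * N := (show c ≤ Q by omega).trans (Nat.le_mul_of_pos_right _ (by omega))
        have : N ≤ Q * N := Nat.le_mul_of_pos_left _ (by omega)
        omega
      have e2 : 250 * (c + 1) * (n + G.arcs.card + 1) * W ≤ 500 * (Q * N) := by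
        calc _ = 250 * (((c + 1) * W) * (n + G.arcs.card + 1)) := by ring
          _ ≤ 250 * (Q * (2 * N)) :=
            Nat.mul_le_mul_left _ (Nat.mul_le_mul (by omega) hN1)
          _ = _ := by ring
      have e3 : (T.card + c * W + 1) * (60 * (n + G.arcs.card + 1)) ≤ 240 * (Q * N) := by
        calc _ ≤ (2 * Q) * (60 * (2 * N)) :=
            Nat.mul_le_mul (by omega) (Nat.mul_le_mul_left _ hN1)
          _ = _ := by ring
      omega
    · rw [htor.verts]
      omega
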